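/- Let $(X,\mathscr B)$ be a standard Borel space, $\mu$ a probability measure on $X$ and $f:X\to X$ a measurable map preserving $\mu$. Let $\mathcal E\to X$ be a measurable vector bundle of rank $d$ with a measurable Euclidean norm (a norm given by an inner product on each fibre), and let $F:\mathcal E\to\mathcal E$ be a measurable linear bundle morphism covering $f$, that is, a measurable family of linear maps $F_x:\mathcal E_x\to\mathcal E_{f(x)}$, which need not be invertible, such that $$\int \log^+\|F_x\|\,d\mu(x)<\infty .$$ Write $F^n_x=F_{f^{n-1}(x)}\circ\cdots\circ F_x$, let $\sigma_1(L)\ge\dots\ge\sigma_d(L)$ be the singular values of a linear map $L$, and put $\log 0=-\infty$. For $1\le k\le d$ let $\hat{\mathcal E}_k$ be the projective bundle $\mathrm P(\wedge^k\mathcal E)$ with a cemetery point $\Delta_x$ adjoined to each fibre, with projection $\pi_k:\hat{\mathcal E}_k\to X$ and $\Delta=\bigsqcup_x\Delta_x$. Define $\hat F_k(x,[v])=(f(x),[\wedge^kF_xv])$ if $\wedge^kF_xv\ne0$, and let $\hat F_k$ send $(x,[v])$ with $\wedge^kF_xv=0$, and $\Delta_x$, to $\Delta_{f(x)}$. Define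 $\hat\phi_k(x,[v])=\log(\|\wedge^kF_xv\|/\|v\|)\in[-\infty,\infty)$ and $\hat\phi_k=-\infty$ on $\Delta$; here $\wedge^k\mathcal E_x$ carries the Euclidean norm induced by that of $\mathcal E_x$. An invariant lift of $\mu$ is an $\hat F_k$-invariant measure $\hat\nu$ on $\hat{\mathcal E}_k$ with $(\pi_k)_*\hat\nu=\mu$. Then the following hold. 1. For each $i=1,\dots,d$ the limit $\lambda_i(x)=\lim_{n\to\infty}\frac1n\log\sigma_i(F^n_x)\in[-\infty,\infty)$ exists for $\mu$-almost every $x$. The Lyapunov exponents of $\mu$ are $\lambda_i(\mu)=\int\lambda_i(x)\,d\mu(x)\in[-\infty,\infty)$. If $\mu$ is ergodic, then $\lambda_i(x)=\lambda_i(\mu)$ for $\mu$-almost every $x$. 2. For every $k=1,\dots,d$, $$\sum_{i=1}^k\lambda_i(\mu)=\sup\Big\{\int\hat\phi_k\,d\hat\nu:\ \hat\nu \text{ is } \hat F_k\text{-invariant and } (\pi_k)_*\hat\nu=\mu\Big\}.$$ 3. The supremum is attained on an invariant lift of $\mu$; if $\mu$ is ergodic for $f$, it is attained on a lift that is ergodic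 for $\hat F_k$. 4. If $F$ is nonsingular, i.e. $F_x$ is injective for every $x\in X$, then 2 and 3 also hold without the cemetery section, that is, with the lifts restricted to those with $\hat\nu(\Delta)=0$ (invariant measures on $\mathrm P(\wedge^k\mathcal E)$). -/

import Mathlib

open MeasureTheory Filter Topology Bundle
open scoped LinearAlgebra.Projectivization ENNReal

universe u v

noncomputable section

/-- The extended integral `∫ φ⁺ - ∫ φ⁻ ∈ [-∞, ∞)` of a function with values in `[-∞, ∞]`,
meaningful as soon as `φ` is measurable and `∫ φ⁺ < ∞`. -/
def extIntegral {Z : Type*} [MeasurableSpace Z] (ν : Measure Z) (φ : Z → EReal) : EReal :=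
  ((∫⁻ z, (φ z).toENNReal ∂ν : ℝ≥0∞) : EReal) - ((∫⁻ z, (-φ z).toENNReal ∂ν : ℝ≥0∞) : EReal)

/-- The logarithm of a nonnegative real number, with `log 0 = -∞`. -/
def logE (r : ℝ) : EReal := ENNReal.log (ENNReal.ofReal r)

section Exterior

variable {V : Type*} [NormedAddCommGroup V] [InnerProductSpace ℝ V]

/-- The Euclidean inner product on `⋀^k V`, i.e. the bilinear form with
`⟨v₁ ∧ ⋯ ∧ v_k, w₁ ∧ ⋯ ∧ w_k⟩ = det ⟨v_i, w_j⟩` (see `extInner_ιMulti`). -/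
def extInner (k : ℕ) : ⋀[ℝ]^k V →ₗ[ℝ] ⋀[ℝ]^k V →ₗ[ℝ] ℝ :=
  exteriorPower.pairingDual ℝ V k ∘ₗ exteriorPower.map k (innerₗ V)

theorem extInner_ιMulti (k : ℕ) (v w : Fin k → V) :
    extInner k (exteriorPower.ιMulti ℝ k v) (exteriorPower.ιMulti ℝ k w) =
      Matrix.det (Matrix.of fun i j => inner ℝ (v j) (w i)) := by
  simp only [extInner, LinearMap.comp_apply, exteriorPower.map_apply_ιMulti,
    exteriorPower.pairingDual_ιMulti_ιMulti]
  rfl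

/-- The Euclidean norm on `⋀^k V` induced by the inner product of `V`. -/
def extNorm (k : ℕ) (w : ⋀[ℝ]^k V) : ℝ := Real.sqrt (extInner k w w)

end Exterior

/-- The line `[w]` spanned by a nonzero vector `w`, and the cemetery point `none` for `w = 0`. -/
def lineOrCemetery {W : Type*} [AddCommGroup W] [Module ℝ W] (w : W) : Option (ℙ ℝ W) :=
  open Classical in
  if h : w = 0 then none else some (Projectivization.mk ℝ w h)

/-- The Borel σ-algebra of a finite-dimensional real vector space with its canonical topology. -/
abbrev vectorBorel (W : Type*) [AddCommGroup W] [Module ℝ W] : MeasurableSpace W :=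
  @borel W (moduleTopology ℝ W)

section Family

variable {X : Type u} (d : ℕ) (E : X → Type v)
  [∀ x, NormedAddCommGroup (E x)] [∀ x, InnerProductSpace ℝ (E x)]

/-- The total space of a family of vector spaces that is to be a bundle of rank `d`. -/
abbrev BundleTotal (d : ℕ) (E : X → Type v) : Type (max u v) := TotalSpace (EuclideanSpace ℝ (Fin d)) E

/-- The projective bundle of `⋀^k E` with a cemetery point `none` adjoined to every fibre. -/
def ProjBundle (_d k : ℕ) (E : X → Type v) [∀ x, NormedAddCommGroup (E x)]
    [∀ x, InnerProductSpace ℝ (E x)] : Type (max u v) :=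
  Σ x, Option (ℙ ℝ (⋀[ℝ]^k (E x)))

/-- The bundle projection. -/
def ProjBundle.proj (k : ℕ) (z : ProjBundle d k E) : X := z.1

/-- The cemetery section. -/
def ProjBundle.cemetery (k : ℕ) : Set (ProjBundle d k E) := {z | z.2 = none}

variable {E} {f : X → X} (F : ∀ x, E x →ₗ[ℝ] E (f x))

/-- The map induced on the total space by a family of linear maps over `f`. -/
def totalMap (p : BundleTotal d E) : BundleTotal d E := ⟨f p.1, F p.1 p.2⟩

/-- The iterates `F^n_x = F_{f^{n-1} x} ∘ ⋯ ∘ F_x`. -/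
def cocycle : ∀ (n : ℕ) (x : X), E x →ₗ[ℝ] E (f^[n] x)
  | 0, _ => LinearMap.id
  | n + 1, x => cocycle n (f x) ∘ₗ F x

/-- The induced map of the projective bundle with cemetery: `(x, [v]) ↦ (f x, [⋀^k F_x v])` if
`⋀^k F_x v ≠ 0`, and everything else goes to the cemetery point over `f x`. -/
def projMap (k : ℕ) : ProjBundle d k E → ProjBundle d k E
  | ⟨x, none⟩ => ⟨f x, none⟩
  | ⟨x, some l⟩ => ⟨f x, lineOrCemetery (exteriorPower.map k (F x) l.rep)⟩

/-- The potential `(x, [v]) ↦ log (‖⋀^k F_x v‖ / ‖v‖)`, equal to `-∞` on the cemetery. -/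
def projPotential (k : ℕ) : ProjBundle d k E → EReal
  | ⟨_, none⟩ => ⊥
  | ⟨x, some l⟩ => logE (extNorm k (exteriorPower.map k (F x) l.rep) / extNorm k l.rep)

variable [∀ x, FiniteDimensional ℝ (E x)]

/-- `(1/n) log σ_{i+1}(F^n_x)`, where `σ_1 ≥ σ_2 ≥ ⋯` are the singular values. -/
def singularRate (i n : ℕ) (x : X) : EReal :=
  logE ((cocycle F n x).singularValues i) / (n : EReal)

/-- The pointwise Lyapunov exponent `λ_{i+1}(x) = lim (1/n) log σ_{i+1}(F^n_x)` (a limit almost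
everywhere, for an invariant measure; the upper limit is used to have a value everywhere). -/
def pointwiseExponent (i : ℕ) (x : X) : EReal :=
  limsup (fun n => singularRate F i n x) atTop

/-- The Lyapunov exponent `λ_{i+1}(μ) = ∫ λ_{i+1}(x) dμ`. -/
def lyapunovExponent [MeasurableSpace X] (μ : Measure X) (i : ℕ) : EReal :=
  extIntegral μ (pointwiseExponent F i)

end Family

section Measurability

variable {X : Type u} [MeasurableSpace X] (d : ℕ) (E : X → Type v)
  [∀ x, NormedAddCommGroup (E x)] [∀ x, InnerProductSpace ℝ (E x)]

/-- A measurable local trivialization: fibrewise linear isomorphisms `ℝ^d ≃ E_x` over a measurable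
set `U` that together form an isomorphism of measurable spaces from `U × ℝ^d` onto the part of the
total space lying over `U`. -/
structure MeasurableChart [MeasurableSpace (BundleTotal d E)] where
  base : Set X
  measurableSet_base : MeasurableSet base
  fiberEquiv : ∀ x : base, EuclideanSpace ℝ (Fin d) ≃ₗ[ℝ] E x
  measurableEmbedding : MeasurableEmbedding
    (fun p : base × EuclideanSpace ℝ (Fin d) => (⟨p.1, fiberEquiv p.1 p.2⟩ : BundleTotal d E))

/-- The family `E` of inner product spaces over `X`, with a σ-algebra on its total space, is a
measurable vector bundle of rank `d` with a measurable Euclidean norm. -/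
class IsMeasurableEuclideanBundle [MeasurableSpace (BundleTotal d E)] : Prop where
  measurable_proj : Measurable (TotalSpace.proj : BundleTotal d E → X)
  exists_charts : ∃ c : ℕ → MeasurableChart d E, ⋃ i, (c i).base = Set.univ
  measurable_norm : Measurable (fun p : BundleTotal d E => ‖p.2‖)

variable {E d} in
/-- In a chart over `U`, the map `(x, w) ↦ (x, [w])` from `U × ⋀^k ℝ^d` to the projective bundle
with cemetery (`w = 0` is sent to the cemetery). -/
def MeasurableChart.toProj [MeasurableSpace (BundleTotal d E)] (c : MeasurableChart d E) (k : ℕ)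
    (p : c.base × ⋀[ℝ]^k (EuclideanSpace ℝ (Fin d))) : ProjBundle d k E :=
  ⟨p.1, lineOrCemetery (exteriorPower.map k (c.fiberEquiv p.1).toLinearMap p.2)⟩

/-- The σ-algebra of the projective bundle with cemetery: a set is measurable when, read in every
chart of `E`, it is measurable, where the fibre carries the quotient σ-algebra of `⋀^k ℝ^d`. -/
instance ProjBundle.measurableSpace [MeasurableSpace (BundleTotal d E)] (k : ℕ) :
    MeasurableSpace (ProjBundle d k E) :=
  ⨅ c : MeasurableChart d E, MeasurableSpace.map (c.toProj k)
    (@Prod.instMeasurableSpace _ _ inferInstance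
      (vectorBorel (⋀[ℝ]^k (EuclideanSpace ℝ (Fin d)))))

variable {E} {f : X → X} (F : ∀ x, E x →ₗ[ℝ] E (f x))

/-- The measures on the projective bundle with cemetery that are invariant and project to `μ`. -/
def invariantLifts [MeasurableSpace (BundleTotal d E)] (k : ℕ) (μ : Measure X) :
    Set (Measure (ProjBundle d k E)) :=
  {ν | MeasurePreserving (projMap d F k) ν ν ∧ MeasurePreserving (ProjBundle.proj d E k) ν μ}

end Measurability

end

/-! Dividing `F_x` by `exp (log⁺ ‖F_x‖)` and reading it in a measurable orthonormal frame turns the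
morphism into a cocycle of contractions of `ℝ^d`. Minus the logarithm of a contraction ratio is a
cost in `[0, ∞]`, and the normalization only contributes Birkhoff sums of the integrable function
`log⁺ ‖F‖`. In `[0, ∞]` the value `log 0 = -∞` is just the cost `∞`, so singular maps need no
separate ergodic theory. Maximizing the potential over lifts becomes minimizing a mean cost.

Exponents: `‖⋀^k L‖` is the product of the first `k` singular values (`opNorm_exteriorPower_map`),
so the sum of the first `k` singular costs is the operator cost of `⋀^k`, which is superadditive
along orbits. Kingman's theorem in `[0, ∞]` (`superadditive_ergodic`) gives limits of these sums,
and consecutive differences give the individual exponents (`exists_rates`).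

Upper bound: a single direction costs at least as much as the operator. Integrating this over `n`
steps against an invariant lift bounds its mean cost below by the mean growth cost `c` of `⋀^k`
(`lintegral_cocycleCost_le_projCost`).

Attainment: over each `x` take a basis vector that `⋀^k F^n_x` expands almost maximally, and average
the push-forwards of this section on the unit sphere bundle. The mean cost of the average is at most
`c + O(1/n)`. After refining the topology of `X` so that all data are continuous, the lifts of `μ`
form a compact set, because the fibres are compact. The induced map is discontinuous only at kernel
directions; there the cost is infinite, so a finite bound on the mean cost makes the mass near them
uniformly small, and limits of the averages are invariant (`exists_sphere_lift`). If `c = ∞` and the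
cocycle is not injective, the measure carried by the cemetery section is optimal already.

Ergodicity: when `μ` is ergodic, the optimal lifts form a compact face of the invariant probability
measures, and an extreme point of that face is ergodic. -/

section SuperadditiveErgodic

/-! ### Kingman's theorem for superadditive sequences with values in `[0, ∞]`. -/

variable {X : Type*}

/-- Block decomposition: if off `D` some iterate up to time `N` has average at least `c`, then a
superadditive sequence grows at rate `c` up to the visits to `D`. -/
theorem superadditive_block {f : X → X} {g : ℕ → X → ℝ≥0∞}
    (hg : ∀ m n x, g m x + g n (f^[m] x) ≤ g (m + n) x) (c : ℝ≥0∞) (D : Set X) (N : ℕ) :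
    ∀ (L : ℕ) (x : X), (∀ j, f^[j] x ∉ D → ∃ n, 1 ≤ n ∧ n ≤ N ∧ n * c ≤ g n (f^[j] x)) →
      L * c ≤ g L x + c * (birkhoffSum f (D.indicator 1) L x + N) := by
  intro L
  induction L using Nat.strong_induction_on with
  | _ L ih =>
  intro x hx
  -- A final stretch of length at most `N` is paid for by the term `c * N`.
  rcases le_or_gt L N with hL | hL
  · calc (L : ℝ≥0∞) * c ≤ N * c := by gcongr
      _ = c * N := mul_comm _ _
      _ ≤ c * (birkhoffSum f (D.indicator 1) L x + N) := by gcongr; exact le_add_self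
      _ ≤ _ := le_add_self
  have hshift : ∀ n, ∀ j, f^[j] (f^[n] x) ∉ D →
      ∃ m, 1 ≤ m ∧ m ≤ N ∧ m * c ≤ g m (f^[j] (f^[n] x)) := by
    intro n j
    rw [← Function.iterate_add_apply]
    exact hx (j + n)
  -- From a point of `D` advance one step and charge `c` to the visit; otherwise jump over a whole
  -- good block.
  by_cases hD : x ∈ D
  · obtain ⟨L, rfl⟩ : ∃ L', L = 1 + L' := ⟨L - 1, by omega⟩
    have h := ih L (by omega) (f^[1] x) (hshift 1)
    rw [birkhoffSum_add, birkhoffSum_one, Set.indicator_of_mem hD]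
    push_cast
    calc (1 + (L : ℝ≥0∞)) * c = c + L * c := by ring
      _ ≤ c + (g L (f^[1] x) + c * (birkhoffSum f (D.indicator 1) L (f^[1] x) + N)) := by gcongr
      _ = g L (f^[1] x) + c * (1 + birkhoffSum f (D.indicator 1) L (f^[1] x) + N) := by ring
      _ ≤ _ := by gcongr; exacts [le_add_self.trans (hg 1 L x), le_rfl]
  · obtain ⟨n, hn1, hnN, hn⟩ := hx 0 hD
    obtain ⟨L, rfl⟩ : ∃ L', L = n + L' := ⟨L - n, by omega⟩
    have h := ih L (by omega) (f^[n] x) (hshift n)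
    rw [birkhoffSum_add]
    push_cast
    calc ((n : ℝ≥0∞) + L) * c = n * c + L * c := by ring
      _ ≤ g n x + (g L (f^[n] x) + c * (birkhoffSum f (D.indicator 1) L (f^[n] x) + N)) := by
        gcongr; exact hn
      _ = (g n x + g L (f^[n] x)) + c * (birkhoffSum f (D.indicator 1) L (f^[n] x) + N) := by ring
      _ ≤ _ := by
        gcongr
        · exact hg n L x
        · exact le_add_self

variable [MeasurableSpace X] {μ : Measure X} {f : X → X}

/-- The two functions have the same integral, which forces equality once it is finite; truncation at
`M` makes it finite. -/
theorem MeasureTheory.MeasurePreserving.ae_comp_eq_of_comp_le [IsFiniteMeasure μ]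
    (hf : MeasurePreserving f μ μ) {φ : X → ℝ≥0∞} (hφ : Measurable φ) (h : ∀ x, φ (f x) ≤ φ x) :
    φ ∘ f =ᵐ[μ] φ := by
  have key : ∀ M : ℕ, (fun x => min (φ (f x)) M) =ᵐ[μ] fun x => min (φ x) M := by
    intro M
    have hm : Measurable fun x => min (φ x) (M : ℝ≥0∞) := hφ.min measurable_const
    have e : ∫⁻ x, min (φ (f x)) M ∂μ = ∫⁻ x, min (φ x) M ∂μ := hf.lintegral_comp hm
    refine ae_eq_of_ae_le_of_lintegral_le (.of_forall fun x => min_le_min_right _ (h x)) ?_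
      hm.aemeasurable e.ge
    refine ne_top_of_le_ne_top (b := ∫⁻ _, (M : ℝ≥0∞) ∂μ) ?_
      (lintegral_mono fun x => min_le_right _ _)
    simp [ENNReal.mul_eq_top]
  filter_upwards [ae_all_iff.2 key] with x hx
  refine le_antisymm (h x) ?_
  refine ENNReal.le_of_forall_nnreal_lt fun r hr => ?_
  obtain ⟨n, hn⟩ := exists_nat_ge r
  have := hx n
  have h2 : (r : ℝ≥0∞) ≤ min (φ x) n := le_min hr.le (by exact_mod_cast hn)
  rw [← this] at h2
  exact h2.trans (min_le_left _ _)

theorem measurable_birkhoffSum {φ : X → ℝ≥0∞} (hφ : Measurable φ) (hf : Measurable f) (n : ℕ) :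
    Measurable (birkhoffSum f φ n) := by
  unfold birkhoffSum
  exact Finset.measurable_sum _ fun i _ => hφ.comp (hf.iterate i)

theorem MeasureTheory.MeasurePreserving.lintegral_birkhoffSum (hf : MeasurePreserving f μ μ)
    {φ : X → ℝ≥0∞} (hφ : Measurable φ) (n : ℕ) :
    ∫⁻ x, birkhoffSum f φ n x ∂μ = n * ∫⁻ x, φ x ∂μ := by
  simp only [birkhoffSum]
  rw [lintegral_finsetSum (f := fun k x => φ (f^[k] x)) _ fun i _ => hφ.comp (hf.measurable.iterate i)]
  simp [(hf.iterate _).lintegral_comp hφ]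

omit [MeasurableSpace X] in
theorem superadditive_comp_le {g : ℕ → X → ℝ≥0∞}
    (hg : ∀ m n x, g m x + g n (f^[m] x) ≤ g (m + n) x) (n : ℕ) (x : X) :
    g n (f x) ≤ g (n + 1) x := by
  rw [add_comm]
  exact le_add_self.trans (hg 1 n x)

theorem ENNReal.tendsto_natCast_succ_div : Tendsto (fun n : ℕ => ((n + 1 : ℕ) : ℝ≥0∞) / n) atTop (𝓝 1) := by
  have h : Tendsto (fun n : ℕ => 1 + (n : ℝ≥0∞)⁻¹) atTop (𝓝 (1 + 0)) :=
    tendsto_const_nhds.add ENNReal.tendsto_inv_nat_nhds_zero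
  rw [add_zero] at h
  refine h.congr' ?_
  filter_upwards [eventually_gt_atTop 0] with n hn
  have h0 : (n : ℝ≥0∞) ≠ 0 := by exact_mod_cast hn.ne'
  rw [Nat.cast_add, Nat.cast_one, ENNReal.add_div, ENNReal.div_self h0 (by simp), one_div]

theorem ENNReal.tendsto_natCast_div_succ : Tendsto (fun n : ℕ => (n : ℝ≥0∞) / ((n + 1 : ℕ) : ℝ≥0∞)) atTop (𝓝 1) := by
  have h := ENNReal.tendsto_natCast_succ_div.inv
  rw [inv_one] at h
  refine h.congr' ?_
  filter_upwards [eventually_gt_atTop 0] with n hn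
  have h0 : (n : ℝ≥0∞) ≠ 0 := by exact_mod_cast hn.ne'
  rw [ENNReal.inv_div (.inl (by simp)) (.inl h0)]

-- Superadditivity gives `g n (f x) ≤ g (n + 1) x`, and `(n + 1) / n → 1`. This inequality is enough
-- for almost everywhere invariance.
omit [MeasurableSpace X] in
theorem limsup_superadditive_comp_le {g : ℕ → X → ℝ≥0∞}
    (hg : ∀ m n x, g m x + g n (f^[m] x) ≤ g (m + n) x) (x : X) :
    limsup (fun n => g n (f x) / n) atTop ≤ limsup (fun n => g n x / n) atTop := by
  have e : limsup (fun n => g n x / n) atTop = limsup (fun n => g (n + 1) x / (n + 1 : ℕ)) atTop :=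
    (limsup_nat_add (fun n => g n x / n) 1).symm
  have hl : limsup (fun n : ℕ => ((n + 1 : ℕ) : ℝ≥0∞) / n) atTop = 1 :=
    ENNReal.tendsto_natCast_succ_div.limsup_eq
  rw [e]
  calc limsup (fun n => g n (f x) / n) atTop
      ≤ limsup ((fun n : ℕ => ((n + 1 : ℕ) : ℝ≥0∞) / n) * fun n => g (n + 1) x / (n + 1 : ℕ)) atTop := by
        refine limsup_le_limsup (.of_forall fun n => ?_)
        simp only [Pi.mul_apply]
        have h0 : ((n + 1 : ℕ) : ℝ≥0∞) ≠ 0 := by simp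
        rw [mul_comm, ← mul_div_assoc, ENNReal.div_mul_cancel h0 (by simp)]
        gcongr
        exact superadditive_comp_le hg n x
    _ ≤ _ := by
        refine (ENNReal.limsup_mul_le' ?_ ?_).trans ?_ <;> rw [hl]
        · exact .inl one_ne_zero
        · exact .inl ENNReal.one_ne_top
        · rw [one_mul]

omit [MeasurableSpace X] in
theorem liminf_superadditive_comp_le {g : ℕ → X → ℝ≥0∞}
    (hg : ∀ m n x, g m x + g n (f^[m] x) ≤ g (m + n) x) (x : X) :
    liminf (fun n => g n (f x) / n) atTop ≤ liminf (fun n => g n x / n) atTop := by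
  have e : liminf (fun n => g n x / n) atTop = liminf (fun n => g (n + 1) x / (n + 1 : ℕ)) atTop :=
    (liminf_nat_add (fun n => g n x / n) 1).symm
  have hl : liminf (fun n : ℕ => (n : ℝ≥0∞) / ((n + 1 : ℕ) : ℝ≥0∞)) atTop = 1 :=
    ENNReal.tendsto_natCast_div_succ.liminf_eq
  rw [e]
  calc liminf (fun n => g n (f x) / n) atTop
      = liminf (fun n : ℕ => (n : ℝ≥0∞) / ((n + 1 : ℕ) : ℝ≥0∞)) atTop * liminf (fun n => g n (f x) / n) atTop := by
        rw [hl, one_mul]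
    _ ≤ liminf ((fun n : ℕ => (n : ℝ≥0∞) / ((n + 1 : ℕ) : ℝ≥0∞)) * fun n => g n (f x) / n) atTop :=
        ENNReal.le_liminf_mul
    _ ≤ _ := by
        refine liminf_le_liminf ?_
        filter_upwards [eventually_gt_atTop 0] with n hn
        have h0 : (n : ℝ≥0∞) ≠ 0 := by exact_mod_cast hn.ne'
        simp only [Pi.mul_apply]
        rw [mul_comm, ← mul_div_assoc, ENNReal.div_mul_cancel h0 (by simp)]
        gcongr
        exact superadditive_comp_le hg n x

/-- Slightly below the limsup, almost every orbit is cut into blocks of bounded length on which the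
average is large, apart from visits to a set of small measure. Integrating over a long orbit segment
and dividing by its length gives the bound. -/
theorem lintegral_limsup_superadditive_le [IsFiniteMeasure μ] (hf : MeasurePreserving f μ μ)
    {g : ℕ → X → ℝ≥0∞} (hgm : ∀ n, Measurable (g n))
    (hg : ∀ m n x, g m x + g n (f^[m] x) ≤ g (m + n) x) {I : ℝ≥0∞}
    (hI : ∀ n, 0 < n → ∫⁻ x, g n x ∂μ ≤ n * I) :
    ∫⁻ x, limsup (fun n => g n x / n) atTop ∂μ ≤ I := by
  set G : X → ℝ≥0∞ := fun x => limsup (fun n => g n x / n) atTop with hG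
  have hGm : Measurable G := .limsup fun n => (hgm n).div_const _
  have hinv : G ∘ f =ᵐ[μ] G := hf.ae_comp_eq_of_comp_le hGm (limsup_superadditive_comp_le hg)
  -- The block decomposition uses one threshold along the whole orbit.
  have horb : ∀ᵐ x ∂μ, ∀ j, G (f^[j] x) = G x := by
    have h1 : ∀ᵐ x ∂μ, ∀ j, G (f (f^[j] x)) = G (f^[j] x) :=
      ae_all_iff.2 fun j => (hf.iterate j).quasiMeasurePreserving.ae hinv
    filter_upwards [h1] with x hx j
    induction j with
    | zero => rfl
    | succ j ih => rw [Function.iterate_succ_apply', hx j, ih]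
  -- the truncated estimate
  have key : ∀ (r : NNReal) (M : ℕ), r < 1 → r * ∫⁻ x, min (G x) M ∂μ ≤ I := by
    intro r M hr
    set φ : X → ℝ≥0∞ := fun x => r * min (G x) M with hφ
    have hφm : Measurable φ := (hGm.min measurable_const).const_mul _
    have hφM : ∀ x, φ x ≤ M := fun x => by
      calc φ x ≤ 1 * M := by
            simp only [hφ]; gcongr
            · exact_mod_cast hr.le
            · exact min_le_right _ _
        _ = M := one_mul _
    set D : ℕ → Set X := fun N => {x | ∀ n, 1 ≤ n → n ≤ N → g n x < n * φ x} with hD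
    have hDm : ∀ N, MeasurableSet (D N) := by
      intro N
      have : D N = ⋂ n, ⋂ (_ : 1 ≤ n), ⋂ (_ : n ≤ N), {x | g n x < n * φ x} := by
        ext x; simp [hD]
      rw [this]
      refine .iInter fun n => .iInter fun _ => .iInter fun _ => ?_
      exact measurableSet_lt (hgm n) (hφm.const_mul _)
    have hD0 : Tendsto (fun N => μ (D N)) atTop (𝓝 0) := by
      -- A point in every `D N` would have `G ≤ φ`. But `φ` is positive there by the case `n = 1`,
      -- hence strictly below `G` since `r < 1`.
      have hempty : ⋂ N, D N = ∅ := by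
        refine Set.eq_empty_iff_forall_notMem.2 fun x hx => ?_
        have hx' : ∀ n, 1 ≤ n → g n x < n * φ x := fun n hn =>
          (Set.mem_iInter.1 hx n) n hn le_rfl
        have hle : G x ≤ φ x := by
          refine limsup_le_of_le (by isBoundedDefault) ?_
          filter_upwards [eventually_ge_atTop 1] with n hn
          refine ENNReal.div_le_of_le_mul ?_
          rw [mul_comm]
          exact (hx' n hn).le
        have hpos : φ x ≠ 0 := fun h0 => by simpa [h0] using hx' 1 le_rfl
        have hmin0 : min (G x) (M : ℝ≥0∞) ≠ 0 := fun h0 => hpos (by simp [hφ, h0])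
        have : φ x < min (G x) M := by
          have := ENNReal.mul_lt_mul_left (a := min (G x) M) (b := (r : ℝ≥0∞)) (c := 1) hmin0
            (ne_top_of_le_ne_top (by simp) (min_le_right _ _)) (by exact_mod_cast hr)
          simpa [hφ, mul_comm] using this
        exact absurd (hle.trans_lt (this.trans_le (min_le_left _ _))) (lt_irrefl _)
      rw [← measure_empty (μ := μ), ← hempty]
      refine tendsto_measure_iInter_atTop (fun N => (hDm N).nullMeasurableSet) ?_
        ⟨0, measure_ne_top _ _⟩
      intro a b hab x hx n h1 h2
      exact hx n h1 (h2.trans hab)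
    have hN : ∀ N, 1 ≤ N → ∫⁻ x, φ x ∂μ ≤ I + M * μ (D N) := by
      intro N hN1
      have hL : ∀ L : ℕ, 0 < L →
          -- Integrated block estimate divided by `L`. The last term, from the unfinished final
          -- block, vanishes as `L → ∞`; then `N → ∞` removes the visits to `D N`.
          ∫⁻ x, φ x ∂μ ≤ I + M * μ (D N) + M * N * μ Set.univ * (L : ℝ≥0∞)⁻¹ := by
        intro L hL
        have hL0 : (L : ℝ≥0∞) ≠ 0 := by exact_mod_cast hL.ne'
        have hpt : ∀ᵐ x ∂μ, L * φ x ≤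
            g L x + M * (birkhoffSum f ((D N).indicator 1) L x + N) := by
          filter_upwards [horb] with x hx
          have hφx : ∀ j, φ (f^[j] x) = φ x := fun j => by simp only [hφ, hx j]
          refine (superadditive_block hg (φ x) (D N) N L x fun j hj => ?_).trans ?_
          · simp only [hD, Set.mem_ofPred_eq, not_forall, not_lt, hφx] at hj
            obtain ⟨n, h1, h2, h3⟩ := hj
            exact ⟨n, h1, h2, h3⟩
          · gcongr
            exact hφM x
        have hind : Measurable ((D N).indicator (1 : X → ℝ≥0∞)) :=
          measurable_one.indicator (hDm N)
        have hint := lintegral_mono_ae hpt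
        rw [lintegral_const_mul _ hφm, lintegral_add_left (hgm L),
          lintegral_const_mul _ ((measurable_birkhoffSum hind hf.measurable L).add_const _),
          lintegral_add_left (measurable_birkhoffSum hind hf.measurable L),
          hf.lintegral_birkhoffSum hind, lintegral_indicator_one (hDm N), lintegral_const] at hint
        have h2 := hint.trans (add_le_add_left (hI L hL) _)
        have h3 : (L : ℝ≥0∞) * ∫⁻ x, φ x ∂μ ≤
            L * (I + M * μ (D N) + M * N * μ Set.univ * (L : ℝ≥0∞)⁻¹) := by
          refine h2.trans (le_of_eq ?_)
          have : (L : ℝ≥0∞) * (L : ℝ≥0∞)⁻¹ = 1 := ENNReal.mul_inv_cancel hL0 (by simp)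
          calc _ = L * I + L * (M * μ (D N)) + M * N * μ Set.univ * 1 := by ring
            _ = _ := by rw [← this]; ring
        exact (ENNReal.mul_le_mul_iff_right hL0 (by simp)).1 h3
      have hlim : Tendsto (fun L : ℕ => I + M * μ (D N) + M * N * μ Set.univ * (L : ℝ≥0∞)⁻¹) atTop
          (𝓝 (I + M * μ (D N) + M * N * μ Set.univ * 0)) :=
        tendsto_const_nhds.add (ENNReal.Tendsto.const_mul ENNReal.tendsto_inv_nat_nhds_zero
          (.inr (ENNReal.mul_ne_top (by finiteness) (measure_ne_top _ _))))
      rw [mul_zero, add_zero] at hlim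
      exact ge_of_tendsto hlim ((eventually_gt_atTop 0).mono hL)
    have hlim : Tendsto (fun N => I + M * μ (D N)) atTop (𝓝 (I + M * 0)) :=
      tendsto_const_nhds.add (ENNReal.Tendsto.const_mul hD0 (.inr (by simp)))
    rw [mul_zero, add_zero] at hlim
    have := ge_of_tendsto hlim ((eventually_ge_atTop 1).mono hN)
    rwa [lintegral_const_mul _ (hGm.min measurable_const)] at this
  have key2 : ∀ M : ℕ, ∫⁻ x, min (G x) M ∂μ ≤ I := by
    intro M
    refine ENNReal.le_of_forall_nnreal_lt fun t ht => ?_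
    by_contra hcon
    push Not at hcon
    rcases eq_or_ne t 0 with rfl | ht0
    · simp at hcon
    obtain ⟨s, hs1, hs2⟩ := ENNReal.lt_iff_exists_nnreal_btwn.1 ht
    have hs1' : t < s := by exact_mod_cast hs1
    have hs0 : s ≠ 0 := (pos_of_gt hs1').ne'
    have h := key (t / s) M (by rw [div_lt_one (pos_of_gt hs1')]; exact hs1')
    have : ((t / s : NNReal) : ℝ≥0∞) * s ≤ I := (by gcongr : _ ≤ _).trans h
    rw [← ENNReal.coe_mul, div_mul_cancel₀ _ hs0] at this
    exact absurd (this.trans_lt hcon) (lt_irrefl _)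
  have hmono : ∫⁻ x, G x ∂μ = ⨆ M : ℕ, ∫⁻ x, min (G x) M ∂μ := by
    rw [← lintegral_iSup (fun M => hGm.min measurable_const)]
    · refine lintegral_congr fun x => ?_
      refine le_antisymm (ENNReal.le_of_forall_nnreal_lt fun t ht => ?_)
        (iSup_le fun _ => min_le_left _ _)
      obtain ⟨n, hn⟩ := exists_nat_ge t
      exact (le_min ht.le (by exact_mod_cast hn)).trans (le_iSup (fun M : ℕ => min (G x) (M : ℝ≥0∞)) n)
    · intro a b hab x
      exact min_le_min_left _ (by exact_mod_cast hab)
  rw [hmono]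
  exact iSup_le key2

/-- For the truncation `ξ = min φ M`, the limsup bound applied to the complement `M - ξ` is a liminf
bound for `ξ`; then `M → ∞` by monotone convergence. -/
theorem lintegral_le_lintegral_liminf_birkhoffSum [IsFiniteMeasure μ] (hf : MeasurePreserving f μ μ)
    {φ : X → ℝ≥0∞} (hφ : Measurable φ) :
    ∫⁻ x, φ x ∂μ ≤ ∫⁻ x, liminf (fun n => birkhoffSum f φ n x / n) atTop ∂μ := by
  have bounded : ∀ M : ℕ, ∫⁻ x, min (φ x) M ∂μ ≤
      ∫⁻ x, liminf (fun n => birkhoffSum f (fun x => min (φ x) M) n x / n) atTop ∂μ := by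
    intro M
    set ξ : X → ℝ≥0∞ := fun x => min (φ x) M with hξ
    set ψ : X → ℝ≥0∞ := fun x => M - ξ x with hψ
    have hξm : Measurable ξ := hφ.min measurable_const
    have hψm : Measurable ψ := measurable_const.sub hξm
    have hadd : ∀ x, ψ x + ξ x = M := fun x => tsub_add_cancel_of_le (min_le_right _ _)
    have hsum : ∀ n x, birkhoffSum f ψ n x + birkhoffSum f ξ n x = n * M := by
      intro n x
      simp [birkhoffSum, ← Finset.sum_add_distrib, hadd]
    have h1 := lintegral_limsup_superadditive_le hf (g := birkhoffSum f ψ) (I := ∫⁻ x, ψ x ∂μ)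
      (fun n => measurable_birkhoffSum hψm hf.measurable n)
      (fun m n x => (birkhoffSum_add f ψ m n x).ge)
      (fun n _ => (hf.lintegral_birkhoffSum hψm n).le)
    have hpt : ∀ x, (M : ℝ≥0∞) ≤ limsup (fun n => birkhoffSum f ψ n x / n) atTop +
        liminf (fun n => birkhoffSum f ξ n x / n) atTop := by
      intro x
      refine ENNReal.le_of_forall_pos_le_add fun ε hε hfin => ?_
      set S := limsup (fun n => birkhoffSum f ψ n x / n) atTop
      have hS : S ≠ ∞ := ne_top_of_le_ne_top hfin.ne le_self_add
      have hlt : S < S + ε := ENNReal.lt_add_right hS (by exact_mod_cast hε.ne')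
      have hev := eventually_lt_of_limsup_lt hlt
      have : (M : ℝ≥0∞) - (S + ε) ≤ liminf (fun n => birkhoffSum f ξ n x / n) atTop := by
        refine le_liminf_of_le (by isBoundedDefault) ?_
        filter_upwards [hev, eventually_gt_atTop 0] with n hn hn0
        have h0 : (n : ℝ≥0∞) ≠ 0 := by exact_mod_cast hn0.ne'
        have : (M : ℝ≥0∞) = birkhoffSum f ψ n x / n + birkhoffSum f ξ n x / n := by
          rw [← ENNReal.add_div, hsum, mul_comm, ENNReal.mul_div_cancel_right h0 (by simp)]
        rw [tsub_le_iff_left, this]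
        gcongr
      rw [tsub_le_iff_left] at this
      exact this.trans (le_of_eq (by ring))
    have h2 : ∫⁻ _, (M : ℝ≥0∞) ∂μ ≤ ∫⁻ x, ψ x ∂μ +
        ∫⁻ x, liminf (fun n => birkhoffSum f ξ n x / n) atTop ∂μ := by
      refine (lintegral_mono hpt).trans ?_
      rw [lintegral_add_left (.limsup fun n =>
        (measurable_birkhoffSum hψm hf.measurable n).div_const _)]
      gcongr
    have h3 : ∫⁻ _, (M : ℝ≥0∞) ∂μ = ∫⁻ x, ψ x ∂μ + ∫⁻ x, ξ x ∂μ := by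
      rw [← lintegral_add_left hψm]
      exact lintegral_congr fun x => (hadd x).symm
    rw [h3] at h2
    have hfin : ∫⁻ x, ψ x ∂μ ≠ ∞ := by
      refine ne_top_of_le_ne_top (b := ∫⁻ _, (M : ℝ≥0∞) ∂μ) ?_ (lintegral_mono fun x => tsub_le_self)
      simp [ENNReal.mul_eq_top]
    exact (ENNReal.add_le_add_iff_left hfin).1 h2
  have hmono : ∫⁻ x, φ x ∂μ = ⨆ M : ℕ, ∫⁻ x, min (φ x) M ∂μ := by
    rw [← lintegral_iSup (fun M => hφ.min measurable_const)]
    · refine lintegral_congr fun x => ?_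
      refine le_antisymm (ENNReal.le_of_forall_nnreal_lt fun t ht => ?_)
        (iSup_le fun _ => min_le_left _ _)
      obtain ⟨n, hn⟩ := exists_nat_ge t
      exact (le_min ht.le (by exact_mod_cast hn)).trans (le_iSup (fun M : ℕ => min (φ x) (M : ℝ≥0∞)) n)
    · intro a b hab x
      exact min_le_min_left _ (by exact_mod_cast hab)
  rw [hmono]
  refine iSup_le fun M => (bounded M).trans (lintegral_mono fun x => ?_)
  refine liminf_le_liminf (.of_forall fun n => ?_)
  simp only [birkhoffSum]
  gcongr
  exact min_le_left _ _

omit [MeasurableSpace X] in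
theorem birkhoffSum_iterate_le_superadditive {g : ℕ → X → ℝ≥0∞}
    (hg : ∀ m n x, g m x + g n (f^[m] x) ≤ g (m + n) x) (m q : ℕ) (x : X) :
    birkhoffSum f^[m] (g m) q x ≤ g (m * q) x := by
  induction q generalizing x with
  | zero => simp
  | succ q ih =>
    rw [birkhoffSum_succ']
    calc g m x + birkhoffSum f^[m] (g m) q (f^[m] x) ≤ g m x + g (m * q) (f^[m] x) := by
          gcongr; exact ih _
      _ ≤ g (m + m * q) x := hg _ _ _
      _ = g (m * (q + 1)) x := by congr 1; ring

/-- `g (m * q)` dominates the Birkhoff sum of `g m` under `f^[m]`, so the additive liminf bound for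
`f^[m]` applies. -/
theorem lintegral_superadditive_le_lintegral_liminf [IsFiniteMeasure μ]
    (hf : MeasurePreserving f μ μ) {g : ℕ → X → ℝ≥0∞} (hgm : ∀ n, Measurable (g n))
    (hg : ∀ m n x, g m x + g n (f^[m] x) ≤ g (m + n) x) {m : ℕ} (hm : 0 < m) :
    ∫⁻ x, g m x ∂μ ≤ m * ∫⁻ x, liminf (fun n => g n x / n) atTop ∂μ := by
  have hm0 : (m : ℝ≥0∞) ≠ 0 := by exact_mod_cast hm.ne'
  rw [← lintegral_const_mul _ (.liminf fun n => (hgm n).div_const _)]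
  refine (lintegral_le_lintegral_liminf_birkhoffSum (hf.iterate m) (hgm m)).trans
    (lintegral_mono fun x => ?_)
  have hmono : ∀ a b, a ≤ b → g a x ≤ g b x := by
    intro a b hab
    obtain ⟨c, rfl⟩ := Nat.exists_eq_add_of_le hab
    exact le_self_add.trans (hg a c x)
  have hl : liminf (fun n : ℕ => (n : ℝ≥0∞) / ((n + 1 : ℕ) : ℝ≥0∞)) atTop = 1 :=
    ENNReal.tendsto_natCast_div_succ.liminf_eq
  set u : ℕ → ℝ≥0∞ := fun q => birkhoffSum f^[m] (g m) q x / q with hu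
  -- The factor `q / (q + 1) → 1` allows for the times `n` strictly between `m * q` and `m * (q +
  -- 1)`.
  set w : ℕ → ℝ≥0∞ := fun q => ((q : ℝ≥0∞) / ((q + 1 : ℕ) : ℝ≥0∞)) * u q with hw
  calc liminf u atTop
      = liminf (fun n : ℕ => (n : ℝ≥0∞) / ((n + 1 : ℕ) : ℝ≥0∞)) atTop * liminf u atTop := by
        rw [hl, one_mul]
    _ ≤ liminf w atTop := ENNReal.le_liminf_mul
    _ ≤ liminf (fun n => w (n / m)) atTop :=
        (Nat.tendsto_div_const_atTop hm.ne').liminf_le_liminf_comp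
    _ ≤ liminf (fun n => m * (g n x / n)) atTop := by
        refine liminf_le_liminf ?_
        filter_upwards [eventually_ge_atTop m] with n hn
        have hq : 0 < n / m := Nat.div_pos hn hm
        have hq0 : ((n / m : ℕ) : ℝ≥0∞) ≠ 0 := by exact_mod_cast hq.ne'
        have h1 : w (n / m) ≤ g n x / ((n / m + 1 : ℕ) : ℝ≥0∞) := by
          simp only [hw, hu]
          rw [mul_comm, ← mul_div_assoc, ENNReal.div_mul_cancel hq0 (by simp)]
          gcongr
          exact (birkhoffSum_iterate_le_superadditive hg m _ x).trans
            (hmono _ _ (Nat.mul_div_le n m))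
        refine h1.trans ?_
        have hlt : n ≤ m * (n / m + 1) := (Nat.lt_mul_div_succ n hm).le
        rw [← mul_div_assoc]
        have hn0 : (n : ℝ≥0∞) ≠ 0 := by exact_mod_cast (hm.trans_le hn).ne'
        rw [ENNReal.le_div_iff_mul_le (.inl hn0) (.inl (by simp))]
        calc g n x / ((n / m + 1 : ℕ) : ℝ≥0∞) * n
            ≤ g n x / ((n / m + 1 : ℕ) : ℝ≥0∞) * (m * (n / m + 1 : ℕ)) := by
              gcongr; exact_mod_cast hlt
          _ = m * (g n x / ((n / m + 1 : ℕ) : ℝ≥0∞) * (n / m + 1 : ℕ)) := by ring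
          _ = m * g n x := by rw [ENNReal.div_mul_cancel (by simp) (by finiteness)]
    _ = m * liminf (fun n => g n x / n) atTop :=
        ENNReal.liminf_const_mul_of_ne_top (by simp)

/-- **Kingman's theorem** for nonnegative superadditive sequences with values in `[0, ∞]`. -/
theorem superadditive_ergodic [IsFiniteMeasure μ] (hf : MeasurePreserving f μ μ)
    {g : ℕ → X → ℝ≥0∞} (hgm : ∀ n, Measurable (g n))
    (hg : ∀ m n x, g m x + g n (f^[m] x) ≤ g (m + n) x) :
    ∃ G : X → ℝ≥0∞, Measurable G ∧ G ∘ f =ᵐ[μ] G ∧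
      (∀ᵐ x ∂μ, Tendsto (fun n => g n x / n) atTop (𝓝 (G x))) ∧
      (∀ n, 0 < n → ∫⁻ x, g n x ∂μ ≤ n * ∫⁻ x, G x ∂μ) ∧
      ∀ I, (∀ n, 0 < n → ∫⁻ x, g n x ∂μ ≤ n * I) → ∫⁻ x, G x ∂μ ≤ I := by
  set G : X → ℝ≥0∞ := fun x => limsup (fun n => g n x / n) atTop with hG
  set H : X → ℝ≥0∞ := fun x => liminf (fun n => g n x / n) atTop with hH
  have hGm : Measurable G := .limsup fun n => (hgm n).div_const _
  have hHm : Measurable H := .liminf fun n => (hgm n).div_const _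
  have hle : ∀ x, H x ≤ G x := fun x => liminf_le_limsup
  have hHinv : H ∘ f =ᵐ[μ] H := hf.ae_comp_eq_of_comp_le hHm (liminf_superadditive_comp_le hg)
  -- On the almost invariant set `{H ≤ M}` the two integral bounds give `∫ G ≤ ∫ H < ∞`, while `H ≤
  -- G` pointwise.
  have heqM : ∀ M : ℕ, ∀ᵐ x ∂μ, H x ≤ M → H x = G x := by
    intro M
    set A : Set X := {x | H x ≤ M} with hA
    have hAm : MeasurableSet A := measurableSet_le hHm measurable_const
    have hAinv : f ⁻¹' A =ᵐ[μ] A := by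
      filter_upwards [hHinv] with x hx
      apply propext
      change H (f x) ≤ M ↔ H x ≤ M
      rw [← hx, Function.comp_apply]
    have hfA : MeasurePreserving f (μ.restrict A) (μ.restrict A) := by
      have := hf.restrict_preimage hAm
      rwa [Measure.restrict_congr_set hAinv] at this
    have h1 := lintegral_limsup_superadditive_le hfA hgm hg
      (fun n hn => lintegral_superadditive_le_lintegral_liminf hfA hgm hg hn)
    have hfin : ∫⁻ x in A, H x ∂μ ≠ ∞ := by
      refine ne_top_of_le_ne_top (b := ∫⁻ _ in A, (M : ℝ≥0∞) ∂μ) ?_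
        (setLIntegral_mono measurable_const fun x hx => hx)
      simp [ENNReal.mul_eq_top]
    have := ae_eq_of_ae_le_of_lintegral_le (.of_forall hle) hfin hGm.aemeasurable h1
    exact (ae_restrict_iff' hAm).1 this
  have heq : ∀ᵐ x ∂μ, H x = G x := by
    filter_upwards [ae_all_iff.2 heqM] with x hx
    rcases eq_or_ne (H x) ∞ with h | h
    · exact le_antisymm (hle x) (by rw [h]; exact le_top)
    · obtain ⟨M, hM⟩ := ENNReal.exists_nat_gt h
      exact hx M hM.le
  refine ⟨G, hGm, hf.ae_comp_eq_of_comp_le hGm (limsup_superadditive_comp_le hg), ?_, ?_, ?_⟩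
  · filter_upwards [heq] with x hx
    exact tendsto_of_liminf_eq_limsup hx rfl
  · intro n hn
    refine (lintegral_superadditive_le_lintegral_liminf hf hgm hg hn).trans ?_
    gcongr with x
    exact hle x
  · exact fun I hI => lintegral_limsup_superadditive_le hf hgm hg hI

end SuperadditiveErgodic

/-! ### Logarithmic costs of contraction ratios. -/

section NegLog

/-- The cost `-log r` of a contraction ratio `r ∈ [0, 1]`, as an element of `[0, ∞]`. -/
noncomputable def negLog (r : ℝ) : ℝ≥0∞ := (-(logE r)).toENNReal

theorem negLog_zero : negLog 0 = ∞ := by simp [negLog, logE]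

theorem negLog_one : negLog 1 = 0 := by simp [negLog, logE]

theorem logE_mono : Monotone logE := fun _ _ h => ENNReal.log_monotone (ENNReal.ofReal_le_ofReal h)

theorem logE_mul {r s : ℝ} (hr : 0 ≤ r) : logE (r * s) = logE r + logE s := by
  rw [logE, ENNReal.ofReal_mul hr, ENNReal.log_mul_add]; rfl

theorem logE_ne_top (r : ℝ) : logE r ≠ ⊤ := by
  rw [logE, Ne, ENNReal.log_eq_top_iff]
  exact ENNReal.ofReal_ne_top

theorem logE_nonpos {r : ℝ} (hr : r ≤ 1) : logE r ≤ 0 := by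
  rw [logE, ENNReal.log_le_zero_iff]
  exact ENNReal.ofReal_le_one.2 hr

theorem logE_of_pos {r : ℝ} (hr : 0 < r) : logE r = Real.log r := ENNReal.log_ofReal_of_pos hr

theorem negLog_anti : Antitone negLog := fun _ _ h =>
  EReal.toENNReal_le_toENNReal (EReal.neg_le_neg_iff.2 (logE_mono h))

theorem coe_negLog {r : ℝ} (hr : r ≤ 1) : (negLog r : EReal) = -logE r :=
  EReal.coe_toENNReal (EReal.neg_nonneg.2 (logE_nonpos hr))

theorem negLog_of_pos {r : ℝ} (hr : 0 < r) : negLog r = ENNReal.ofReal (-Real.log r) := by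
  rw [negLog, logE_of_pos hr, ← EReal.coe_neg, EReal.real_coe_toENNReal]

theorem negLog_ne_top {r : ℝ} (hr : 0 < r) : negLog r ≠ ∞ := by
  rw [negLog_of_pos hr]; exact ENNReal.ofReal_ne_top

/-- Both logarithms are nonpositive, so taking positive parts loses nothing, even when a factor
vanishes. -/
theorem negLog_mul {r s : ℝ} (hr : 0 ≤ r) (hr1 : r ≤ 1) (hs1 : s ≤ 1) :
    negLog (r * s) = negLog r + negLog s := by
  rw [negLog, logE_mul hr, EReal.neg_add (.inr (logE_ne_top s)) (.inl (logE_ne_top r)),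
    sub_eq_add_neg,
    EReal.toENNReal_add (EReal.neg_nonneg.2 (logE_nonpos hr1)) (EReal.neg_nonneg.2 (logE_nonpos hs1))]
  rfl

theorem continuous_logE : Continuous logE :=
  ENNReal.continuous_log.comp ENNReal.continuous_ofReal

theorem continuous_negLog : Continuous negLog :=
  EReal.continuous_toENNReal.comp (continuous_neg.comp continuous_logE)

theorem negLog_prod {ι : Type*} (s : Finset ι) (r : ι → ℝ) (h0 : ∀ i ∈ s, 0 ≤ r i)
    (h1 : ∀ i ∈ s, r i ≤ 1) : negLog (∏ i ∈ s, r i) = ∑ i ∈ s, negLog (r i) := by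
  classical
  induction s using Finset.induction_on with
  | empty => simp [negLog_one]
  | insert a s ha ih =>
    rw [Finset.prod_insert ha, Finset.sum_insert ha, negLog_mul (h0 a (by simp)) (h1 a (by simp)),
      ih (fun i hi => h0 i (by simp [hi])) (fun i hi => h1 i (by simp [hi]))]
    exact Finset.prod_le_one (fun i hi => h0 i (by simp [hi])) (fun i hi => h1 i (by simp [hi]))

end NegLog

/-! ### Making measurable dynamics continuous. -/

section PolishRefinement

/-- A measurable self-map of a standard Borel space and a measurable map to a second countable
space become continuous for a suitable Polish topology. -/
theorem exists_polishSpace_continuous {X Y : Type*} [MeasurableSpace X] [StandardBorelSpace X]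
    [TopologicalSpace Y] [SecondCountableTopology Y] [MeasurableSpace Y] [OpensMeasurableSpace Y]
    {f : X → X} (hf : Measurable f) {φ : X → Y} (hφ : Measurable φ) :
    ∃ t : TopologicalSpace X, PolishSpace X ∧ BorelSpace X ∧ Continuous f ∧ Continuous φ := by
  have step : ∀ t₀ : {t : TopologicalSpace X // @PolishSpace X t ∧ @BorelSpace X t _},
      ∃ t' : {t : TopologicalSpace X // @PolishSpace X t ∧ @BorelSpace X t _},
        t'.1 ≤ t₀.1 ∧ Continuous[t'.1, t₀.1] f := by
    rintro ⟨t, ht, hb⟩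
    obtain ⟨t', hle, hc, hp⟩ := hf.exists_continuous
    refine ⟨⟨t', hp, ?_⟩, hle, hc⟩
    exact @BorelSpace.mk X t' _ ((hb.measurable_eq).trans (borel_eq_borel_of_le hp ht hle).symm)
  obtain ⟨t₀, hb₀, hp₀⟩ := ‹StandardBorelSpace X›.polish
  obtain ⟨s, hs, hcs, hps⟩ := hφ.exists_continuous
  have hbs : @BorelSpace X s _ :=
    @BorelSpace.mk X s _ ((hb₀.measurable_eq).trans (borel_eq_borel_of_le hps hp₀ hs).symm)
  choose next hnext_le hnext using step
  -- One refinement makes `f` continuous only from the finer to the coarser topology. In the infimum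
  -- of the iterated refinements source and target coincide, and the Borel sets have not changed.
  let τ : ℕ → {t : TopologicalSpace X // @PolishSpace X t ∧ @BorelSpace X t _} :=
    fun n => next^[n] ⟨s, hps, hbs⟩
  have hτ : ∀ n, τ (n + 1) = next (τ n) := fun n => Function.iterate_succ_apply' _ _ _
  have hanti : Antitone fun n => (τ n).1 := antitone_nat_of_succ_le fun n => by
    rw [hτ]; exact hnext_le _
  have hpol : @PolishSpace X (⨅ n, (τ n).1) :=
    PolishSpace.iInf ⟨0, fun i => hanti (Nat.zero_le i)⟩ fun i => (τ i).2.1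
  have hle : (⨅ n, (τ n).1) ≤ s := iInf_le (fun n => (τ n).1) 0
  refine ⟨⨅ n, (τ n).1, hpol, ?_, ?_, ?_⟩
  · exact @BorelSpace.mk X (⨅ n, (τ n).1) _
      (hbs.measurable_eq.trans (borel_eq_borel_of_le hpol hps hle).symm)
  · refine continuous_iInf_rng.2 fun n => ?_
    refine continuous_iInf_dom (i := n + 1) ?_
    rw [hτ]
    exact hnext _
  · exact continuous_le_dom hle hcs

end PolishRefinement

/-! ### Averages of push-forwards. -/

section Average

variable {Z : Type*} [MeasurableSpace Z]

/-- The average of the first `n` push-forwards of `ν` under `G`. -/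
noncomputable def averageMap (G : Z → Z) (ν : Measure Z) (n : ℕ) : Measure Z :=
  (n : ℝ≥0∞)⁻¹ • ∑ j ∈ Finset.range n, ν.map G^[j]

theorem lintegral_averageMap {G : Z → Z} (hG : Measurable G) (ν : Measure Z) (n : ℕ)
    {φ : Z → ℝ≥0∞} (hφ : Measurable φ) :
    ∫⁻ z, φ z ∂averageMap G ν n = (n : ℝ≥0∞)⁻¹ * ∫⁻ z, birkhoffSum G φ n z ∂ν := by
  rw [averageMap, lintegral_smul_measure, lintegral_finsetSum_measure, smul_eq_mul]
  simp only [birkhoffSum]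
  rw [lintegral_finsetSum (f := fun k z => φ (G^[k] z)) _ fun k _ => hφ.comp (hG.iterate k)]
  simp_rw [lintegral_map hφ (hG.iterate _)]

theorem isProbabilityMeasure_averageMap {G : Z → Z} (hG : Measurable G) (ν : Measure Z)
    [IsProbabilityMeasure ν] {n : ℕ} (hn : 0 < n) : IsProbabilityMeasure (averageMap G ν n) := by
  constructor
  have h := lintegral_averageMap hG ν n (φ := fun _ => 1) measurable_const
  simp only [lintegral_one] at h
  rw [h]
  simp only [birkhoffSum]
  simp [ENNReal.inv_mul_cancel (show (n : ℝ≥0∞) ≠ 0 by exact_mod_cast hn.ne') (by simp)]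

theorem map_averageMap {X : Type*} [MeasurableSpace X] {G : Z → Z} (hG : Measurable G) {f : X → X}
    {p : Z → X} (hp : Measurable p) (h : ∀ z, p (G z) = f (p z)) {ν : Measure Z} {μ : Measure X}
    (hμ : MeasurePreserving f μ μ) (hν : ν.map p = μ) {n : ℕ} (hn : 0 < n) :
    (averageMap G ν n).map p = μ := by
  have hiter : ∀ j z, p (G^[j] z) = f^[j] (p z) := fun j => by
    induction j with
    | zero => intro z; rfl
    | succ j ih => intro z; rw [Function.iterate_succ_apply, ih, h, Function.iterate_succ_apply]
  ext s hs
  rw [Measure.map_apply hp hs, averageMap, Measure.smul_apply, Measure.finsetSum_apply]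
  have : ∀ j ∈ Finset.range n, ν.map G^[j] (p ⁻¹' s) = μ s := by
    intro j _
    rw [Measure.map_apply (hG.iterate j) (hp hs)]
    have e : G^[j] ⁻¹' (p ⁻¹' s) = p ⁻¹' (f^[j] ⁻¹' s) := by
      ext z; simp [hiter]
    rw [e, ← Measure.map_apply hp ((hμ.measurable.iterate j) hs), hν,
      (hμ.iterate j).measure_preimage hs.nullMeasurableSet]
  rw [Finset.sum_congr rfl this]
  simp only [Finset.sum_const, Finset.card_range, nsmul_eq_mul, smul_eq_mul]
  rw [← mul_assoc, ENNReal.inv_mul_cancel (by exact_mod_cast hn.ne') (by simp), one_mul]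

/-- The difference telescopes to `n⁻¹ * (∫ g ∘ G^[n] - ∫ g)`. -/
theorem abs_integral_averageMap_sub_le {G : Z → Z} (hG : Measurable G) (ν : Measure Z)
    [IsProbabilityMeasure ν] {n : ℕ} (hn : 0 < n) {g : Z → ℝ} (hg : Measurable g) {C : ℝ}
    (hC : ∀ z, |g z| ≤ C) :
    |∫ z, g (G z) ∂averageMap G ν n - ∫ z, g z ∂averageMap G ν n| ≤ 2 * C / n := by
  have hint : ∀ j, Integrable (fun z => g (G^[j] z)) ν := fun j =>
    Integrable.of_bound (hg.comp (hG.iterate j)).aestronglyMeasurable C (.of_forall fun z => hC _)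
  have havg : ∀ φ : Z → ℝ, Measurable φ → (∀ z, |φ z| ≤ C) →
      ∫ z, φ z ∂averageMap G ν n = (n : ℝ)⁻¹ * ∑ j ∈ Finset.range n, ∫ z, φ (G^[j] z) ∂ν := by
    intro φ hφ hφC
    have hi : ∀ j ∈ Finset.range n, Integrable φ (ν.map G^[j]) := fun j _ => by
      have : IsProbabilityMeasure (ν.map G^[j]) :=
        Measure.isProbabilityMeasure_map (hG.iterate j).aemeasurable
      exact Integrable.of_bound hφ.aestronglyMeasurable C (.of_forall hφC)
    rw [averageMap, integral_smul_measure, integral_finsetSum_measure hi]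
    simp only [ENNReal.toReal_inv, ENNReal.toReal_natCast, smul_eq_mul]
    congr 1
    refine Finset.sum_congr rfl fun j _ => ?_
    rw [integral_map (hG.iterate j).aemeasurable hφ.aestronglyMeasurable]
  rw [havg (fun z => g (G z)) (hg.comp hG) (fun z => hC _), havg g hg hC, ← mul_sub, ← Finset.sum_sub_distrib]
  have : ∑ j ∈ Finset.range n, (∫ z, g (G (G^[j] z)) ∂ν - ∫ z, g (G^[j] z) ∂ν) =
      ∫ z, g (G^[n] z) ∂ν - ∫ z, g z ∂ν := by
    have := Finset.sum_range_sub (fun j => ∫ z, g (G^[j] z) ∂ν) n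
    simpa only [Function.iterate_succ_apply', Function.iterate_zero, id] using this
  rw [this, abs_mul, abs_of_nonneg (by positivity : (0 : ℝ) ≤ (n : ℝ)⁻¹), inv_mul_eq_div]
  gcongr
  have hb : ∀ j, |∫ z, g (G^[j] z) ∂ν| ≤ C := fun j => by
    have := norm_integral_le_of_norm_le_const (μ := ν) (f := fun z => g (G^[j] z)) (C := C)
      (.of_forall fun z => hC _)
    simpa using this
  have h1 := hb n
  have h2 := hb 0
  simp only [Function.iterate_zero, id] at h2
  rw [abs_le] at *
  constructor <;> linarith [h1.1, h1.2, h2.1, h2.2]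

end Average

/-! ### Weak compactness, invariant limits and ergodic extreme points. -/

section WeakTopology

variable {Z : Type*} [TopologicalSpace Z] [MeasurableSpace Z] [BorelSpace Z]

open BoundedContinuousFunction

/-- The integral is the supremum of those of the bounded continuous truncations `min a m`, hence
lower semicontinuous in the measure. -/
theorem isClosed_setOf_lintegral_le {a : Z → ℝ≥0∞} (ha : Continuous a) (C : ℝ≥0∞) :
    IsClosed {ν : ProbabilityMeasure Z | ∫⁻ z, a z ∂(ν : Measure Z) ≤ C} := by
  have key : ∀ m : ℕ, IsClosed {ν : ProbabilityMeasure Z | ∫⁻ z, min (a z) m ∂(ν : Measure Z) ≤ C} := by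
    intro m
    have hfin : ∀ z, min (a z) m ≠ ∞ := fun z => ne_top_of_le_ne_top (by simp) (min_le_right _ _)
    let g : Z →ᵇ NNReal := BoundedContinuousFunction.mkOfBound
      ⟨fun z => (min (a z) m).toNNReal,
        ENNReal.continuousOn_toNNReal.comp_continuous (ha.min continuous_const) hfin⟩ m (by
          intro x y
          have hb : ∀ z, (min (a z) m).toNNReal ≤ m := fun z => by
            have := ENNReal.toNNReal_mono (by simp) (min_le_right (a z) m)
            simpa using this
          rw [NNReal.dist_eq]
          have h1 : (((min (a x) m).toNNReal : NNReal) : ℝ) ≤ m := by exact_mod_cast hb x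
          have h2 : (((min (a y) m).toNNReal : NNReal) : ℝ) ≤ m := by exact_mod_cast hb y
          have h3 := ((min (a x) m).toNNReal).2
          have h4 := ((min (a y) m).toNNReal).2
          simp only [ContinuousMap.coe_mk]
          rw [abs_le]
          constructor <;> linarith)
    have hg : ∀ z, (g z : ℝ≥0∞) = min (a z) m := fun z => ENNReal.coe_toNNReal (hfin z)
    have := ProbabilityMeasure.continuous_lintegral_boundedContinuousFunction g
    simp only [hg] at this
    exact isClosed_le this continuous_const
  have : {ν : ProbabilityMeasure Z | ∫⁻ z, a z ∂(ν : Measure Z) ≤ C} =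
      ⋂ m : ℕ, {ν : ProbabilityMeasure Z | ∫⁻ z, min (a z) m ∂(ν : Measure Z) ≤ C} := by
    ext ν
    simp only [Set.mem_ofPred_eq, Set.mem_iInter]
    refine ⟨fun h m => (lintegral_mono fun z => min_le_left _ _).trans h, fun h => ?_⟩
    have hmono : ∫⁻ z, a z ∂(ν : Measure Z) = ⨆ M : ℕ, ∫⁻ z, min (a z) M ∂(ν : Measure Z) := by
      rw [← lintegral_iSup (fun M => (ha.min continuous_const).measurable)]
      · refine lintegral_congr fun x => ?_
        refine le_antisymm (ENNReal.le_of_forall_nnreal_lt fun t ht => ?_)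
          (iSup_le fun _ => min_le_left _ _)
        obtain ⟨n, hn⟩ := exists_nat_ge t
        exact (le_min ht.le (by exact_mod_cast hn)).trans
          (le_iSup (fun M : ℕ => min (a x) (M : ℝ≥0∞)) n)
      · intro a b hab x
        exact min_le_min_left _ (by exact_mod_cast hab)
    rw [hmono]
    exact iSup_le h
  rw [this]
  exact isClosed_iInter key

/-- Prokhorov: the first marginal is a single tight measure and the second lives on a compact space.
-/
theorem isCompact_setOf_map_fst_eq {X S : Type*} [TopologicalSpace X] [PolishSpace X]
    [MeasurableSpace X] [BorelSpace X] [TopologicalSpace S] [PolishSpace S] [CompactSpace S]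
    [MeasurableSpace S] [BorelSpace S] (μ : Measure X) [IsFiniteMeasure μ] :
    IsCompact {ν : ProbabilityMeasure (X × S) | (ν : Measure (X × S)).map Prod.fst = μ} := by
  rcases Set.eq_empty_or_nonempty
    {ν : ProbabilityMeasure (X × S) | (ν : Measure (X × S)).map Prod.fst = μ} with h | ⟨ν₀, hν₀⟩
  · rw [h]; exact isCompact_empty
  have hμ : IsProbabilityMeasure μ := by
    rw [← hν₀]
    exact Measure.isProbabilityMeasure_map measurable_fst.aemeasurable
  have hclosed : IsClosed {ν : ProbabilityMeasure (X × S) |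
      (ν : Measure (X × S)).map Prod.fst = μ} := by
    obtain ⟨μ', hμ'⟩ : ∃ μ' : ProbabilityMeasure X, (μ' : Measure X) = μ := ⟨⟨μ, hμ⟩, rfl⟩
    have hc := ProbabilityMeasure.continuous_map (Ω := X × S) (f := Prod.fst) continuous_fst
    have : {ν : ProbabilityMeasure (X × S) | (ν : Measure (X × S)).map Prod.fst = μ} =
        (fun ν : ProbabilityMeasure (X × S) => ν.map continuous_fst.measurable.aemeasurable) ⁻¹'
          {μ'} := by
      ext ν
      rw [Set.mem_preimage, Set.mem_singleton_iff,
        ← ProbabilityMeasure.toMeasure_injective.eq_iff, hμ']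
      rfl
    rw [this]
    exact isClosed_singleton.preimage hc
  rw [← hclosed.closure_eq]
  refine isCompact_closure_of_isTightMeasureSet (IsTightMeasureSet.prodMk ?_ ?_)
  · refine (isTightMeasureSet_singleton (μ := μ)).subset ?_
    rintro _ ⟨_, ⟨ν, hν, rfl⟩, rfl⟩
    exact hν
  · exact IsTightMeasureSet.of_compactSpace

variable {G : Z → Z}

theorem MeasureTheory.ProbabilityMeasure.measurePreserving_iff_integral [HasOuterApproxClosed Z]
    (hG : Measurable G) (ν : ProbabilityMeasure Z) :
    MeasurePreserving G (ν : Measure Z) ν ↔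
      ∀ g : Z →ᵇ ℝ, ∫ z, g (G z) ∂(ν : Measure Z) = ∫ z, g z ∂(ν : Measure Z) := by
  constructor
  · intro h g
    have := integral_map (μ := (ν : Measure Z)) hG.aemeasurable
      (f := g) g.continuous.measurable.aestronglyMeasurable
    rw [← this, h.map_eq]
  · intro h
    refine ⟨hG, ?_⟩
    have : IsProbabilityMeasure ((ν : Measure Z).map G) :=
      Measure.isProbabilityMeasure_map hG.aemeasurable
    refine ext_of_forall_integral_eq_of_IsFiniteMeasure fun g => ?_
    rw [integral_map hG.aemeasurable g.continuous.measurable.aestronglyMeasurable, h g]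

/-- `G` may be discontinuous: invariance is tested on bounded continuous `g`, and closedness only
needs `ν ↦ ∫ g ∘ G dν` to be continuous on `K`. -/
theorem isCompact_inter_measurePreserving [HasOuterApproxClosed Z] (hG : Measurable G)
    {K : Set (ProbabilityMeasure Z)} (hK : IsCompact K)
    (hcont : ∀ g : Z →ᵇ ℝ, ContinuousOn (fun ν : ProbabilityMeasure Z => ∫ z, g (G z) ∂(ν : Measure Z)) K) :
    IsCompact (K ∩ {ν | MeasurePreserving G (ν : Measure Z) ν}) := by
  have : K ∩ {ν | MeasurePreserving G (ν : Measure Z) ν} = K ∩ ⋂ g : Z →ᵇ ℝ, (K ∩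
      {ν | ∫ z, g (G z) ∂(ν : Measure Z) = ∫ z, g z ∂(ν : Measure Z)}) := by
    ext ν
    simp only [Set.mem_inter_iff, Set.mem_ofPred_eq, Set.mem_iInter,
      ProbabilityMeasure.measurePreserving_iff_integral hG]
    constructor
    · rintro ⟨h1, h2⟩; exact ⟨h1, fun g => ⟨h1, h2 g⟩⟩
    · rintro ⟨h1, h2⟩; exact ⟨h1, fun g => (h2 g).2⟩
  rw [this]
  refine hK.inter_right (isClosed_iInter fun g => ?_)
  have hc : ContinuousOn (fun ν : ProbabilityMeasure Z =>
      ∫ z, g (G z) ∂(ν : Measure Z) - ∫ z, g z ∂(ν : Measure Z)) K :=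
    (hcont g).sub (ProbabilityMeasure.continuous_integral_boundedContinuousFunction g).continuousOn
  have := hc.preimage_isClosed_of_isClosed hK.isClosed (isClosed_singleton (x := (0 : ℝ)))
  convert this using 2
  ext ν
  simp [sub_eq_zero]

/-- The Krylov–Bogoliubov argument along a sequence of almost invariant measures. -/
theorem exists_measurePreserving_of_asymptotically_invariant [HasOuterApproxClosed Z]
    (hG : Measurable G) {K : Set (ProbabilityMeasure Z)} (hK : IsCompact K)
    (hcont : ∀ g : Z →ᵇ ℝ, ContinuousOn (fun ν : ProbabilityMeasure Z => ∫ z, g (G z) ∂(ν : Measure Z)) K)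
    (νs : ℕ → ProbabilityMeasure Z) (hνs : ∀ n, νs n ∈ K)
    (hinv : ∀ g : Z →ᵇ ℝ, Tendsto (fun n => ∫ z, g (G z) ∂(νs n : Measure Z) -
      ∫ z, g z ∂(νs n : Measure Z)) atTop (𝓝 0)) :
    ∃ ν ∈ K, MeasurePreserving G (ν : Measure Z) ν ∧
      ∀ s : Set (ProbabilityMeasure Z), IsClosed s → (∀ᶠ n in atTop, νs n ∈ s) → ν ∈ s := by
  -- A limit along an ultrafilter replaces the extraction of a convergent subsequence.
  obtain ⟨ν, hνK, hν⟩ := hK.ultrafilter_le_nhds ((Ultrafilter.of atTop : Ultrafilter ℕ).map νs)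
    (by
      rw [le_principal_iff]
      exact Filter.mem_map.2 (Filter.mem_of_superset Filter.univ_mem fun n _ => hνs n))
  have hU : ((Ultrafilter.of atTop : Ultrafilter ℕ) : Filter ℕ) ≤ atTop := Ultrafilter.of_le _
  have htend : Tendsto νs (Ultrafilter.of atTop : Ultrafilter ℕ) (𝓝 ν) := hν
  refine ⟨ν, hνK, ?_, fun s hs hev => hs.mem_of_tendsto htend (hU hev)⟩
  rw [ProbabilityMeasure.measurePreserving_iff_integral hG]
  intro g
  have htK : Tendsto νs (Ultrafilter.of atTop : Ultrafilter ℕ) (𝓝[K] ν) :=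
    tendsto_nhdsWithin_iff.2 ⟨htend, .of_forall hνs⟩
  have h1 := (hcont g ν hνK).tendsto.comp htK
  have h2 := ((ProbabilityMeasure.continuous_integral_boundedContinuousFunction g).tendsto ν).comp htend
  have h3 := h1.sub h2
  have h4 := tendsto_nhds_unique h3 ((hinv g).mono_left hU)
  exact sub_eq_zero.1 h4

/-- A nonempty compact face of the set of invariant probability measures contains an ergodic
measure. -/
theorem exists_ergodic_of_isCompact_face [HasOuterApproxClosed Z]
    {M : Set (ProbabilityMeasure Z)} (hM : IsCompact M) (hne : M.Nonempty)
    (hinv : ∀ ν ∈ M, MeasurePreserving G (ν : Measure Z) ν)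
    (hface : ∀ ν ∈ M, ∀ ν₁ ν₂ : ProbabilityMeasure Z, MeasurePreserving G (ν₁ : Measure Z) ν₁ →
      MeasurePreserving G (ν₂ : Measure Z) ν₂ → ∀ a b : ℝ≥0∞, 0 < a → 0 < b → a + b = 1 →
      a • (ν₁ : Measure Z) + b • (ν₂ : Measure Z) = ν → ν₁ ∈ M ∧ ν₂ ∈ M) :
    ∃ ν ∈ M, Ergodic G (ν : Measure Z) := by
  -- Measures are embedded in a product of lines, a locally convex space, where a nonempty compact
  -- set has an extreme point. The face property transfers extremality from `M` to all invariant
  -- probability measures.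
  let T : ProbabilityMeasure Z → (Z →ᵇ ℝ) → ℝ := fun ν g => ∫ z, g z ∂(ν : Measure Z)
  have hT : Continuous T := continuous_pi fun g =>
    ProbabilityMeasure.continuous_integral_boundedContinuousFunction g
  have hTinj : Function.Injective T := by
    intro ν₁ ν₂ h
    apply ProbabilityMeasure.toMeasure_injective
    exact ext_of_forall_integral_eq_of_IsFiniteMeasure fun g => congrFun h g
  obtain ⟨_, ⟨ν, hν, rfl⟩, hext⟩ := (hM.image hT).extremePoints_nonempty (hne.image T)
  refine ⟨ν, hν, Ergodic.of_mem_extremePoints ⟨⟨hinv ν hν, inferInstance⟩, ?_⟩⟩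
  rintro ν₁ ⟨h1, hp1⟩ ν₂ ⟨h2, hp2⟩ ⟨a, b, ha, hb, hab, hsum⟩
  obtain ⟨m1, m2⟩ := hface ν hν ⟨ν₁, hp1⟩ ⟨ν₂, hp2⟩ h1 h2 a b ha hb hab hsum
  have ha1 : a ≠ ∞ := ne_top_of_le_ne_top ENNReal.one_ne_top (hab ▸ le_self_add)
  have hb1 : b ≠ ∞ := ne_top_of_le_ne_top ENNReal.one_ne_top (hab ▸ le_add_self)
  have key := hext (Set.mem_image_of_mem T m1) (Set.mem_image_of_mem T m2) ?_
  · have := hTinj key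
    have := congrArg (fun ν : ProbabilityMeasure Z => (ν : Measure Z)) this
    exact this
  refine ⟨a.toReal, b.toReal, ENNReal.toReal_pos ha.ne' ha1, ENNReal.toReal_pos hb.ne' hb1, ?_, ?_⟩
  · rw [← ENNReal.toReal_add ha1 hb1, hab, ENNReal.toReal_one]
  · funext g
    have hi : ∀ ρ : Measure Z, IsProbabilityMeasure ρ → Integrable g ρ := fun ρ _ => g.integrable ρ
    simp only [T, Pi.add_apply, Pi.smul_apply, smul_eq_mul]
    rw [← hsum, integral_add_measure ((hi ν₁ hp1).smul_measure ha1) ((hi ν₂ hp2).smul_measure hb1),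
      integral_smul_measure, integral_smul_measure]
    rfl

end WeakTopology

/-! ### Measurable families of linear maps and their cocycle costs. -/

section LinearFamilies

variable {X W : Type*} [NormedAddCommGroup W] [InnerProductSpace ℝ W] [FiniteDimensional ℝ W]

theorem LinearMap.apply_eq_sum_stdOrthonormalBasis {W' : Type*} [AddCommGroup W'] [Module ℝ W']
    (T : W →ₗ[ℝ] W') (w : W) :
    T w = ∑ i, inner ℝ (stdOrthonormalBasis ℝ W i) w • T (stdOrthonormalBasis ℝ W i) := by
  conv_lhs => rw [← (stdOrthonormalBasis ℝ W).sum_repr' w]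
  simp [map_sum]

/-- By linearity, joint measurability reduces to the finitely many vectors of a basis. -/
theorem measurable_linearFamily_apply [MeasurableSpace X] [MeasurableSpace W] [BorelSpace W]
    {T : X → W →ₗ[ℝ] W} (hT : ∀ w, Measurable fun x => T x w) :
    Measurable fun p : X × W => T p.1 p.2 := by
  have : (fun p : X × W => T p.1 p.2) = fun p : X × W =>
      ∑ i, inner ℝ (stdOrthonormalBasis ℝ W i) p.2 • T p.1 (stdOrthonormalBasis ℝ W i) := by
    funext p
    exact (T p.1).apply_eq_sum_stdOrthonormalBasis p.2
  rw [this]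
  refine Finset.measurable_sum _ fun i _ => ?_
  exact (measurable_const.inner measurable_snd).smul ((hT _).comp measurable_fst)

theorem continuous_linearFamily_apply [TopologicalSpace X] {T : X → W →ₗ[ℝ] W}
    (hT : ∀ i, Continuous fun x => T x (stdOrthonormalBasis ℝ W i)) :
    Continuous fun p : X × W => T p.1 p.2 := by
  have : (fun p : X × W => T p.1 p.2) = fun p : X × W =>
      ∑ i, inner ℝ (stdOrthonormalBasis ℝ W i) p.2 • T p.1 (stdOrthonormalBasis ℝ W i) := by
    funext p
    exact (T p.1).apply_eq_sum_stdOrthonormalBasis p.2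
  rw [this]
  refine continuous_finsetSum _ fun i _ => ?_
  exact (continuous_const.inner continuous_snd).smul ((hT i).comp continuous_fst)

/-- The operator norm of a linear map on a finite-dimensional space. -/
noncomputable def opNorm {V V' : Type*} [NormedAddCommGroup V] [NormedSpace ℝ V]
    [FiniteDimensional ℝ V] [NormedAddCommGroup V'] [NormedSpace ℝ V'] (T : V →ₗ[ℝ] V') : ℝ :=
  ‖T.toContinuousLinearMap‖

theorem opNorm_nonneg (T : W →ₗ[ℝ] W) : 0 ≤ opNorm T := norm_nonneg _

theorem le_opNorm (T : W →ₗ[ℝ] W) (w : W) : ‖T w‖ ≤ opNorm T * ‖w‖ :=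
  T.toContinuousLinearMap.le_opNorm w

theorem opNorm_le {T : W →ₗ[ℝ] W} {C : ℝ} (hC : 0 ≤ C) (h : ∀ w, ‖T w‖ ≤ C * ‖w‖) :
    opNorm T ≤ C :=
  ContinuousLinearMap.opNorm_le_bound _ hC h

theorem opNorm_comp_le (S T : W →ₗ[ℝ] W) : opNorm (S ∘ₗ T) ≤ opNorm S * opNorm T :=
  opNorm_le (mul_nonneg (opNorm_nonneg S) (opNorm_nonneg T)) fun w => by
    calc ‖S (T w)‖ ≤ opNorm S * ‖T w‖ := le_opNorm S _
      _ ≤ opNorm S * (opNorm T * ‖w‖) := by gcongr; exacts [opNorm_nonneg S, le_opNorm T w]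
      _ = _ := by ring

theorem measurable_opNorm [MeasurableSpace X] [MeasurableSpace W] [BorelSpace W]
    {T : X → W →ₗ[ℝ] W} (hT : ∀ w, Measurable fun x => T x w) :
    Measurable fun x => opNorm (T x) := by
  refine measurable_of_Iic fun r => ?_
  rcases lt_or_ge r 0 with hr | hr
  · convert MeasurableSet.empty
    refine Set.eq_empty_iff_forall_notMem.2 fun x hx => ?_
    exact absurd ((opNorm_nonneg (T x)).trans hx) (not_le.2 hr)
  obtain ⟨s, hs, hd⟩ := TopologicalSpace.exists_countable_dense W
  have : (fun x => opNorm (T x)) ⁻¹' Set.Iic r = ⋂ w ∈ s, {x | ‖T x w‖ ≤ r * ‖w‖} := by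
    ext x
    simp only [Set.mem_preimage, Set.mem_Iic, Set.mem_iInter, Set.mem_ofPred_eq]
    refine ⟨fun h w _ => (le_opNorm _ w).trans (by gcongr), fun h => opNorm_le hr fun w => ?_⟩
    have hcl : IsClosed {w : W | ‖T x w‖ ≤ r * ‖w‖} :=
      isClosed_le ((T x).continuous_of_finiteDimensional.norm) (by fun_prop)
    have := hcl.closure_subset_iff.2 (fun w hw => h w hw : s ⊆ _)
    rw [hd.closure_eq] at this
    exact this (Set.mem_univ w)
  rw [this]
  exact MeasurableSet.biInter hs fun w _ => measurableSet_le (hT w).norm measurable_const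

variable {f : X → X}

omit [FiniteDimensional ℝ W] in
theorem cocycle_add (B : X → W →ₗ[ℝ] W) (m n : ℕ) (x : X) :
    cocycle (E := fun _ : X => W) (f := f) B (m + n) x =
      cocycle (E := fun _ : X => W) (f := f) B n (f^[m] x) ∘ₗ
        cocycle (E := fun _ : X => W) (f := f) B m x := by
  induction m generalizing x with
  | zero => rw [Nat.zero_add]; rfl
  | succ m ih =>
    rw [show m + 1 + n = (m + n) + 1 by ring]
    change cocycle (E := fun _ : X => W) (f := f) B (m + n) (f x) ∘ₗ B x = _
    rw [ih (f x)]
    rfl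

variable [MeasurableSpace X] [MeasurableSpace W] [BorelSpace W] in
theorem measurable_cocycle (hf : Measurable f) {B : X → W →ₗ[ℝ] W}
    (hB : ∀ w, Measurable fun x => B x w) (n : ℕ) (w : W) :
    Measurable fun x => (cocycle (E := fun _ : X => W) (f := f) B n x : W →ₗ[ℝ] W) w := by
  induction n generalizing w with
  | zero => exact measurable_const
  | succ n ih =>
    exact (measurable_linearFamily_apply ih).comp (hf.prodMk (hB w))

omit [FiniteDimensional ℝ W] in
theorem norm_cocycle_le {B : X → W →ₗ[ℝ] W} (hB1 : ∀ x w, ‖B x w‖ ≤ ‖w‖) (n : ℕ) (x : X) (w : W) :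
    ‖(cocycle (E := fun _ : X => W) (f := f) B n x : W →ₗ[ℝ] W) w‖ ≤ ‖w‖ := by
  induction n generalizing x w with
  | zero => exact le_rfl
  | succ n ih => exact (ih (f x) (B x w)).trans (hB1 x w)

/-- The cost `-log ‖B^n_x‖` of a cocycle of contractions. -/
noncomputable def cocycleCost (f : X → X) (B : X → W →ₗ[ℝ] W) (n : ℕ) (x : X) : ℝ≥0∞ :=
  negLog (opNorm (cocycle (E := fun _ : X => W) (f := f) B n x : W →ₗ[ℝ] W))

theorem opNorm_cocycle_le_one {B : X → W →ₗ[ℝ] W} (hB1 : ∀ x w, ‖B x w‖ ≤ ‖w‖) (n : ℕ) (x : X) :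
    opNorm (cocycle (E := fun _ : X => W) (f := f) B n x : W →ₗ[ℝ] W) ≤ 1 :=
  opNorm_le zero_le_one fun w => by rw [one_mul]; exact norm_cocycle_le hB1 n x w

variable [MeasurableSpace X] [MeasurableSpace W] [BorelSpace W] in
theorem measurable_cocycleCost (hf : Measurable f) {B : X → W →ₗ[ℝ] W}
    (hB : ∀ w, Measurable fun x => B x w) (n : ℕ) : Measurable (cocycleCost f B n) :=
  continuous_negLog.measurable.comp (measurable_opNorm (measurable_cocycle hf hB n))

theorem cocycleCost_superadditive {B : X → W →ₗ[ℝ] W} (hB1 : ∀ x w, ‖B x w‖ ≤ ‖w‖) (m n : ℕ)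
    (x : X) : cocycleCost f B m x + cocycleCost f B n (f^[m] x) ≤ cocycleCost f B (m + n) x := by
  rw [add_comm]
  unfold cocycleCost
  rw [← negLog_mul (opNorm_nonneg _) (opNorm_cocycle_le_one hB1 _ _)
    (opNorm_cocycle_le_one hB1 _ _), cocycle_add]
  exact negLog_anti (opNorm_comp_le _ _)

end LinearFamilies

/-! ### The induced dynamics on the unit sphere bundle. -/

section SphereBundle

variable {X W : Type*} [NormedAddCommGroup W] [InnerProductSpace ℝ W]

open Metric

/-- The unit vector in the direction of `w`, and a given unit vector if `w = 0`. -/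
noncomputable def directionOr (v : sphere (0 : W) 1) (w : W) : sphere (0 : W) 1 :=
  open Classical in
  if h : w = 0 then v else ⟨‖w‖⁻¹ • w, by simp [norm_smul, h]⟩

theorem coe_directionOr (v : sphere (0 : W) 1) {w : W} (h : w ≠ 0) :
    (directionOr v w : W) = ‖w‖⁻¹ • w := by
  rw [directionOr, dif_neg h]

/-- The map induced on the unit sphere bundle by a family of linear maps over `f`. -/
noncomputable def sphereMap (f : X → X) (B : X → W →ₗ[ℝ] W) (z : X × sphere (0 : W) 1) :
    X × sphere (0 : W) 1 :=
  (f z.1, directionOr z.2 (B z.1 z.2))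

/-- The cost `-log ‖B_x v‖`. -/
noncomputable def sphereCost (B : X → W →ₗ[ℝ] W) (z : X × sphere (0 : W) 1) : ℝ≥0∞ :=
  negLog ‖B z.1 z.2‖

variable {f : X → X} {B : X → W →ₗ[ℝ] W}

/-- The ratios of successive norms telescope. Once the vector is killed both sides are `∞`, so the
arbitrary direction chosen by `directionOr` does not matter. -/
theorem birkhoffSum_sphereCost (hB1 : ∀ x w, ‖B x w‖ ≤ ‖w‖) (n : ℕ) (z : X × sphere (0 : W) 1) :
    birkhoffSum (sphereMap f B) (sphereCost B) n z =
      negLog ‖(cocycle (E := fun _ : X => W) (f := f) B n z.1 : W →ₗ[ℝ] W) z.2‖ := by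
  induction n generalizing z with
  | zero =>
    have : ‖(z.2 : W)‖ = 1 := by simp
    rw [birkhoffSum_zero]
    change 0 = negLog ‖(z.2 : W)‖
    rw [this, negLog_one]
  | succ n ih =>
    rw [birkhoffSum_succ', ih]
    change _ = negLog ‖(cocycle (E := fun _ : X => W) (f := f) B n (f z.1) : W →ₗ[ℝ] W) (B z.1 z.2)‖
    have hz : ‖(z.2 : W)‖ = 1 := by simp
    by_cases h : B z.1 z.2 = 0
    · simp [sphereCost, h, negLog_zero]
    · have h0 : 0 < ‖B z.1 z.2‖ := norm_pos_iff.2 h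
      simp only [sphereMap, sphereCost]
      rw [coe_directionOr _ h, map_smul, norm_smul, norm_inv, norm_norm,
        ← negLog_mul (norm_nonneg _) ((hB1 _ _).trans hz.le)]
      · congr 1
        field_simp
      · rw [inv_mul_le_one₀ h0]
        exact norm_cocycle_le hB1 _ _ _

variable [FiniteDimensional ℝ W] [MeasurableSpace W] [BorelSpace W]

omit [MeasurableSpace W] [BorelSpace W] in
theorem cocycleCost_le_birkhoffSum (hB1 : ∀ x w, ‖B x w‖ ≤ ‖w‖) (n : ℕ) (z : X × sphere (0 : W) 1) :
    cocycleCost f B n z.1 ≤ birkhoffSum (sphereMap f B) (sphereCost B) n z := by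
  rw [birkhoffSum_sphereCost hB1]
  refine negLog_anti ?_
  have hz : ‖(z.2 : W)‖ = 1 := by simp
  simpa [hz] using le_opNorm (cocycle (E := fun _ : X => W) (f := f) B n z.1 : W →ₗ[ℝ] W) z.2

theorem measurable_sphereMap [MeasurableSpace X] (hf : Measurable f)
    (hB : ∀ w, Measurable fun x => B x w) : Measurable (sphereMap f B) := by
  classical
  have hBm : Measurable fun z : X × sphere (0 : W) 1 => B z.1 z.2 :=
    (measurable_linearFamily_apply hB).comp
      (measurable_fst.prodMk (measurable_subtype_coe.comp measurable_snd))
  refine (hf.comp measurable_fst).prodMk ?_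
  have : (fun z : X × sphere (0 : W) 1 => (directionOr z.2 (B z.1 z.2) : W)) =
      fun z => if B z.1 z.2 = 0 then (z.2 : W) else ‖B z.1 z.2‖⁻¹ • B z.1 z.2 := by
    funext z
    split_ifs with h
    · rw [directionOr, dif_pos h]
    · rw [coe_directionOr _ h]
  have hm : Measurable fun z : X × sphere (0 : W) 1 => (directionOr z.2 (B z.1 z.2) : W) := by
    rw [this]
    exact Measurable.ite (hBm (measurableSet_singleton 0))
      (measurable_subtype_coe.comp measurable_snd) (hBm.norm.inv.smul hBm)
  exact hm.subtype_mk

/-- The basis vector with the largest image can be selected measurably among finitely many. The lost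
factor, the dimension, is a bounded additive cost and disappears after division by `n`. -/
theorem exists_measurable_almost_maximal [MeasurableSpace X] [Nontrivial W] {T : X → W →ₗ[ℝ] W}
    (hT : ∀ w, Measurable fun x => T x w) :
    ∃ v : X → sphere (0 : W) 1, Measurable v ∧
      ∀ x, opNorm (T x) ≤ Module.finrank ℝ W * ‖T x (v x)‖ := by
  classical
  set N := Module.finrank ℝ W with hN
  have hN0 : 0 < N := Module.finrank_pos
  set b := stdOrthonormalBasis ℝ W with hb
  -- Indexing by `ℕ` allows the selection by `Nat.find`; beyond `N` the value is a filler.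
  let w : ℕ → sphere (0 : W) 1 := fun n =>
    if h : n < N then ⟨b ⟨n, h⟩, by simp⟩ else ⟨b ⟨0, hN0⟩, by simp⟩
  have hex : ∀ x, ∃ n, ∀ j, ‖T x (b j)‖ ≤ ‖T x (w n)‖ := by
    intro x
    have : Nonempty (Fin N) := ⟨⟨0, hN0⟩⟩
    obtain ⟨i, hi⟩ := Finite.exists_max fun j => ‖T x (b j)‖
    refine ⟨i, fun j => ?_⟩
    have : (w i : W) = b i := by
      simp only [w]
      rw [dif_pos i.2]
    rw [this]
    exact hi j
  have hm : ∀ n, MeasurableSet {x | ∀ j, ‖T x (b j)‖ ≤ ‖T x (w n)‖} := by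
    intro n
    have : {x | ∀ j, ‖T x (b j)‖ ≤ ‖T x (w n)‖} = ⋂ j, {x | ‖T x (b j)‖ ≤ ‖T x (w n)‖} := by
      ext x; simp
    rw [this]
    exact .iInter fun j => measurableSet_le (hT _).norm (hT _).norm
  refine ⟨fun x => w (Nat.find (hex x)), (measurable_from_nat (f := w)).comp (measurable_find hex hm),
    fun x => opNorm_le (by positivity) fun u => ?_⟩
  have hmax := Nat.find_spec (hex x)
  rw [(T x).apply_eq_sum_stdOrthonormalBasis u]
  calc ‖∑ i, inner ℝ (b i) u • T x (b i)‖ ≤ ∑ i, ‖inner ℝ (b i) u • T x (b i)‖ := norm_sum_le _ _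
    _ ≤ ∑ _i : Fin N, ‖u‖ * ‖T x (w (Nat.find (hex x)))‖ := by
      refine Finset.sum_le_sum fun i _ => ?_
      rw [norm_smul]
      gcongr
      · refine (norm_inner_le_norm _ _).trans ?_
        simp
      · exact hmax i
    _ = _ := by simp; ring

end SphereBundle

/-! ### Optimal invariant lifts on the sphere bundle. -/

section SphereLift

open Metric BoundedContinuousFunction

variable {X W : Type*} [NormedAddCommGroup W] [InnerProductSpace ℝ W]
variable {f : X → X} {B : X → W →ₗ[ℝ] W}

theorem continuous_sphereBundle_norm [TopologicalSpace X]
    (hBc : Continuous fun p : X × W => B p.1 p.2) :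
    Continuous fun z : X × sphere (0 : W) 1 => B z.1 z.2 :=
  hBc.comp (continuous_fst.prodMk (continuous_subtype_val.comp continuous_snd))

theorem continuousAt_sphereMap [TopologicalSpace X] (hf : Continuous f)
    (hBc : Continuous fun p : X × W => B p.1 p.2) {z : X × sphere (0 : W) 1}
    (hz : B z.1 z.2 ≠ 0) : ContinuousAt (sphereMap f B) z := by
  have hB := continuous_sphereBundle_norm hBc
  refine (hf.comp continuous_fst).continuousAt.prodMk ?_
  rw [Topology.IsInducing.subtypeVal.continuousAt_iff]
  have hev : ∀ᶠ z' in 𝓝 z, B z'.1 z'.2 ≠ 0 := hB.continuousAt.eventually_ne hz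
  have : ContinuousAt (fun z' : X × sphere (0 : W) 1 => ‖B z'.1 z'.2‖⁻¹ • B z'.1 z'.2) z :=
    (hB.continuousAt.norm.inv₀ (norm_ne_zero_iff.2 hz)).smul hB.continuousAt
  refine this.congr ?_
  filter_upwards [hev] with z' hz'
  exact (coe_directionOr _ hz').symm

theorem continuous_sphereMap [TopologicalSpace X] (hf : Continuous f)
    (hBc : Continuous fun p : X × W => B p.1 p.2) (hinj : ∀ x, Function.Injective (B x)) :
    Continuous (sphereMap f B) := by
  refine continuous_iff_continuousAt.2 fun z => continuousAt_sphereMap hf hBc fun h => ?_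
  have h0 : (z.2 : W) = 0 := hinj z.1 (h.trans (map_zero _).symm)
  have : ‖(z.2 : W)‖ = 1 := by simp
  simp [h0] at this

theorem continuous_sphereCost [TopologicalSpace X] (hBc : Continuous fun p : X × W => B p.1 p.2) :
    Continuous (sphereCost B) :=
  continuous_negLog.comp (continuous_sphereBundle_norm hBc).norm

/-- The cut-off of `g ∘ sphereMap f B` near the kernel directions. -/
theorem continuous_cutoff [TopologicalSpace X] (hf : Continuous f)
    (hBc : Continuous fun p : X × W => B p.1 p.2) (g : (X × sphere (0 : W) 1) →ᵇ ℝ) (m : ℕ) :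
    Continuous fun z => min 1 (m * ‖B z.1 z.2‖) * g (sphereMap f B z) := by
  have hB := continuous_sphereBundle_norm hBc
  have hχ : Continuous fun z : X × sphere (0 : W) 1 => min 1 ((m : ℝ) * ‖B z.1 z.2‖) := by fun_prop
  refine continuous_iff_continuousAt.2 fun z => ?_
  -- At a kernel direction the cut-off tends to `0` and `g` is bounded, so the jump of `sphereMap`
  -- is invisible.
  by_cases hz : B z.1 z.2 = 0
  · have h0 : min 1 ((m : ℝ) * ‖B z.1 z.2‖) = 0 := by simp [hz]
    have hlim : Tendsto (fun z' : X × sphere (0 : W) 1 =>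
        min 1 ((m : ℝ) * ‖B z'.1 z'.2‖) * ‖g‖) (𝓝 z) (𝓝 0) := by
      have h := (hχ.tendsto z).mul_const ‖g‖
      rwa [h0, zero_mul] at h
    rw [ContinuousAt, h0, zero_mul]
    refine squeeze_zero_norm (fun z' => ?_) hlim
    rw [norm_mul]
    gcongr
    · rw [Real.norm_of_nonneg (by positivity)]
    · exact g.norm_coe_le_norm _
  · exact hχ.continuousAt.mul
      (g.continuous.continuousAt.comp (continuousAt_sphereMap hf hBc hz))

variable [FiniteDimensional ℝ W] [MeasurableSpace W] [BorelSpace W]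

/-- The integrands differ only where `‖B v‖ < 1 / m`, hence where the cost is at least `negLog (1 /
m)`; Markov's inequality bounds the mass of that set. -/
theorem abs_integral_sub_cutoff_le [MeasurableSpace X] [TopologicalSpace X]
    [BorelSpace X] [SecondCountableTopology X] (hf : Continuous f)
    (hBc : Continuous fun p : X × W => B p.1 p.2) (g : (X × sphere (0 : W) 1) →ᵇ ℝ) {m : ℕ} (hm0 : 0 < m)
    (hGm : Measurable (sphereMap f B)) (ν : Measure (X × sphere (0 : W) 1)) [IsProbabilityMeasure ν]
    {C : ℝ≥0∞} (hC : ∫⁻ z, sphereCost B z ∂ν ≤ C) (hC' : C ≠ ∞) (hm : negLog (1 / m) ≠ 0) :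
    |∫ z, g (sphereMap f B z) ∂ν - ∫ z, min 1 (m * ‖B z.1 z.2‖) * g (sphereMap f B z) ∂ν| ≤
      ‖g‖ * (C / negLog (1 / m)).toReal := by
  have hcm : Measurable (sphereCost B) := (continuous_sphereCost hBc).measurable
  set A : Set (X × sphere (0 : W) 1) := {z | negLog (1 / m) ≤ sphereCost B z} with hA
  have hAm : MeasurableSet A := measurableSet_le measurable_const hcm
  have hχ0 : ∀ z : X × sphere (0 : W) 1, 0 ≤ min 1 ((m : ℝ) * ‖B z.1 z.2‖) := fun z => by positivity
  have hi1 : Integrable (fun z => g (sphereMap f B z)) ν :=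
    Integrable.of_bound (g.continuous.measurable.comp hGm).aestronglyMeasurable ‖g‖
      (.of_forall fun z => g.norm_coe_le_norm _)
  have hi2 : Integrable (fun z => min 1 (m * ‖B z.1 z.2‖) * g (sphereMap f B z)) ν := by
    refine Integrable.of_bound (continuous_cutoff hf hBc g m).measurable.aestronglyMeasurable ‖g‖
      (.of_forall fun z => ?_)
    rw [norm_mul, Real.norm_of_nonneg (hχ0 z)]
    calc _ ≤ 1 * ‖g‖ := by gcongr; exacts [min_le_left _ _, g.norm_coe_le_norm _]
      _ = _ := one_mul _
  rw [← integral_sub hi1 hi2]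
  have hpt : ∀ z, ‖g (sphereMap f B z) - min 1 (m * ‖B z.1 z.2‖) * g (sphereMap f B z)‖ ≤
      A.indicator (fun _ => ‖g‖) z := by
    intro z
    have e : g (sphereMap f B z) - min 1 (m * ‖B z.1 z.2‖) * g (sphereMap f B z) =
      (1 - min 1 (m * ‖B z.1 z.2‖)) * g (sphereMap f B z) := by ring
    rw [e, norm_mul]
    by_cases hz : z ∈ A
    · rw [Set.indicator_of_mem hz]
      have h1 : ‖1 - min 1 ((m : ℝ) * ‖B z.1 z.2‖)‖ ≤ 1 := by
        rw [Real.norm_of_nonneg (sub_nonneg.2 (min_le_left _ _))]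
        linarith [hχ0 z]
      calc _ ≤ 1 * ‖g‖ := by gcongr; exact g.norm_coe_le_norm _
        _ = _ := one_mul _
    · rw [Set.indicator_of_notMem hz]
      have hlt : 1 / (m : ℝ) ≤ ‖B z.1 z.2‖ := by
        by_contra hcon
        exact hz (negLog_anti (not_le.1 hcon).le)
      have : 1 ≤ (m : ℝ) * ‖B z.1 z.2‖ := by
        rw [div_le_iff₀ (by exact_mod_cast hm0)] at hlt
        linarith
      rw [min_eq_left this]
      simp
  calc |∫ z, (g (sphereMap f B z) - min 1 (m * ‖B z.1 z.2‖) * g (sphereMap f B z)) ∂ν|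
      ≤ ∫ z, A.indicator (fun _ => ‖g‖) z ∂ν :=
        norm_integral_le_of_norm_le ((integrable_const _).indicator hAm) (.of_forall hpt)
    _ = ‖g‖ * ν.real A := by rw [integral_indicator_const _ hAm, smul_eq_mul, mul_comm]
    _ ≤ _ := by
      gcongr
      refine ENNReal.toReal_mono ?_ ?_
      · exact ENNReal.div_ne_top hC' hm
      · have htop : negLog (1 / m) ≠ ∞ := negLog_ne_top (by positivity)
        exact (meas_ge_le_lintegral_div hcm.aemeasurable hm htop).trans (by gcongr)

theorem tendsto_negLog_one_div_natCast : Tendsto (fun m : ℕ => negLog (1 / m)) atTop (𝓝 ∞) := by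
  have := (continuous_negLog.tendsto 0).comp tendsto_one_div_atTop_nhds_zero_nat
  rwa [negLog_zero] at this

/-- For finite `C` the functional is a uniform limit on `K` of the continuous cut-off functionals.
For injective `B` the map `sphereMap` is itself continuous. -/
theorem continuousOn_integral_comp_sphereMap [MeasurableSpace X] [TopologicalSpace X]
    [BorelSpace X] [SecondCountableTopology X] (hf : Continuous f)
    (hBc : Continuous fun p : X × W => B p.1 p.2) (hGm : Measurable (sphereMap f B)) {C : ℝ≥0∞}
    (hcase : C ≠ ∞ ∨ ∀ x, Function.Injective (B x)) {K : Set (ProbabilityMeasure (X × sphere (0 : W) 1))}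
    (hK : ∀ ν ∈ K, ∫⁻ z, sphereCost B z ∂(ν : Measure (X × sphere (0 : W) 1)) ≤ C)
    (g : (X × sphere (0 : W) 1) →ᵇ ℝ) :
    ContinuousOn (fun ν : ProbabilityMeasure (X × sphere (0 : W) 1) =>
      ∫ z, g (sphereMap f B z) ∂(ν : Measure (X × sphere (0 : W) 1))) K := by
  rcases hcase with hC | hinj
  · have hcont : ∀ m : ℕ, Continuous (fun ν : ProbabilityMeasure (X × sphere (0 : W) 1) =>
        ∫ z, min 1 (m * ‖B z.1 z.2‖) * g (sphereMap f B z)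
          ∂(ν : Measure (X × sphere (0 : W) 1))) := by
      intro m
      let h : (X × sphere (0 : W) 1) →ᵇ ℝ := BoundedContinuousFunction.ofNormedAddCommGroup
        (fun z => min 1 (m * ‖B z.1 z.2‖) * g (sphereMap f B z)) (continuous_cutoff hf hBc g m) ‖g‖
        (fun z => by
          rw [norm_mul, Real.norm_of_nonneg (by positivity)]
          calc _ ≤ 1 * ‖g‖ := by gcongr; exacts [min_le_left _ _, g.norm_coe_le_norm _]
            _ = _ := one_mul _)
      exact ProbabilityMeasure.continuous_integral_boundedContinuousFunction h
    have hu : TendstoUniformlyOn (fun (m : ℕ) (ν : ProbabilityMeasure (X × sphere (0 : W) 1)) =>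
        ∫ z, min 1 (m * ‖B z.1 z.2‖) * g (sphereMap f B z) ∂(ν : Measure (X × sphere (0 : W) 1)))
        (fun ν => ∫ z, g (sphereMap f B z) ∂(ν : Measure (X × sphere (0 : W) 1))) atTop K := by
      rw [Metric.tendstoUniformlyOn_iff]
      intro ε hε
      have hlim : Tendsto (fun m : ℕ => ‖g‖ * (C / negLog (1 / m)).toReal) atTop (𝓝 0) := by
        have h1 : Tendsto (fun m : ℕ => C / negLog (1 / m)) atTop (𝓝 (C / ∞)) :=
          ENNReal.Tendsto.const_div tendsto_negLog_one_div_natCast (.inr hC)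
        rw [ENNReal.div_top] at h1
        have h2 := (ENNReal.tendsto_toReal ENNReal.zero_ne_top).comp h1
        have h3 := h2.const_mul ‖g‖
        rwa [ENNReal.toReal_zero, mul_zero] at h3
      filter_upwards [hlim.eventually_lt_const hε, eventually_gt_atTop 0,
        tendsto_negLog_one_div_natCast.eventually_ne ENNReal.top_ne_zero] with m h1 h2 h3 ν hν
      rw [Real.dist_eq]
      exact (abs_integral_sub_cutoff_le hf hBc g h2 hGm ν (hK ν hν) hC h3).trans_lt h1
    exact hu.continuousOn (Frequently.of_forall fun m => (hcont m).continuousOn)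
  · exact (ProbabilityMeasure.continuous_integral_boundedContinuousFunction
      (g.compContinuous ⟨_, continuous_sphereMap hf hBc hinj⟩)).continuousOn

theorem measurePreserving_of_semiconj {Z X : Type*} [MeasurableSpace Z] [MeasurableSpace X]
    {ν : Measure Z} {p : Z → X} {G : Z → Z} {f : X → X} (hp : Measurable p) (hf : Measurable f)
    (h : ∀ z, p (G z) = f (p z)) (hν : MeasurePreserving G ν ν) :
    MeasurePreserving f (ν.map p) (ν.map p) := by
  refine ⟨hf, ?_⟩
  rw [Measure.map_map hf hp]
  have : f ∘ p = p ∘ G := funext fun z => (h z).symm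
  rw [this, ← Measure.map_map hp hν.measurable, hν.map_eq]

theorem lintegral_cocycleCost_le [MeasurableSpace X] {μ : Measure X} (hf : Measurable f)
    (hB : ∀ w, Measurable fun x => B x w) (hB1 : ∀ x w, ‖B x w‖ ≤ ‖w‖)
    {ν : Measure (X × sphere (0 : W) 1)} (hν : MeasurePreserving (sphereMap f B) ν ν)
    (hνμ : ν.map Prod.fst = μ) (n : ℕ) :
    ∫⁻ x, cocycleCost f B n x ∂μ ≤ n * ∫⁻ z, sphereCost B z ∂ν := by
  have hcm : Measurable (sphereCost B) := continuous_negLog.measurable.comp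
    ((measurable_linearFamily_apply hB).comp
      (measurable_fst.prodMk (measurable_subtype_coe.comp measurable_snd))).norm
  rw [← hνμ, lintegral_map (measurable_cocycleCost hf hB n) measurable_fst,
    ← hν.lintegral_birkhoffSum hcm]
  exact lintegral_mono fun z => cocycleCost_le_birkhoffSum hB1 n z

theorem negLog_le_add_of_le_mul {N : ℕ} (hN : 0 < N) {r s : ℝ} (hr : 0 ≤ r) (hr1 : r ≤ 1)
    (h : r ≤ N * s) : negLog s ≤ negLog r + negLog (N : ℝ)⁻¹ := by
  have hN' : (0 : ℝ) < N := by exact_mod_cast hN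
  rw [← negLog_mul hr hr1 (inv_le_one_of_one_le₀ (by exact_mod_cast hN))]
  refine negLog_anti ?_
  rw [mul_inv_le_iff₀ hN']
  linarith

/-- Krylov–Bogoliubov applied to almost maximal sections: lower semicontinuity keeps the cost of the
limit at most `c`, and `hcI` makes `c` a lower bound for every invariant lift, so the minimizers
form a face when `μ` is ergodic. -/
theorem exists_sphere_lift_of_continuous [Nontrivial W] [MeasurableSpace X] [TopologicalSpace X]
    [PolishSpace X] [BorelSpace X] {μ : Measure X} [IsProbabilityMeasure μ]
    (hfμ : MeasurePreserving f μ μ) (hf : Continuous f)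
    (hBc : Continuous fun p : X × W => B p.1 p.2) (hB1 : ∀ x w, ‖B x w‖ ≤ ‖w‖) {c : ℝ≥0∞}
    (hc : ∀ n, 0 < n → ∫⁻ x, cocycleCost f B n x ∂μ ≤ n * c)
    (hcI : ∀ I, (∀ n, 0 < n → ∫⁻ x, cocycleCost f B n x ∂μ ≤ n * I) → c ≤ I)
    (hcase : c ≠ ∞ ∨ ∀ x, Function.Injective (B x)) :
    ∃ ν : Measure (X × sphere (0 : W) 1), MeasurePreserving (sphereMap f B) ν ν ∧
      ν.map Prod.fst = μ ∧ ∫⁻ z, sphereCost B z ∂ν ≤ c ∧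
      (Ergodic f μ → Ergodic (sphereMap f B) ν) := by
  have hB : ∀ w, Measurable fun x => B x w := fun w =>
    (hBc.comp (continuous_id.prodMk continuous_const)).measurable
  have hGm := measurable_sphereMap hf.measurable hB
  have hcc := continuous_sphereCost (B := B) hBc
  set N := Module.finrank ℝ W
  have hN0 : 0 < N := Module.finrank_pos
  -- `D = log N` is the price of replacing a maximal vector by a basis vector.
  set D := negLog (N : ℝ)⁻¹ with hD
  have hDtop : D ≠ ∞ := negLog_ne_top (by positivity)
  set marg : Set (ProbabilityMeasure (X × sphere (0 : W) 1)) :=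
    {ν | (ν : Measure (X × sphere (0 : W) 1)).map Prod.fst = μ} with hmarg
  have hmargc : IsCompact marg := isCompact_setOf_map_fst_eq μ
  let T : ℝ≥0∞ → Set (ProbabilityMeasure (X × sphere (0 : W) 1)) := fun C =>
    {ν | ∫⁻ z, sphereCost B z ∂(ν : Measure (X × sphere (0 : W) 1)) ≤ C}
  have hT : ∀ C, IsClosed (T C) := fun C => isClosed_setOf_lintegral_le hcc C
  have hK : ∀ C, IsCompact (marg ∩ T C) := fun C => hmargc.inter_right (hT C)
  have hcont : ∀ C, (C ≠ ∞ ∨ ∀ x, Function.Injective (B x)) →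
      ∀ g : (X × sphere (0 : W) 1) →ᵇ ℝ,
      ContinuousOn (fun ν : ProbabilityMeasure (X × sphere (0 : W) 1) =>
        ∫ z, g (sphereMap f B z) ∂(ν : Measure (X × sphere (0 : W) 1))) (marg ∩ T C) :=
    fun C hC g => continuousOn_integral_comp_sphereMap hf hBc hGm hC (fun ν hν => hν.2) g
  -- the approximating measures
  have hseq : ∀ n : ℕ, ∃ ν : ProbabilityMeasure (X × sphere (0 : W) 1), ν ∈ marg ∧
      ν ∈ T (c + ((n + 1 : ℕ) : ℝ≥0∞)⁻¹ * D) ∧ ∀ g : (X × sphere (0 : W) 1) →ᵇ ℝ,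
        |∫ z, g (sphereMap f B z) ∂(ν : Measure (X × sphere (0 : W) 1)) -
          ∫ z, g z ∂(ν : Measure (X × sphere (0 : W) 1))| ≤ 2 * ‖g‖ / (n + 1 : ℕ) := by
    intro n
    set m := n + 1 with hm
    have hm0 : 0 < m := n.succ_pos
    obtain ⟨v, hvm, hv⟩ := exists_measurable_almost_maximal
      (T := fun x => (cocycle (E := fun _ : X => W) (f := f) B m x : W →ₗ[ℝ] W))
      (measurable_cocycle hf.measurable hB m)
    set ν₀ : Measure (X × sphere (0 : W) 1) := μ.map fun x => (x, v x) with hν₀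
    have hgm : Measurable fun x => (x, v x) := measurable_id.prodMk hvm
    have hp₀ : IsProbabilityMeasure ν₀ := Measure.isProbabilityMeasure_map hgm.aemeasurable
    have hp := isProbabilityMeasure_averageMap hGm ν₀ hm0
    refine ⟨⟨averageMap (sphereMap f B) ν₀ m, hp⟩, ?_, ?_, fun g => ?_⟩
    · refine map_averageMap hGm measurable_fst (fun z => rfl) hfμ ?_ hm0
      rw [hν₀, Measure.map_map measurable_fst hgm]
      exact Measure.map_id
    · change ∫⁻ z, sphereCost B z ∂(averageMap (sphereMap f B) ν₀ m) ≤ _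
      rw [lintegral_averageMap hGm ν₀ m hcc.measurable, hν₀,
        lintegral_map (measurable_birkhoffSum hcc.measurable hGm m) hgm]
      have hpt : ∀ x, birkhoffSum (sphereMap f B) (sphereCost B) m (x, v x) ≤
          cocycleCost f B m x + D := fun x => by
        rw [birkhoffSum_sphereCost hB1]
        exact negLog_le_add_of_le_mul hN0 (opNorm_nonneg _) (opNorm_cocycle_le_one hB1 _ _) (hv x)
      have hm1 : (m : ℝ≥0∞) ≠ 0 := by exact_mod_cast hm0.ne'
      calc (m : ℝ≥0∞)⁻¹ * ∫⁻ x, birkhoffSum (sphereMap f B) (sphereCost B) m (x, v x) ∂μ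
          ≤ (m : ℝ≥0∞)⁻¹ * ∫⁻ x, (cocycleCost f B m x + D) ∂μ := by gcongr with x; exact hpt x
        _ = (m : ℝ≥0∞)⁻¹ * (∫⁻ x, cocycleCost f B m x ∂μ + D) := by
          rw [lintegral_add_right _ measurable_const]; simp
        _ ≤ (m : ℝ≥0∞)⁻¹ * (m * c + D) := by gcongr; exact hc m hm0
        _ = c + (m : ℝ≥0∞)⁻¹ * D := by
          rw [mul_add, ← mul_assoc, ENNReal.inv_mul_cancel hm1 (by simp), one_mul]
    · exact abs_integral_averageMap_sub_le hGm ν₀ hm0 g.continuous.measurable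
        (fun z => g.norm_coe_le_norm z)
  choose νs hνm hνT hνg using hseq
  have hinvle : ∀ m n : ℕ, m ≤ n →
      c + ((n + 1 : ℕ) : ℝ≥0∞)⁻¹ * D ≤ c + ((m + 1 : ℕ) : ℝ≥0∞)⁻¹ * D := by
    intro m n hmn
    gcongr
  -- The averages over `n + 1` steps cost at most `c + D / (n + 1)`, so all lie in the compact set
  -- with bound `c + D`, the case `n = 0`.
  obtain ⟨ν, hνK, hνinv, hνcl⟩ := exists_measurePreserving_of_asymptotically_invariant hGm
    (hK (c + ((0 + 1 : ℕ) : ℝ≥0∞)⁻¹ * D))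
    (hcont _ (hcase.imp_left fun h => by
      simp only [zero_add, Nat.cast_one, inv_one, one_mul]
      exact ENNReal.add_ne_top.2 ⟨h, hDtop⟩)) νs
    (fun n => ⟨hνm n, (hνT n).trans (hinvle 0 n n.zero_le)⟩)
    (fun g => by
      refine squeeze_zero_norm (fun n => hνg n g) ?_
      exact (tendsto_const_div_atTop_nhds_zero_nat (2 * ‖g‖)).comp (tendsto_add_atTop_nat 1))
  have hνc : ν ∈ T c := by
    have h1 : ∀ m : ℕ, ∫⁻ z, sphereCost B z ∂(ν : Measure (X × sphere (0 : W) 1)) ≤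
        c + ((m + 1 : ℕ) : ℝ≥0∞)⁻¹ * D := fun m =>
      hνcl _ (hT _) ((eventually_ge_atTop m).mono fun n hn => (hνT n).trans (hinvle m n hn))
    have h2 : Tendsto (fun m : ℕ => c + ((m + 1 : ℕ) : ℝ≥0∞)⁻¹ * D) atTop (𝓝 (c + 0 * D)) :=
      tendsto_const_nhds.add (ENNReal.Tendsto.mul_const
        (ENNReal.tendsto_inv_nat_nhds_zero.comp (tendsto_add_atTop_nat 1)) (.inr hDtop))
    rw [zero_mul, add_zero] at h2
    exact ge_of_tendsto' h2 h1
  by_cases herg : Ergodic f μ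
  swap
  · exact ⟨ν, hνinv, hνK.1, hνc, fun h => absurd h herg⟩
  have hM := isCompact_inter_measurePreserving hGm (hK c) (hcont c hcase)
  suffices h : ∃ ρ ∈ marg ∩ T c ∩ {ν | MeasurePreserving (sphereMap f B)
      (ν : Measure (X × sphere (0 : W) 1)) ν}, Ergodic (sphereMap f B)
        (ρ : Measure (X × sphere (0 : W) 1)) by
    obtain ⟨ρ, hρ, hρerg⟩ := h
    exact ⟨ρ, hρ.2, hρ.1.1, hρ.1.2, fun _ => hρerg⟩
  refine exists_ergodic_of_isCompact_face hM ⟨ν, ⟨hνK.1, hνc⟩, hνinv⟩ (fun ν hν => hν.2) ?_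
  rintro ρ ⟨⟨hρm, hρc⟩, hρi⟩ ν₁ ν₂ h1 h2 a b ha hb hab hsum
  have hmap : ∀ ν : ProbabilityMeasure (X × sphere (0 : W) 1),
      MeasurePreserving (sphereMap f B) (ν : Measure (X × sphere (0 : W) 1)) ν →
      MeasurePreserving f ((ν : Measure (X × sphere (0 : W) 1)).map Prod.fst)
        ((ν : Measure (X × sphere (0 : W) 1)).map Prod.fst) ∧
      IsProbabilityMeasure ((ν : Measure (X × sphere (0 : W) 1)).map Prod.fst) := fun ν hν =>
    ⟨measurePreserving_of_semiconj measurable_fst hf.measurable (fun z => rfl) hν,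
      Measure.isProbabilityMeasure_map measurable_fst.aemeasurable⟩
  have hmeq : a • (ν₁ : Measure (X × sphere (0 : W) 1)).map Prod.fst +
      b • (ν₂ : Measure (X × sphere (0 : W) 1)).map Prod.fst = μ := by
    rw [← hρm, ← hsum, Measure.map_add _ _ measurable_fst, Measure.map_smul, Measure.map_smul]
  have hext := mem_extremePoints.1 herg.mem_extremePoints
  -- An ergodic `μ` is extreme, so both components of a decomposition are again lifts of `μ`.
  obtain ⟨e1, e2⟩ := hext.2 _ (hmap ν₁ h1) _ (hmap ν₂ h2) ⟨a, b, ha, hb, hab, hmeq⟩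
  have l1 := hcI _ fun n _ => lintegral_cocycleCost_le hf.measurable hB hB1 h1 e1 n
  have l2 := hcI _ fun n _ => lintegral_cocycleCost_le hf.measurable hB hB1 h2 e2 n
  have hsumc : a * ∫⁻ z, sphereCost B z ∂(ν₁ : Measure (X × sphere (0 : W) 1)) +
      b * ∫⁻ z, sphereCost B z ∂(ν₂ : Measure (X × sphere (0 : W) 1)) ≤ c := by
    refine le_trans (le_of_eq ?_) hρc
    rw [← hsum, lintegral_add_measure, lintegral_smul_measure, lintegral_smul_measure]
    rfl
  -- If a weighted mean is at most `c` and one term is at least `c`, the other is at most `c`.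
  -- Cancellation needs `c` finite; for `c = ∞` there is nothing to prove.
  have hfin : ∀ {a b r s : ℝ≥0∞}, 0 < a → a + b = 1 → c ≤ s → a * r + b * s ≤ c → r ≤ c := by
    intro a b r s ha hab hs h
    rcases eq_or_ne c ∞ with hct | hct
    · rw [hct]; exact le_top
    have ha1 : a ≠ ∞ := ne_top_of_le_ne_top ENNReal.one_ne_top (hab ▸ le_self_add)
    have hb1 : b ≠ ∞ := ne_top_of_le_ne_top ENNReal.one_ne_top (hab ▸ le_add_self)
    have h3 : a * r + b * c ≤ a * c + b * c := by
      calc a * r + b * c ≤ a * r + b * s := by gcongr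
        _ ≤ c := h
        _ = a * c + b * c := by rw [← add_mul, hab, one_mul]
    have h4 := (ENNReal.add_le_add_iff_right (ENNReal.mul_ne_top hb1 hct)).1 h3
    exact (ENNReal.mul_le_mul_iff_right ha.ne' ha1).1 h4
  refine ⟨⟨⟨e1, hfin ha hab l2 hsumc⟩, h1⟩, ⟨⟨e2, hfin hb ((add_comm _ _).trans hab) l1 ?_⟩, h2⟩⟩
  rwa [add_comm]

/-- **Optimal invariant lifts to the sphere bundle**: for a measurable cocycle of contractions over
a measure preserving map of a standard Borel space, there is an invariant lift whose mean cost is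
the mean growth cost of the cocycle, and it may be taken ergodic over an ergodic base. -/
theorem exists_sphere_lift [Nontrivial W] [MeasurableSpace X] [StandardBorelSpace X]
    {μ : Measure X} [IsProbabilityMeasure μ] (hfμ : MeasurePreserving f μ μ)
    (hB : ∀ w, Measurable fun x => B x w) (hB1 : ∀ x w, ‖B x w‖ ≤ ‖w‖) {c : ℝ≥0∞}
    (hc : ∀ n, 0 < n → ∫⁻ x, cocycleCost f B n x ∂μ ≤ n * c)
    (hcI : ∀ I, (∀ n, 0 < n → ∫⁻ x, cocycleCost f B n x ∂μ ≤ n * I) → c ≤ I)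
    (hcase : c ≠ ∞ ∨ ∀ x, Function.Injective (B x)) :
    ∃ ν : Measure (X × sphere (0 : W) 1), MeasurePreserving (sphereMap f B) ν ν ∧
      ν.map Prod.fst = μ ∧ ∫⁻ z, sphereCost B z ∂ν ≤ c ∧
      (Ergodic f μ → Ergodic (sphereMap f B) ν) := by
  obtain ⟨t, h1, h2, h3, h4⟩ := exists_polishSpace_continuous hfμ.measurable
    (φ := fun x i => B x (stdOrthonormalBasis ℝ W i)) (measurable_pi_lambda _ fun i => hB _)
  exact exists_sphere_lift_of_continuous hfμ h3
    (continuous_linearFamily_apply fun i => (continuous_apply i).comp h4) hB1 hc hcI hcase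

end SphereLift

/-! ### Norms on exterior powers and singular values. -/

section ExteriorNorm

variable {V V' : Type*} [NormedAddCommGroup V] [InnerProductSpace ℝ V] [FiniteDimensional ℝ V]
  [NormedAddCommGroup V'] [InnerProductSpace ℝ V'] [FiniteDimensional ℝ V']

/-- Both bilinear forms are Gram determinants on decomposable vectors, which span. -/
theorem extInner_eq_inner (k : ℕ) (x y : ⋀[ℝ]^k V) : extInner k x y = inner ℝ x y := by
  have : extInner (V := V) k = innerₗ (⋀[ℝ]^k V) := by
    apply exteriorPower.linearMap_ext
    ext v : 1
    simp only [LinearMap.compAlternatingMap_apply]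
    apply exteriorPower.linearMap_ext
    ext w
    simp only [LinearMap.compAlternatingMap_apply, extInner_ιMulti, innerₗ_apply_apply,
      exteriorPower.inner_ιMulti_ιMulti]
  rw [this, innerₗ_apply_apply]

theorem extNorm_eq_norm (k : ℕ) (w : ⋀[ℝ]^k V) : extNorm k w = ‖w‖ := by
  rw [extNorm, extInner_eq_inner, ← norm_eq_sqrt_real_inner]

/-- The Gram matrix is diagonal if `s = t`; otherwise an index of `t` missing from `s` gives a zero
row. -/
theorem inner_ιMulti_family_of_orthogonal {ι : Type*} [LinearOrder ι] {k : ℕ} {v : ι → V}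
    {c : ι → ℝ} (hv : ∀ i j, inner ℝ (v i) (v j) = if i = j then c i else 0)
    (s t : Set.powersetCard ι k) :
    inner ℝ (exteriorPower.ιMulti_family ℝ k v s) (exteriorPower.ιMulti_family ℝ k v t) =
      if s = t then ∏ j, c (Set.powersetCard.ofFinEmbEquiv.symm s j) else 0 := by
  simp only [exteriorPower.ιMulti_family, exteriorPower.inner_ιMulti_ιMulti, Function.comp_apply, hv]
  split_ifs with h
  · subst h
    have : (Matrix.of fun i j : Fin k =>
        if Set.powersetCard.ofFinEmbEquiv.symm s j = Set.powersetCard.ofFinEmbEquiv.symm s i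
          then c (Set.powersetCard.ofFinEmbEquiv.symm s j) else 0) =
        Matrix.diagonal fun j => c (Set.powersetCard.ofFinEmbEquiv.symm s j) := by
      ext i j
      simp only [Matrix.of_apply, Matrix.diagonal_apply, EmbeddingLike.apply_eq_iff_eq, @eq_comm _ j i]
      split_ifs with hij
      · rw [hij]
      · rfl
    rw [this, Matrix.det_diagonal]
  · obtain ⟨x, hxt, hxs⟩ := (Set.powersetCard.exists_mem_notMem_iff_ne t s).mp (.symm h)
    simp only [Set.mem_range, not_exists,
      ← Set.powersetCard.mem_range_ofFinEmbEquiv_symm_iff_mem] at hxs hxt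
    obtain ⟨i, rfl⟩ := hxt
    exact Matrix.det_eq_zero_of_row_eq_zero i fun j => if_neg (hxs j)

/-- If `T b` is orthogonal, then `⋀^k T` sends the exterior basis to an orthogonal family, and
Pythagoras applies. -/
theorem norm_sq_exteriorPower_map {ι : Type*} [Fintype ι] [LinearOrder ι] (b : OrthonormalBasis ι ℝ V)
    (T : V →ₗ[ℝ] V') {c : ι → ℝ}
    (hT : ∀ i j, inner ℝ (T (b i)) (T (b j)) = if i = j then c i else 0) (k : ℕ) (w : ⋀[ℝ]^k V) :
    ‖exteriorPower.map k T w‖ ^ 2 = ∑ s, (b.exteriorPower k).repr w s ^ 2 *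
      ∏ j, c (Set.powersetCard.ofFinEmbEquiv.symm s j) := by
  have hb : ∀ s, exteriorPower.map k T (b.exteriorPower k s) =
      exteriorPower.ιMulti_family ℝ k (T ∘ b) s := by
    intro s
    have : b.exteriorPower k s = exteriorPower.ιMulti_family ℝ k b s := by
      rw [← OrthonormalBasis.coe_toBasis, OrthonormalBasis.toBasis_exteriorPower,
        exteriorPower.coe_basis, OrthonormalBasis.coe_toBasis]
    rw [this, exteriorPower.ιMulti_family, exteriorPower.map_apply_ιMulti]
    rfl
  conv_lhs => rw [← (b.exteriorPower k).sum_repr w]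
  simp only [map_sum, map_smul, hb]
  rw [← real_inner_self_eq_norm_sq, sum_inner]
  refine Finset.sum_congr rfl fun s _ => ?_
  rw [inner_sum, Finset.sum_eq_single s]
  · rw [inner_smul_left, inner_smul_right, inner_ιMulti_family_of_orthogonal (v := T ∘ b) hT,
      if_pos rfl]
    simp only [conj_trivial]
    ring
  · intro t _ hts
    rw [inner_smul_left, inner_smul_right, inner_ιMulti_family_of_orthogonal (v := T ∘ b) hT,
      if_neg hts.symm]
    simp
  · simp

theorem norm_exteriorPower_map_isometry {d : ℕ} (b : OrthonormalBasis (Fin d) ℝ V) (e : V →ₗᵢ[ℝ] V')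
    (k : ℕ) (w : ⋀[ℝ]^k V) : ‖exteriorPower.map k e.toLinearMap w‖ = ‖w‖ := by
  have h1 := norm_sq_exteriorPower_map b e.toLinearMap (c := fun _ => 1)
    (fun i j => by
      simpa [orthonormal_iff_ite] using orthonormal_iff_ite.1 b.orthonormal i j) k w
  have h2 := norm_sq_exteriorPower_map b LinearMap.id (c := fun _ => 1)
    (fun i j => orthonormal_iff_ite.1 b.orthonormal i j) k w
  rw [exteriorPower.map_id, LinearMap.id_apply] at h2
  rw [← h2] at h1
  exact (sq_eq_sq₀ (norm_nonneg _) (norm_nonneg _)).1 h1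

/-- With antitone singular values, this makes the first `k` indices the ones of largest product. -/
theorem Fin.le_orderEmbedding {k d : ℕ} (g : Fin k ↪o Fin d) (j : Fin k) : (j : ℕ) ≤ g j := by
  obtain ⟨j, hj⟩ := j
  induction j with
  | zero => exact Nat.zero_le _
  | succ j ih =>
    have h1 := ih (by omega)
    have h2 : g ⟨j, by omega⟩ < g ⟨j + 1, hj⟩ := g.lt_iff_lt.2 (by simp)
    have h3 : (g ⟨j, by omega⟩ : ℕ) < g ⟨j + 1, hj⟩ := h2
    simp only at h1 ⊢
    omega

/-- The operator norm of `⋀^k T` is the product of the first `k` singular values; here `T` is a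
multiple of `L` read in isometric coordinates. -/
theorem opNorm_exteriorPower_map {U : Type*} [NormedAddCommGroup U] [InnerProductSpace ℝ U]
    [FiniteDimensional ℝ U] {d : ℕ} (hd : Module.finrank ℝ V = d) (e : U ≃ₗᵢ[ℝ] V)
    (L : V →ₗ[ℝ] V') (e' : U ≃ₗᵢ[ℝ] V') {r : ℝ} (hr : 0 ≤ r) (T : U →ₗ[ℝ] U)
    (hT : ∀ w, e' (T w) = r • L (e w)) {k : ℕ} (hk : k ≤ d) :
    opNorm (exteriorPower.map k T) = ∏ i ∈ Finset.range k, r * L.singularValues i := by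
  -- Right singular vectors of `L`, pulled back by `e`: `T` maps this basis to an orthogonal family
  -- with norms `r σ_i`.
  set b := (L.isSymmetric_adjoint_comp_self.eigenvectorBasis hd).map e.symm with hb
  set σ : ℕ → ℝ := fun i => r * L.singularValues i with hσ
  have hσ0 : ∀ i, 0 ≤ σ i := fun i => mul_nonneg hr (L.singularValues_nonneg i)
  have hσa : Antitone σ := fun i j hij => mul_le_mul_of_nonneg_left (L.singularValues_antitone hij) hr
  have hTb : ∀ i j, inner ℝ (T (b i)) (T (b j)) = if i = j then σ i ^ 2 else 0 := by
    intro i j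
    have hbi : ∀ i, e (b i) = L.isSymmetric_adjoint_comp_self.eigenvectorBasis hd i := fun i => by
      simp [hb]
    rw [← e'.inner_map_map, hT, hT, inner_smul_left, inner_smul_right, hbi, hbi,
      ← LinearMap.adjoint_inner_left]
    have := L.isSymmetric_adjoint_comp_self.apply_eigenvectorBasis hd i
    rw [LinearMap.comp_apply] at this
    rw [this, inner_smul_left,
      orthonormal_iff_ite.1 (L.isSymmetric_adjoint_comp_self.eigenvectorBasis hd).orthonormal,
      ← L.sq_singularValues_fin hd i]
    split_ifs
    · simp [hσ]; ring
    · simp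
  have hprod : ∀ s : Set.powersetCard (Fin d) k,
      ∏ j, (fun i : Fin d => σ i ^ 2) (Set.powersetCard.ofFinEmbEquiv.symm s j) ≤
        (∏ i ∈ Finset.range k, σ i) ^ 2 := by
    intro s
    rw [← Finset.prod_pow, ← Fin.prod_univ_eq_prod_range (fun i => σ i ^ 2) k]
    refine Finset.prod_le_prod (fun j _ => sq_nonneg _) fun j _ => ?_
    exact pow_le_pow_left₀ (hσ0 _) (hσa (Fin.le_orderEmbedding _ j)) 2
  have hP0 : 0 ≤ ∏ i ∈ Finset.range k, σ i := Finset.prod_nonneg fun i _ => hσ0 i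
  refine le_antisymm (opNorm_le hP0 fun w => ?_) ?_
  · refine (sq_le_sq₀ (norm_nonneg _) (by positivity)).1 ?_
    rw [norm_sq_exteriorPower_map b T hTb, mul_pow]
    have hw : ‖w‖ ^ 2 = ∑ s, (b.exteriorPower k).repr w s ^ 2 := by
      rw [← (b.exteriorPower k).repr.norm_map w, EuclideanSpace.norm_sq_eq]
      simp
    rw [hw, Finset.mul_sum]
    refine Finset.sum_le_sum fun s _ => ?_
    rw [mul_comm]
    gcongr
    exact hprod s
  · set s₀ : Set.powersetCard (Fin d) k := Set.powersetCard.ofFinEmbEquiv (Fin.castLEOrderEmb hk)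
    have hn : ‖exteriorPower.map k T (b.exteriorPower k s₀)‖ = ∏ i ∈ Finset.range k, σ i := by
      refine (sq_eq_sq₀ (norm_nonneg _) hP0).1 ?_
      rw [norm_sq_exteriorPower_map b T hTb, Finset.sum_eq_single s₀]
      · rw [← Finset.prod_pow, ← Fin.prod_univ_eq_prod_range (fun i => σ i ^ 2) k]
        simp [s₀]
      · intro s _ hs
        simp [hs]
      · simp
    have := le_opNorm (exteriorPower.map k T) (b.exteriorPower k s₀)
    rw [hn] at this
    simpa using this

-- By functoriality a linear left inverse of `T` induces one of `⋀^k T`.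
omit [FiniteDimensional ℝ V] [FiniteDimensional ℝ V'] in
theorem exteriorPower_map_injective {T : V →ₗ[ℝ] V'} (hT : Function.Injective T) (k : ℕ) :
    Function.Injective (exteriorPower.map k T) := by
  obtain ⟨S, hS⟩ := T.exists_leftInverse_of_injective (LinearMap.ker_eq_bot.2 hT)
  refine Function.LeftInverse.injective (g := exteriorPower.map k S) fun w => ?_
  rw [← LinearMap.comp_apply, ← exteriorPower.map_comp, hS, exteriorPower.map_id, LinearMap.id_apply]

end ExteriorNorm

/-! ### Borel structure on exterior powers. -/

section ExteriorBorel

variable {V : Type*} [NormedAddCommGroup V] [InnerProductSpace ℝ V] [FiniteDimensional ℝ V]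

theorem borelSpace_vectorBorel (W : Type*) [NormedAddCommGroup W] [NormedSpace ℝ W]
    [FiniteDimensional ℝ W] : @BorelSpace W _ (vectorBorel W) := by
  refine @BorelSpace.mk W _ (vectorBorel W) ?_
  rw [vectorBorel, ← (isModuleTopologyOfFiniteDimensional (𝕜 := ℝ) (E := W)).eq_moduleTopology']

/-- The matrix entries of `⋀^k T` are minors of `T`, polynomials in measurable functions. -/
theorem measurable_exteriorPower_map {X : Type*} [MeasurableSpace X] [MeasurableSpace V]
    [BorelSpace V] {T : X → V →ₗ[ℝ] V} (hT : ∀ v, Measurable fun x => T x v) (k : ℕ)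
    (w : ⋀[ℝ]^k V) :
    @Measurable X (⋀[ℝ]^k V) _ (vectorBorel _) fun x => exteriorPower.map k (T x) w := by
  let _ : MeasurableSpace (⋀[ℝ]^k V) := vectorBorel _
  have : BorelSpace (⋀[ℝ]^k V) := borelSpace_vectorBorel _
  set b := (stdOrthonormalBasis ℝ V).exteriorPower k with hb
  have h1 : (fun x => exteriorPower.map k (T x) w) =
      fun x => ∑ t, inner ℝ (b t) (exteriorPower.map k (T x) w) • b t := by
    funext x; exact (b.sum_repr' _).symm
  rw [h1]
  refine Finset.measurable_sum _ fun t _ => Measurable.smul_const ?_ _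
  have h2 : (fun x => inner ℝ (b t) (exteriorPower.map k (T x) w)) =
      fun x => ∑ s, inner ℝ (b s) w * inner ℝ (b t) (exteriorPower.map k (T x) (b s)) := by
    funext x
    conv_lhs => rw [← b.sum_repr' w]
    simp [map_sum, inner_sum, inner_smul_right]
  rw [h2]
  refine Finset.measurable_sum _ fun s _ => Measurable.const_mul ?_ _
  have hbs : ∀ s, b s = exteriorPower.ιMulti_family ℝ k (stdOrthonormalBasis ℝ V) s := fun s => by
    rw [hb, ← OrthonormalBasis.coe_toBasis, OrthonormalBasis.toBasis_exteriorPower,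
      exteriorPower.coe_basis, OrthonormalBasis.coe_toBasis]
  simp only [hbs, exteriorPower.ιMulti_family, exteriorPower.map_apply_ιMulti,
    exteriorPower.inner_ιMulti_ιMulti, Matrix.det_apply, Function.comp_apply, Matrix.of_apply]
  refine Finset.measurable_sum _ fun τ _ => Measurable.const_smul ?_ _
  exact Finset.measurable_prod _ fun i _ => measurable_const.inner (hT _)

end ExteriorBorel

/-! ### Global measurable orthonormal frames. -/

section Frames

variable {X : Type u} [MeasurableSpace X] {d : ℕ} {E : X → Type v}
  [∀ x, NormedAddCommGroup (E x)] [∀ x, InnerProductSpace ℝ (E x)]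
  [MeasurableSpace (BundleTotal d E)]

/-- Over `x` use the first chart whose base contains it; this glues the charts along a countable
measurable partition. -/
theorem exists_linear_frame [IsMeasurableEuclideanBundle d E] :
    ∃ e : ∀ x, EuclideanSpace ℝ (Fin d) ≃ₗ[ℝ] E x,
      MeasurableEmbedding fun p : X × EuclideanSpace ℝ (Fin d) =>
        (⟨p.1, e p.1 p.2⟩ : BundleTotal d E) := by
  classical
  obtain ⟨c, hc⟩ := IsMeasurableEuclideanBundle.exists_charts (d := d) (E := E)
  have hex : ∀ x, ∃ i, x ∈ (c i).base := fun x => Set.mem_iUnion.1 (hc ▸ Set.mem_univ x)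
  let n : X → ℕ := fun x => Nat.find (hex x)
  have hn : ∀ x, x ∈ (c (n x)).base := fun x => Nat.find_spec (hex x)
  have hnm : Measurable n := measurable_find hex fun i => (c i).measurableSet_base
  let e : ∀ x, EuclideanSpace ℝ (Fin d) ≃ₗ[ℝ] E x := fun x => (c (n x)).fiberEquiv ⟨x, hn x⟩
  let incl (i : ℕ) : (c i).base × EuclideanSpace ℝ (Fin d) → X × EuclideanSpace ℝ (Fin d) :=
    Prod.map Subtype.val id
  have hincl (i : ℕ) : MeasurableEmbedding (incl i) :=
    (MeasurableEmbedding.subtype_coe (c i).measurableSet_base).prodMap .id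
  let D (i : ℕ) : Set (X × EuclideanSpace ℝ (Fin d)) := {p | n p.1 = i}
  have hD (i : ℕ) : MeasurableSet (D i) := (hnm.comp measurable_fst) (measurableSet_singleton i)
  have heq (i : ℕ) (p : (c i).base × EuclideanSpace ℝ (Fin d)) (hp : incl i p ∈ D i) :
      (⟨p.1, (c i).fiberEquiv p.1 p.2⟩ : BundleTotal d E) = ⟨(incl i p).1, e p.1 p.2⟩ := by
    obtain ⟨⟨x, hx⟩, v⟩ := p
    have : n x = i := hp
    subst this
    rfl
  refine ⟨e, ?_, ?_, ?_⟩
  · rintro ⟨x, v⟩ ⟨y, w⟩ h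
    simp only [TotalSpace.mk.injEq] at h
    obtain ⟨rfl, h2⟩ := h
    rw [(e x).injective (eq_of_heq h2)]
  · intro s hs
    convert MeasurableSet.iUnion fun i =>
      ((hincl i).measurableSet_image.2 ((c i).measurableEmbedding.measurable hs)).inter (hD i) using 1
    ext ⟨x, v⟩
    simp only [Set.mem_preimage, Set.mem_iUnion, Set.mem_inter_iff, Set.mem_image]
    constructor
    · intro h
      exact ⟨n x, ⟨⟨⟨x, hn x⟩, v⟩, h, rfl⟩, rfl⟩
    · rintro ⟨i, ⟨p, hp, hpx⟩, hi⟩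
      obtain ⟨rfl, rfl⟩ := Prod.mk.inj hpx
      rwa [heq i p hi] at hp
  · intro s hs
    convert MeasurableSet.iUnion fun i => (c i).measurableEmbedding.measurableSet_image.2
      ((hincl i).measurable (hs.inter (hD i))) using 1
    ext z
    simp only [Set.mem_iUnion, Set.mem_image]
    constructor
    · rintro ⟨⟨x, v⟩, h, rfl⟩
      exact ⟨n x, ⟨⟨x, hn x⟩, v⟩, ⟨h, rfl⟩, rfl⟩
    · rintro ⟨i, p, hp, rfl⟩
      exact ⟨incl i p, hp.1, (heq i p hp.2).symm⟩

/-- A global frame, as a map from the trivial bundle to the total space. -/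
noncomputable def frameMap (e : ∀ x, EuclideanSpace ℝ (Fin d) ≃ₗᵢ[ℝ] E x) (p : X × EuclideanSpace ℝ (Fin d)) :
    BundleTotal d E := ⟨p.1, e p.1 p.2⟩

open InnerProductSpace in
/-- A measurable Euclidean bundle over a standard Borel space has a global measurable orthonormal
frame. -/
theorem exists_orthonormal_frame [StandardBorelSpace X] [∀ x, FiniteDimensional ℝ (E x)]
    [IsMeasurableEuclideanBundle d E] :
    ∃ e : ∀ x, EuclideanSpace ℝ (Fin d) ≃ₗᵢ[ℝ] E x, MeasurableEmbedding (frameMap e) := by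
  obtain ⟨e, he⟩ := exists_linear_frame (d := d) (E := E)
  have hnorm : Measurable fun p : X × EuclideanSpace ℝ (Fin d) => ‖e p.1 p.2‖ :=
    (IsMeasurableEuclideanBundle.measurable_norm (d := d) (E := E)).comp he.measurable
  have hnc : ∀ {u : X → EuclideanSpace ℝ (Fin d)}, Measurable u →
      Measurable fun x => ‖e x (u x)‖ := fun hu => hnorm.comp (measurable_id.prodMk hu)
  -- Only the norm is assumed measurable; polarization gives the inner products.
  have hic : ∀ {u v : X → EuclideanSpace ℝ (Fin d)}, Measurable u → Measurable v →
      Measurable fun x => inner ℝ (e x (u x)) (e x (v x)) := fun {u v} hu hv => by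
    simp only [real_inner_eq_norm_add_mul_self_sub_norm_mul_self_sub_norm_mul_self_div_two,
      ← map_add]
    have := hnc (hu.add hv)
    simp only [Pi.add_apply] at this
    exact (((this.mul this).sub ((hnc hu).mul (hnc hu))).sub ((hnc hv).mul (hnc hv))).div_const 2
  let b := EuclideanSpace.basisFun (Fin d) ℝ
  let g : ∀ x, Fin d → E x := fun x i => e x (b i)
  have hg : ∀ x, LinearIndependent ℝ (g x) := fun x =>
    b.toBasis.linearIndependent.map' (e x).toLinearMap (LinearEquiv.ker _)
  have hgs : ∀ i, Measurable fun x => (e x).symm (gramSchmidt ℝ (g x) i) := by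
    intro i
    induction i using WellFoundedLT.induction with
    | _ i ih =>
      have h1 : (fun x => (e x).symm (gramSchmidt ℝ (g x) i)) = fun x => b i -
          ∑ j ∈ Finset.Iio i,
            (inner ℝ (e x ((e x).symm (gramSchmidt ℝ (g x) j))) (e x (b i)) /
              ‖e x ((e x).symm (gramSchmidt ℝ (g x) j))‖ ^ 2) •
              (e x).symm (gramSchmidt ℝ (g x) j) := by
        funext x
        rw [gramSchmidt_def]
        simp [Submodule.starProjection_singleton, g]
      rw [h1]
      refine measurable_const.sub (Finset.measurable_sum _ fun j hj => ?_)
      have hj := ih j (Finset.mem_Iio.1 hj)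
      exact ((hic hj measurable_const).div ((hnc hj).pow_const 2)).smul hj
  have hdim : ∀ x, Module.finrank ℝ (E x) = Fintype.card (Fin d) := fun x => by
    rw [← (e x).finrank_eq]; simp
  have hne : ∀ x i, gramSchmidtNormed ℝ (g x) i ≠ 0 := fun x i h => by
    have := gramSchmidtNormed_unit_length (𝕜 := ℝ) i (hg x)
    rw [h] at this
    simp at this
  let e' : ∀ x, EuclideanSpace ℝ (Fin d) ≃ₗᵢ[ℝ] E x := fun x =>
    (gramSchmidtOrthonormalBasis (hdim x) (g x)).repr.symm
  have hT : Measurable fun p : X × EuclideanSpace ℝ (Fin d) => (p.1, (e p.1).symm (e' p.1 p.2)) := by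
    refine measurable_fst.prodMk ?_
    have h1 : (fun p : X × EuclideanSpace ℝ (Fin d) => (e p.1).symm (e' p.1 p.2)) = fun p =>
        ∑ i, p.2 i • ‖e p.1 ((e p.1).symm (gramSchmidt ℝ (g p.1) i))‖⁻¹ •
          (e p.1).symm (gramSchmidt ℝ (g p.1) i) := by
      funext p
      simp only [e']
      rw [← OrthonormalBasis.sum_repr_symm]
      simp [gramSchmidtOrthonormalBasis_apply (hdim p.1) (hne p.1 _), gramSchmidtNormed]
    rw [h1]
    refine Finset.measurable_sum _ fun i _ => ?_
    exact ((EuclideanSpace.proj (𝕜 := ℝ) i).continuous.measurable.comp measurable_snd).smul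
      (((hnc (hgs i)).comp measurable_fst).inv.smul ((hgs i).comp measurable_fst))
  refine ⟨e', ?_⟩
  -- Lusin–Souslin: an injective measurable map between standard Borel spaces is a measurable
  -- embedding.
  have hT' := hT.measurableEmbedding (by
    rintro ⟨x, v⟩ ⟨y, w⟩ h
    simp only [Prod.mk.injEq] at h
    obtain ⟨rfl, h2⟩ := h
    rw [(e' x).injective ((e x).symm.injective h2)])
  have := he.comp hT'
  convert this using 1
  funext p
  simp [frameMap]

end Frames

/-! ### The projective bundle read in a frame. -/

section ProjectiveFrames

variable {W W' : Type*} [AddCommGroup W] [Module ℝ W] [AddCommGroup W'] [Module ℝ W']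

theorem lineOrCemetery_zero : lineOrCemetery (0 : W) = none := dif_pos rfl

theorem lineOrCemetery_of_ne_zero {w : W} (hw : w ≠ 0) :
    lineOrCemetery w = some (Projectivization.mk ℝ w hw) := dif_neg hw

theorem lineOrCemetery_eq_none {w : W} : lineOrCemetery w = none ↔ w = 0 := by
  by_cases hw : w = 0 <;> simp [lineOrCemetery, hw]

theorem lineOrCemetery_rep (l : ℙ ℝ W) : lineOrCemetery l.rep = some l := by
  rw [lineOrCemetery_of_ne_zero l.rep_nonzero, l.mk_rep]

theorem lineOrCemetery_smul {c : ℝ} (hc : c ≠ 0) (w : W) :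
    lineOrCemetery (c • w) = lineOrCemetery w := by
  by_cases hw : w = 0
  · simp [hw]
  · rw [lineOrCemetery_of_ne_zero hw, lineOrCemetery_of_ne_zero (smul_ne_zero hc hw)]
    congr 1
    exact (Projectivization.mk_eq_mk_iff' ℝ _ _ _ _).2 ⟨c, rfl⟩

theorem exists_rep_mk {w : W} (hw : w ≠ 0) :
    ∃ c : ℝ, c ≠ 0 ∧ (Projectivization.mk ℝ w hw).rep = c • w := by
  obtain ⟨a, ha⟩ := Projectivization.exists_smul_eq_mk_rep ℝ w hw
  exact ⟨a, a.ne_zero, ha.symm⟩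

theorem exteriorPower_map_map {W'' : Type*} [AddCommGroup W''] [Module ℝ W''] {k : ℕ}
    (T : W →ₗ[ℝ] W') (S : W' →ₗ[ℝ] W'') (w : ⋀[ℝ]^k W) :
    exteriorPower.map k S (exteriorPower.map k T w) = exteriorPower.map k (S ∘ₗ T) w :=
  (LinearMap.congr_fun (exteriorPower.map_comp T S) w).symm

theorem exteriorPower_map_map_comm {W₁ W₂ : Type*} [AddCommGroup W₁] [Module ℝ W₁]
    [AddCommGroup W₂] [Module ℝ W₂] {k : ℕ} {T : W →ₗ[ℝ] W₁} {S : W₁ →ₗ[ℝ] W'}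
    {T' : W →ₗ[ℝ] W₂} {S' : W₂ →ₗ[ℝ] W'} (h : S ∘ₗ T = S' ∘ₗ T') (w : ⋀[ℝ]^k W) :
    exteriorPower.map k S (exteriorPower.map k T w) =
      exteriorPower.map k S' (exteriorPower.map k T' w) := by
  rw [exteriorPower_map_map, exteriorPower_map_map, h]

theorem exteriorPower_map_map_of_comp_eq_id {k : ℕ} {T : W →ₗ[ℝ] W'} {S : W' →ₗ[ℝ] W}
    (h : S ∘ₗ T = LinearMap.id) (w : ⋀[ℝ]^k W) :
    exteriorPower.map k S (exteriorPower.map k T w) = w := by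
  rw [exteriorPower_map_map, h, exteriorPower.map_id, LinearMap.id_apply]

variable {X : Type u} {d k : ℕ} {E : X → Type v}
  [∀ x, NormedAddCommGroup (E x)] [∀ x, InnerProductSpace ℝ (E x)]

/-- The representative of a line is a nonzero multiple of `u`, and rescaling does not change the
image line; `u = 0` encodes the cemetery. -/
theorem projMap_lineOrCemetery {f : X → X} (F : ∀ x, E x →ₗ[ℝ] E (f x)) (x : X)
    (u : ⋀[ℝ]^k (E x)) :
    projMap d F k ⟨x, lineOrCemetery u⟩ = ⟨f x, lineOrCemetery (exteriorPower.map k (F x) u)⟩ := by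
  by_cases hu : u = 0
  · subst hu
    rw [map_zero, lineOrCemetery_zero, lineOrCemetery_zero]
    rfl
  · obtain ⟨c, hc, h⟩ := exists_rep_mk hu
    rw [lineOrCemetery_of_ne_zero hu]
    simp only [projMap, h, map_smul, lineOrCemetery_smul hc]
    rfl

theorem projPotential_lineOrCemetery [∀ x, FiniteDimensional ℝ (E x)] {f : X → X}
    (F : ∀ x, E x →ₗ[ℝ] E (f x)) (x : X) (u : ⋀[ℝ]^k (E x)) :
    projPotential d F k ⟨x, lineOrCemetery u⟩ = logE (‖exteriorPower.map k (F x) u‖ / ‖u‖) := by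
  by_cases hu : u = 0
  · subst hu
    rw [lineOrCemetery_zero]
    -- Here `0 / 0 = 0`, so the quotient formula returns `log 0 = -∞` on the cemetery as well.
    simp [projPotential, logE]
  · obtain ⟨c, hc, h⟩ := exists_rep_mk hu
    rw [lineOrCemetery_of_ne_zero hu]
    simp only [projPotential, h, map_smul, extNorm_eq_norm, norm_smul]
    rw [mul_div_mul_left _ _ (norm_ne_zero_iff.2 hc)]

/-- The map `(x, w) ↦ (x, [⋀^k e_x w])` to the projective bundle with cemetery, for a frame `e`. -/
noncomputable def frameProj (e : ∀ x, EuclideanSpace ℝ (Fin d) ≃ₗᵢ[ℝ] E x)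
    (p : X × ⋀[ℝ]^k (EuclideanSpace ℝ (Fin d))) : ProjBundle d k E :=
  ⟨p.1, lineOrCemetery (exteriorPower.map k (e p.1).toLinearEquiv.toLinearMap p.2)⟩

/-- A bundle morphism read in a frame. -/
noncomputable def frameMatrix (e : ∀ x, EuclideanSpace ℝ (Fin d) ≃ₗᵢ[ℝ] E x) {f : X → X}
    (F : ∀ x, E x →ₗ[ℝ] E (f x)) (x : X) :
    EuclideanSpace ℝ (Fin d) →ₗ[ℝ] EuclideanSpace ℝ (Fin d) :=
  (e (f x)).symm.toLinearEquiv.toLinearMap ∘ₗ F x ∘ₗ (e x).toLinearEquiv.toLinearMap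

theorem frame_frameMatrix (e : ∀ x, EuclideanSpace ℝ (Fin d) ≃ₗᵢ[ℝ] E x) {f : X → X}
    (F : ∀ x, E x →ₗ[ℝ] E (f x)) (x : X) (v : EuclideanSpace ℝ (Fin d)) :
    e (f x) (frameMatrix e F x v) = F x (e x v) := by
  simp [frameMatrix]

theorem map_frame_frameMatrix (e : ∀ x, EuclideanSpace ℝ (Fin d) ≃ₗᵢ[ℝ] E x) {f : X → X}
    (F : ∀ x, E x →ₗ[ℝ] E (f x)) (x : X) (w : ⋀[ℝ]^k (EuclideanSpace ℝ (Fin d))) :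
    exteriorPower.map k (e (f x)).toLinearEquiv.toLinearMap
      (exteriorPower.map k (frameMatrix e F x) w) =
    exteriorPower.map k (F x) (exteriorPower.map k (e x).toLinearEquiv.toLinearMap w) :=
  exteriorPower_map_map_comm (LinearMap.ext fun v => frame_frameMatrix e F x v) w

theorem map_frame_injective (e : ∀ x, EuclideanSpace ℝ (Fin d) ≃ₗᵢ[ℝ] E x) (x : X) :
    Function.Injective (exteriorPower.map k (e x).toLinearEquiv.toLinearMap) :=
  exteriorPower_map_injective (e x).injective k

theorem projMap_frameProj (e : ∀ x, EuclideanSpace ℝ (Fin d) ≃ₗᵢ[ℝ] E x) {f : X → X}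
    (F : ∀ x, E x →ₗ[ℝ] E (f x)) (x : X) (w : ⋀[ℝ]^k (EuclideanSpace ℝ (Fin d))) :
    projMap d F k (frameProj e (x, w)) =
      frameProj e (f x, exteriorPower.map k (frameMatrix e F x) w) := by
  simp only [frameProj, map_frame_frameMatrix, projMap_lineOrCemetery]
  rfl

variable [∀ x, FiniteDimensional ℝ (E x)]

theorem norm_map_frame (e : ∀ x, EuclideanSpace ℝ (Fin d) ≃ₗᵢ[ℝ] E x) (x : X)
    (w : ⋀[ℝ]^k (EuclideanSpace ℝ (Fin d))) :
    ‖exteriorPower.map k (e x).toLinearEquiv.toLinearMap w‖ = ‖w‖ :=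
  norm_exteriorPower_map_isometry (EuclideanSpace.basisFun (Fin d) ℝ) (e x).toLinearIsometry k w

theorem projPotential_frameProj (e : ∀ x, EuclideanSpace ℝ (Fin d) ≃ₗᵢ[ℝ] E x) {f : X → X}
    (F : ∀ x, E x →ₗ[ℝ] E (f x)) (x : X) (w : ⋀[ℝ]^k (EuclideanSpace ℝ (Fin d))) :
    projPotential d F k (frameProj e (x, w)) =
      logE (‖exteriorPower.map k (frameMatrix e F x) w‖ / ‖w‖) := by
  refine (projPotential_lineOrCemetery F x _).trans
    (congrArg logE (congrArg₂ (· / ·) ?_ (norm_map_frame e x w)))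
  exact (congrArg norm (map_frame_frameMatrix e F x w)).symm.trans (norm_map_frame e (f x) _)

omit [∀ x, FiniteDimensional ℝ (E x)] in
theorem frameProj_surjective (e : ∀ x, EuclideanSpace ℝ (Fin d) ≃ₗᵢ[ℝ] E x) :
    Function.Surjective (frameProj (k := k) e) := by
  rintro ⟨x, _ | l⟩
  · exact ⟨(x, 0), congrArg (Sigma.mk x) (by simp [lineOrCemetery_zero])⟩
  · refine ⟨(x, exteriorPower.map k (e x).symm.toLinearEquiv.toLinearMap l.rep),
      congrArg (Sigma.mk x) ?_⟩
    exact (congrArg lineOrCemetery (exteriorPower_map_map_of_comp_eq_id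
      (LinearMap.ext fun v => (e x).apply_symm_apply v) l.rep)).trans (lineOrCemetery_rep l)

omit [∀ x, FiniteDimensional ℝ (E x)] in
theorem frameProj_mem_cemetery (e : ∀ x, EuclideanSpace ℝ (Fin d) ≃ₗᵢ[ℝ] E x)
    (p : X × ⋀[ℝ]^k (EuclideanSpace ℝ (Fin d))) :
    frameProj e p ∈ ProjBundle.cemetery d E k ↔ p.2 = 0 := by
  change lineOrCemetery _ = none ↔ _
  rw [lineOrCemetery_eq_none, map_eq_zero_iff _ (map_frame_injective e p.1)]

end ProjectiveFrames

/-! ### Measurability on the projective bundle. -/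

section ProjectiveMeasurability

/-- The Borel σ-algebra of `⋀^k ℝ^d`. -/
instance exteriorPowerMeasurableSpace (d k : ℕ) :
    MeasurableSpace (⋀[ℝ]^k (EuclideanSpace ℝ (Fin d))) := vectorBorel _

instance (d k : ℕ) : BorelSpace (⋀[ℝ]^k (EuclideanSpace ℝ (Fin d))) := borelSpace_vectorBorel _

variable {X : Type u} [MeasurableSpace X] {d k : ℕ} {E : X → Type v}
  [∀ x, NormedAddCommGroup (E x)] [∀ x, InnerProductSpace ℝ (E x)]
  [MeasurableSpace (BundleTotal d E)] {e : ∀ x, EuclideanSpace ℝ (Fin d) ≃ₗᵢ[ℝ] E x}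

theorem measurable_symm_frame (he : MeasurableEmbedding (frameMap e)) {Y : Type*}
    [MeasurableSpace Y] {g : Y → BundleTotal d E} (hg : Measurable g) :
    Measurable fun y => (e (g y).1).symm (g y).2 := by
  have : Measurable fun y => ((g y).1, (e (g y).1).symm (g y).2) := by
    rw [← he.measurable_comp_iff]
    convert hg using 1
    funext y
    simp [frameMap]
  exact measurable_snd.comp this

/-- The frame is itself a chart, and any other chart differs from it by a measurable family of
linear maps, so this single test implies all the others. -/
theorem measurableSet_projBundle_iff (he : MeasurableEmbedding (frameMap e))
    {s : Set (ProjBundle d k E)} : MeasurableSet s ↔ MeasurableSet (frameProj e ⁻¹' s) := by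
  rw [ProjBundle.measurableSpace, MeasurableSpace.measurableSet_iInf]
  simp only [MeasurableSpace.map_def]
  constructor
  · intro h
    let c : MeasurableChart d E :=
      { base := Set.univ
        measurableSet_base := .univ
        fiberEquiv := fun x => (e x).toLinearEquiv
        measurableEmbedding := he.comp ((MeasurableEmbedding.subtype_coe .univ).prodMap .id) }
    have hι : Measurable fun p : X × ⋀[ℝ]^k (EuclideanSpace ℝ (Fin d)) =>
        ((⟨p.1, Set.mem_univ p.1⟩ : c.base), p.2) :=
      (measurable_fst.subtype_mk).prodMk measurable_snd
    exact hι (h c)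
  · intro h c
    let T (x : c.base) : EuclideanSpace ℝ (Fin d) →ₗ[ℝ] EuclideanSpace ℝ (Fin d) :=
      (e x).symm.toLinearEquiv.toLinearMap ∘ₗ (c.fiberEquiv x).toLinearMap
    have hT (v) : Measurable fun x => T x v :=
      measurable_symm_frame he (g := fun x : c.base => ⟨x, c.fiberEquiv x v⟩)
        (c.measurableEmbedding.measurable.comp (measurable_id.prodMk measurable_const))
    have hq : c.toProj k = fun p => frameProj e ((p.1 : X), exteriorPower.map k (T p.1) p.2) := by
      funext p
      refine congrArg (Sigma.mk _) (congrArg lineOrCemetery ?_)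
      simp only
      rw [exteriorPower_map_map]
      congr 2
      exact LinearMap.ext fun v => ((e p.1).apply_symm_apply _).symm
    rw [hq]
    exact ((measurable_subtype_coe.comp measurable_fst).prodMk
      (measurable_linearFamily_apply (measurable_exteriorPower_map hT k))) h

theorem measurable_frameProj (he : MeasurableEmbedding (frameMap e)) :
    Measurable (frameProj (k := k) e) := fun _ hs => (measurableSet_projBundle_iff he).1 hs

theorem measurable_projBundle_iff (he : MeasurableEmbedding (frameMap e)) {Y : Type*}
    [MeasurableSpace Y] {g : ProjBundle d k E → Y} :
    Measurable g ↔ Measurable fun p => g (frameProj e p) :=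
  ⟨fun h => h.comp (measurable_frameProj he), fun h _ hs =>
    (measurableSet_projBundle_iff he).2 (h hs)⟩

theorem measurable_proj (he : MeasurableEmbedding (frameMap e)) :
    Measurable (ProjBundle.proj d E k) :=
  (measurable_projBundle_iff he).2 measurable_fst

theorem measurable_frameMatrix (he : MeasurableEmbedding (frameMap e)) {f : X → X}
    {F : ∀ x, E x →ₗ[ℝ] E (f x)} (hF : Measurable (totalMap d F)) (v : EuclideanSpace ℝ (Fin d)) :
    Measurable fun x => frameMatrix e F x v :=
  measurable_symm_frame he (g := fun x => totalMap d F (frameMap e (x, v)))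
    (hF.comp (he.measurable.comp (measurable_id.prodMk measurable_const)))

theorem measurable_map_frameMatrix (he : MeasurableEmbedding (frameMap e)) {f : X → X}
    {F : ∀ x, E x →ₗ[ℝ] E (f x)} (hF : Measurable (totalMap d F)) :
    Measurable fun p : X × ⋀[ℝ]^k (EuclideanSpace ℝ (Fin d)) =>
      exteriorPower.map k (frameMatrix e F p.1) p.2 :=
  measurable_linearFamily_apply (measurable_exteriorPower_map (measurable_frameMatrix he hF) k)

theorem measurable_projMap (he : MeasurableEmbedding (frameMap e)) {f : X → X} (hf : Measurable f)
    {F : ∀ x, E x →ₗ[ℝ] E (f x)} (hF : Measurable (totalMap d F)) :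
    Measurable (projMap d F k) := by
  rw [measurable_projBundle_iff he]
  have : (fun p => projMap d F k (frameProj e p)) = frameProj e ∘ fun p =>
      (f p.1, exteriorPower.map k (frameMatrix e F p.1) p.2) := by
    funext p
    exact projMap_frameProj e F p.1 p.2
  rw [this]
  exact (measurable_frameProj he).comp
    ((hf.comp measurable_fst).prodMk (measurable_map_frameMatrix he hF))

theorem measurableSet_cemetery (he : MeasurableEmbedding (frameMap e)) :
    MeasurableSet (ProjBundle.cemetery d E k) := by
  rw [measurableSet_projBundle_iff he]
  convert (measurable_snd (α := X) (β := ⋀[ℝ]^k (EuclideanSpace ℝ (Fin d))))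
    (measurableSet_singleton 0) using 1
  ext p
  exact frameProj_mem_cemetery e p

end ProjectiveMeasurability

/-! ### Differences of `[0, ∞]`-valued quantities in the extended reals. -/

section ExtendedReals

theorem EReal.coe_ennreal_sub_eq_sub {P M H U : ℝ≥0∞} (hP : P ≠ ∞) (hH : H ≠ ∞)
    (h : P + U = M + H) : (P : EReal) - M = H - U := by
  lift P to NNReal using hP
  lift H to NNReal using hH
  by_cases hU : U = ∞
  · subst hU
    have : M = ∞ := by
      by_contra hM
      exact ENNReal.add_ne_top.2 ⟨hM, ENNReal.coe_ne_top⟩ (h.symm.trans (by simp))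
    subst this
    simp [EReal.sub_top]
  · have hM : M ≠ ∞ := fun hM => ENNReal.add_ne_top.2 ⟨ENNReal.coe_ne_top, hU⟩ (h.trans (by simp [hM]))
    lift U to NNReal using hU
    lift M to NNReal using hM
    have h' : (P : ℝ) + U = M + H := by exact_mod_cast h
    simp only [EReal.coe_nnreal_eq_coe_real]
    norm_cast
    linarith

theorem EReal.sub_add_sub_comm_of_ne_top {a b c e : ℝ≥0∞} (ha : a ≠ ∞) (hc : c ≠ ∞) :
    ((a : EReal) - b) + (c - e) = ((a + c : ℝ≥0∞) : EReal) - ((b + e : ℝ≥0∞) : EReal) := by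
  lift a to NNReal using ha
  lift c to NNReal using hc
  by_cases hb : b = ∞
  · subst hb; simp [EReal.sub_top]
  by_cases he : e = ∞
  · subst he; simp [EReal.sub_top]
  lift b to NNReal using hb
  lift e to NNReal using he
  rw [← ENNReal.coe_add, ← ENNReal.coe_add]
  simp only [EReal.coe_nnreal_eq_coe_real]
  norm_cast
  push_cast
  ring

theorem EReal.sum_sub_eq {a : ℝ≥0∞} (ha : a ≠ ∞) (b : ℕ → ℝ≥0∞) (k : ℕ) :
    ∑ i ∈ Finset.range k, ((a : EReal) - b i) =
      ((k * a : ℝ≥0∞) : EReal) - ((∑ i ∈ Finset.range k, b i : ℝ≥0∞) : EReal) := by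
  induction k with
  | zero => simp
  | succ k ih =>
    rw [Finset.sum_range_succ, ih, Finset.sum_range_succ,
      EReal.sub_add_sub_comm_of_ne_top (ENNReal.mul_ne_top (by simp) ha) ha,
      Nat.cast_succ, add_one_mul]

theorem EReal.toENNReal_sub_add {a : ℝ≥0∞} (ha : a ≠ ∞) (b : ℝ≥0∞) :
    ((a : EReal) - b).toENNReal + b = (-((a : EReal) - b)).toENNReal + a := by
  have h1 : ((a : EReal) - b).toENNReal = a - b := by
    rw [EReal.toENNReal_sub (EReal.coe_ennreal_nonneg b)]; simp
  have h2 : (-((a : EReal) - b)).toENNReal = b - a := by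
    rw [EReal.neg_sub (.inl (by simp)) (.inl (by simpa using ha)), add_comm, ← sub_eq_add_neg,
      EReal.toENNReal_sub (EReal.coe_ennreal_nonneg a)]
    simp
  rw [h1, h2, tsub_add_eq_max, tsub_add_eq_max, max_comm]

theorem EReal.tendsto_coe_ennreal_sub {ι : Type*} {l : Filter ι} {u v : ι → ℝ≥0∞} {a b : ℝ≥0∞}
    (hu : Tendsto u l (𝓝 a)) (hv : Tendsto v l (𝓝 b)) (ha : a ≠ ∞) :
    Tendsto (fun i => (u i : EReal) - v i) l (𝓝 (a - b)) := by
  simp only [sub_eq_add_neg]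
  have h1 := (continuous_coe_ennreal_ereal.tendsto a).comp hu
  have h2 := (continuous_neg.tendsto _).comp ((continuous_coe_ennreal_ereal.tendsto b).comp hv)
  exact (EReal.continuousAt_add (p := ((a : EReal), -(b : EReal))) (.inl (by simpa using ha))
    (.inl (by simp))).tendsto.comp (h1.prodMk_nhds h2)

theorem EReal.coe_ennreal_sub_div {a b : ℝ≥0∞} (ha : a ≠ ∞) {n : ℕ} (hn : 0 < n) :
    ((a : EReal) - b) / (n : EReal) =
      ((a / n : ℝ≥0∞) : EReal) - ((b / n : ℝ≥0∞) : EReal) := by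
  lift a to NNReal using ha
  have hn' : (n : NNReal) ≠ 0 := by exact_mod_cast hn.ne'
  have h1 : ∀ r : NNReal, ((r : ℝ≥0∞) / n) = ((r / n : NNReal) : ℝ≥0∞) := fun r => by
    rw [ENNReal.coe_div hn']; simp
  have hnn : (n : EReal) = ((n : ℝ) : EReal) := by simp
  by_cases hb : b = ∞
  · subst hb
    rw [ENNReal.top_div_of_ne_top (by simp)]
    simp only [EReal.coe_ennreal_top, EReal.sub_top]
    exact EReal.bot_div_of_pos_ne_top (by exact_mod_cast hn) (by rw [hnn]; exact EReal.coe_ne_top _)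
  · lift b to NNReal using hb
    rw [h1, h1, hnn]
    simp only [EReal.coe_nnreal_eq_coe_real]
    rw [← EReal.coe_sub, ← EReal.coe_div, ← EReal.coe_sub, sub_div]
    simp

variable {Z : Type*} [MeasurableSpace Z] {ν : Measure Z}

/-- Almost everywhere `φ⁺ + u = φ⁻ + h`; integrate and cancel, which is legitimate because `φ⁺ ≤ h`
and `∫ h < ∞`. -/
theorem extIntegral_eq_sub {φ : Z → EReal} {h u : Z → ℝ≥0∞} (hh : Measurable h)
    (hu : Measurable u) (hfin : ∫⁻ z, h z ∂ν ≠ ∞) (hφ : ∀ᵐ z ∂ν, φ z = (h z : EReal) - u z) :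
    extIntegral ν φ = ((∫⁻ z, h z ∂ν : ℝ≥0∞) : EReal) - ((∫⁻ z, u z ∂ν : ℝ≥0∞) : EReal) := by
  have hm : Measurable fun z => (h z : EReal) - u z :=
    hh.coe_ereal_ennreal.sub hu.coe_ereal_ennreal
  have e1 : ∫⁻ z, (φ z).toENNReal ∂ν = ∫⁻ z, ((h z : EReal) - u z).toENNReal ∂ν :=
    lintegral_congr_ae (hφ.mono fun z hz => by simp only [hz])
  have e2 : ∫⁻ z, (-φ z).toENNReal ∂ν = ∫⁻ z, (-((h z : EReal) - u z)).toENNReal ∂ν :=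
    lintegral_congr_ae (hφ.mono fun z hz => by simp only [hz])
  rw [extIntegral, e1, e2]
  refine EReal.coe_ennreal_sub_eq_sub (ne_top_of_le_ne_top hfin (lintegral_mono fun z => ?_)) hfin ?_
  · rw [EReal.toENNReal_sub (EReal.coe_ennreal_nonneg _)]; simp
  · rw [← lintegral_add_right _ hu, ← lintegral_add_right _ hh]
    refine lintegral_congr_ae ?_
    filter_upwards [ae_lt_top hh hfin] with z hz
    exact EReal.toENNReal_sub_add hz.ne _

end ExtendedReals

/-! ### Factors of invariant and ergodic measures. -/

section PushForward

variable {X Y : Type*} [MeasurableSpace X] [MeasurableSpace Y] {μ : Measure X} {f : X → X}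
  {g : Y → Y} {p : X → Y}

theorem MeasureTheory.MeasurePreserving.map_of_ae_semiconj (hf : MeasurePreserving f μ μ)
    (hg : Measurable g) (hp : Measurable p) (h : ∀ᵐ x ∂μ, p (f x) = g (p x)) :
    MeasurePreserving g (μ.map p) (μ.map p) := by
  refine ⟨hg, ?_⟩
  rw [Measure.map_map hg hp]
  have h' : g ∘ p =ᵐ[μ] p ∘ f := h.mono fun x hx => hx.symm
  rw [Measure.map_congr h', ← Measure.map_map hp hf.measurable, hf.map_eq]

/-- An almost everywhere semiconjugacy is all that is available from the sphere bundle, since kernel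
directions are treated differently there and in the projective bundle. -/
theorem Ergodic.map_of_ae_semiconj (hf : Ergodic f μ) (hg : Measurable g) (hp : Measurable p)
    (h : ∀ᵐ x ∂μ, p (f x) = g (p x)) : Ergodic g (μ.map p) := by
  refine ⟨hf.toMeasurePreserving.map_of_ae_semiconj hg hp h, ⟨fun s hs hgs => ?_⟩⟩
  have hinv : f ⁻¹' (p ⁻¹' s) =ᵐ[μ] p ⁻¹' s := by
    refine h.mono fun x hx => ?_
    refine propext ?_
    change p (f x) ∈ s ↔ p x ∈ s
    rw [hx]
    conv_rhs => rw [← hgs]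
    rfl
  have := hf.quasiErgodic.aeconst_set₀ (hp hs).nullMeasurableSet hinv
  rw [eventuallyConst_set'] at this ⊢
  rcases this with h0 | h1
  · left
    rw [ae_eq_empty] at h0 ⊢
    rwa [Measure.map_apply hp hs]
  · right
    rw [ae_eq_univ] at h1 ⊢
    rwa [Measure.map_apply hp hs.compl]

end PushForward

/-! ### Individual rates from partial sums. -/

section Rates

variable {X : Type*} [MeasurableSpace X] {μ : Measure X} [IsFiniteMeasure μ] {f : X → X}

/-- If the partial sums of an increasing family of sequences of costs are superadditive over `f`,
each sequence has a limiting rate. -/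
theorem exists_rates (hf : MeasurePreserving f μ μ) {d : ℕ} {s : ℕ → ℕ → X → ℝ≥0∞}
    (hsm : ∀ k ≤ d, ∀ n, Measurable fun x => ∑ i ∈ Finset.range k, s i n x)
    (hs : ∀ k ≤ d, ∀ m n x, ∑ i ∈ Finset.range k, s i m x +
      ∑ i ∈ Finset.range k, s i n (f^[m] x) ≤ ∑ i ∈ Finset.range k, s i (m + n) x)
    (hmono : ∀ i j n x, i ≤ j → j < d → s i n x ≤ s j n x) :
    ∃ l : ℕ → X → ℝ≥0∞, (∀ i < d, Measurable (l i)) ∧ (∀ i < d, l i ∘ f =ᵐ[μ] l i) ∧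
      (∀ i < d, ∀ᵐ x ∂μ, Tendsto (fun n => s i n x / n) atTop (𝓝 (l i x))) ∧
      ∀ k ≤ d, (∀ n, 0 < n → ∫⁻ x, ∑ i ∈ Finset.range k, s i n x ∂μ ≤
          n * ∑ i ∈ Finset.range k, ∫⁻ x, l i x ∂μ) ∧
        ∀ I, (∀ n, 0 < n → ∫⁻ x, ∑ i ∈ Finset.range k, s i n x ∂μ ≤ n * I) →
          ∑ i ∈ Finset.range k, ∫⁻ x, l i x ∂μ ≤ I := by
  have key : ∀ k, ∃ G : X → ℝ≥0∞, k ≤ d → Measurable G ∧ G ∘ f =ᵐ[μ] G ∧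
      (∀ᵐ x ∂μ, Tendsto (fun n : ℕ => (∑ i ∈ Finset.range k, s i n x) / n) atTop (𝓝 (G x))) ∧
      (∀ n : ℕ, 0 < n → ∫⁻ x, ∑ i ∈ Finset.range k, s i n x ∂μ ≤ n * ∫⁻ x, G x ∂μ) ∧
      ∀ I, (∀ n : ℕ, 0 < n → ∫⁻ x, ∑ i ∈ Finset.range k, s i n x ∂μ ≤ n * I) →
        ∫⁻ x, G x ∂μ ≤ I := fun k => by
    by_cases hk : k ≤ d
    · obtain ⟨G, h⟩ := superadditive_ergodic hf (hsm k hk) (hs k hk)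
      exact ⟨G, fun _ => h⟩
    · exact ⟨0, fun h => absurd h hk⟩
  choose G hG using key
  classical
  -- Where the partial sum rate `G i` is infinite the difference is meaningless. There `s i`
  -- dominates the mean of the earlier terms by monotonicity, so its rate is `∞`.
  let l : ℕ → X → ℝ≥0∞ := fun i x => if G i x = ∞ then ∞ else G (i + 1) x - G i x
  have hlm : ∀ i < d, Measurable (l i) := fun i hi =>
    Measurable.ite ((hG i hi.le).1 (measurableSet_singleton _)) measurable_const
      ((hG (i + 1) hi).1.sub (hG i hi.le).1)
  have hlf : ∀ i < d, l i ∘ f =ᵐ[μ] l i := fun i hi => by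
    filter_upwards [(hG i hi.le).2.1, (hG (i + 1) hi).2.1] with x h1 h2
    simp only [Function.comp_apply] at h1 h2
    simp only [l, Function.comp_apply, h1, h2]
  have hlt : ∀ i < d, ∀ᵐ x ∂μ, Tendsto (fun n => s i n x / n) atTop (𝓝 (l i x)) := fun i hi => by
    filter_upwards [(hG i hi.le).2.2.1, (hG (i + 1) hi).2.2.1] with x h1 h2
    by_cases hx : G i x = ∞
    · simp only [l, if_pos hx]
      rw [hx] at h1
      have hi0 : i ≠ 0 := by
        rintro rfl
        simp only [Finset.range_zero, Finset.sum_empty, ENNReal.zero_div] at h1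
        exact ENNReal.zero_ne_top (tendsto_nhds_unique tendsto_const_nhds h1)
      have h3 := ENNReal.Tendsto.div_const (b := (i : ℝ≥0∞)) h1 (.inl (by simp))
      rw [ENNReal.top_div_of_ne_top (by simp)] at h3
      refine tendsto_nhds_top_mono h3 (.of_forall fun n => ?_)
      have h4 : ∑ j ∈ Finset.range i, s j n x ≤ i * s i n x := by
        refine (Finset.sum_le_card_nsmul _ _ (s i n x) fun j hj =>
          hmono j i n x (Finset.mem_range.1 hj).le hi).trans ?_
        simp
      calc (∑ j ∈ Finset.range i, s j n x) / n / i ≤ (i * s i n x) / n / i := by gcongr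
        _ = (i * (s i n x / n)) / i := by rw [mul_div_assoc]
        _ = s i n x / n := by
          rw [mul_comm]
          exact ENNReal.mul_div_cancel_right (by exact_mod_cast hi0) (by simp)
    · simp only [l, if_neg hx]
      refine (ENNReal.Tendsto.sub h2 h1 (.inr hx)).congr' ?_
      have h3 := h1.eventually (gt_mem_nhds (lt_top_iff_ne_top.2 hx))
      filter_upwards [h3] with n hn
      rw [Finset.sum_range_succ, ENNReal.add_div]
      exact ENNReal.add_sub_cancel_left hn.ne
  have hsum : ∀ k ≤ d, ∑ i ∈ Finset.range k, ∫⁻ x, l i x ∂μ = ∫⁻ x, G k x ∂μ := fun k hk => by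
    rw [← lintegral_finsetSum' _ fun i hi => (hlm i ((Finset.mem_range.1 hi).trans_le hk)).aemeasurable]
    refine lintegral_congr_ae ?_
    have : ∀ᵐ x ∂μ, ∀ i ∈ Finset.range k, Tendsto (fun n => s i n x / n) atTop (𝓝 (l i x)) :=
      (Finset.eventually_all _).2 fun i hi => hlt i ((Finset.mem_range.1 hi).trans_le hk)
    filter_upwards [this, (hG k hk).2.2.1] with x h1 h2
    refine tendsto_nhds_unique (tendsto_finsetSum _ h1) (h2.congr fun n => ?_)
    simp only [div_eq_mul_inv, Finset.sum_mul]
  refine ⟨l, hlm, hlf, hlt, fun k hk => ?_⟩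
  rw [hsum k hk]
  exact (hG k hk).2.2.2

/-- Birkhoff's theorem as the additive case of Kingman's. -/
theorem exists_birkhoff_rate (hf : MeasurePreserving f μ μ) {h : X → ℝ≥0∞} (hh : Measurable h) :
    ∃ H : X → ℝ≥0∞, Measurable H ∧ H ∘ f =ᵐ[μ] H ∧
      (∀ᵐ x ∂μ, Tendsto (fun n => birkhoffSum f h n x / n) atTop (𝓝 (H x))) ∧
      ∫⁻ x, H x ∂μ = ∫⁻ x, h x ∂μ := by
  obtain ⟨H, h1, h2, h3, h4, h5⟩ := superadditive_ergodic hf (measurable_birkhoffSum hh hf.measurable)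
    fun m n x => (birkhoffSum_add f h m n x).ge
  refine ⟨H, h1, h2, h3, le_antisymm (h5 _ fun n _ => (hf.lintegral_birkhoffSum hh n).le) ?_⟩
  simpa using h4 1 one_pos

end Rates

/-! ### Normalization by a scalar. -/

section Scaling

theorem Real.le_exp_posLog {r : ℝ} (hr : 0 ≤ r) : r ≤ Real.exp (Real.posLog r) := by
  rcases hr.eq_or_lt with rfl | h
  · positivity
  · calc r = Real.exp (Real.log r) := (Real.exp_log h).symm
      _ ≤ _ := Real.exp_le_exp.2 (le_max_right _ _)

theorem logE_eq_sub_negLog {r S : ℝ} (hr : 0 ≤ r) (hS : 0 ≤ S) (h : Real.exp (-S) * r ≤ 1) :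
    logE r = (ENNReal.ofReal S : EReal) - negLog (Real.exp (-S) * r) := by
  rw [coe_negLog h, EReal.coe_ennreal_ofReal, max_eq_left hS]
  rcases hr.eq_or_lt with rfl | h0
  · have : logE 0 = ⊥ := by simp [logE]
    rw [mul_zero, this]
    simp
  · rw [logE_of_pos (mul_pos (Real.exp_pos _) h0), logE_of_pos h0,
      Real.log_mul (Real.exp_pos _).ne' h0.ne', Real.log_exp]
    norm_cast
    ring

theorem EReal.toENNReal_sub_sub_cancel {a : ℝ≥0∞} (ha : a ≠ ∞) (b : ℝ≥0∞) :
    ((a : EReal) - ((a : EReal) - b)).toENNReal = b := by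
  lift a to NNReal using ha
  by_cases hb : b = ∞
  · subst hb; simp [EReal.sub_top]
  · lift b to NNReal using hb
    simp only [EReal.coe_nnreal_eq_coe_real]
    rw [← EReal.coe_sub, ← EReal.coe_sub, sub_sub_cancel, ← EReal.coe_nnreal_eq_coe_real,
      EReal.toENNReal_coe]

theorem exteriorPower_map_smul {V V' : Type*} [AddCommGroup V] [Module ℝ V] [AddCommGroup V']
    [Module ℝ V'] (k : ℕ) (c : ℝ) (T : V →ₗ[ℝ] V') :
    exteriorPower.map k (c • T) = c ^ k • exteriorPower.map k T := by
  apply exteriorPower.linearMap_ext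
  ext v : 1
  have : (c • T) ∘ v = fun i => c • T (v i) := rfl
  simp only [LinearMap.compAlternatingMap_apply, exteriorPower.map_apply_ιMulti,
    LinearMap.smul_apply, this]
  rw [AlternatingMap.map_smul_univ]
  simp [Function.comp_def]

end Scaling

/-! ### Costs of singular values of contractions. -/

section SingularCosts

variable {U V V' : Type*} [NormedAddCommGroup U] [InnerProductSpace ℝ U] [FiniteDimensional ℝ U]
  [NormedAddCommGroup V] [InnerProductSpace ℝ V] [FiniteDimensional ℝ V]
  [NormedAddCommGroup V'] [InnerProductSpace ℝ V'] [FiniteDimensional ℝ V']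

omit [FiniteDimensional ℝ U] in
-- Evaluate the contraction `T` at a unit singular vector.
theorem mul_singularValues_le_one {d : ℕ} (hd : Module.finrank ℝ V = d) (e : U ≃ₗᵢ[ℝ] V)
    (L : V →ₗ[ℝ] V') (e' : U ≃ₗᵢ[ℝ] V') {r : ℝ} (hr : 0 ≤ r) (T : U →ₗ[ℝ] U)
    (hT : ∀ w, e' (T w) = r • L (e w)) (hT1 : ∀ w, ‖T w‖ ≤ ‖w‖) {i : ℕ} (hi : i < d) :
    r * L.singularValues i ≤ 1 := by
  set b := L.isSymmetric_adjoint_comp_self.eigenvectorBasis hd ⟨i, hi⟩ with hb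
  have hb1 : ‖b‖ = 1 := (L.isSymmetric_adjoint_comp_self.eigenvectorBasis hd).orthonormal.1 _
  have hL : ‖L b‖ = L.singularValues i := by
    refine (sq_eq_sq₀ (norm_nonneg _) (L.singularValues_nonneg i)).1 ?_
    rw [← real_inner_self_eq_norm_sq, ← LinearMap.adjoint_inner_left]
    have := L.isSymmetric_adjoint_comp_self.apply_eigenvectorBasis hd ⟨i, hi⟩
    rw [LinearMap.comp_apply] at this
    rw [this, inner_smul_left, real_inner_self_eq_norm_sq, hb1, ← L.sq_singularValues_fin hd]
    simp
  calc r * L.singularValues i = ‖r • L (e (e.symm b))‖ := by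
        rw [norm_smul, Real.norm_of_nonneg hr, e.apply_symm_apply, hL]
    _ = ‖T (e.symm b)‖ := by rw [← hT, e'.norm_map]
    _ ≤ ‖e.symm b‖ := hT1 _
    _ = 1 := by rw [e.symm.norm_map, hb1]

theorem negLog_opNorm_exteriorPower_map {d : ℕ} (hd : Module.finrank ℝ V = d) (e : U ≃ₗᵢ[ℝ] V)
    (L : V →ₗ[ℝ] V') (e' : U ≃ₗᵢ[ℝ] V') {r : ℝ} (hr : 0 ≤ r) (T : U →ₗ[ℝ] U)
    (hT : ∀ w, e' (T w) = r • L (e w)) (hT1 : ∀ w, ‖T w‖ ≤ ‖w‖) {k : ℕ} (hk : k ≤ d) :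
    negLog (opNorm (exteriorPower.map k T)) =
      ∑ i ∈ Finset.range k, negLog (r * L.singularValues i) := by
  rw [opNorm_exteriorPower_map hd e L e' hr T hT hk, negLog_prod]
  · exact fun i _ => mul_nonneg hr (L.singularValues_nonneg i)
  · exact fun i hi => mul_singularValues_le_one hd e L e' hr T hT hT1
      ((Finset.mem_range.1 hi).trans_le hk)

theorem norm_exteriorPower_map_le {T : U →ₗ[ℝ] U} (hT1 : ∀ w, ‖T w‖ ≤ ‖w‖) {k : ℕ}
    (hk : k ≤ Module.finrank ℝ U) (w : ⋀[ℝ]^k U) : ‖exteriorPower.map k T w‖ ≤ ‖w‖ := by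
  have h : opNorm (exteriorPower.map k T) ≤ 1 := by
    rw [opNorm_exteriorPower_map rfl (LinearIsometryEquiv.refl ℝ U) T (LinearIsometryEquiv.refl ℝ U)
      zero_le_one T (fun w => by simp) hk]
    exact Finset.prod_le_one (fun i _ => mul_nonneg zero_le_one (T.singularValues_nonneg i))
      fun i hi => mul_singularValues_le_one rfl (LinearIsometryEquiv.refl ℝ U) T
        (LinearIsometryEquiv.refl ℝ U) zero_le_one T (fun w => by simp) hT1
        ((Finset.mem_range.1 hi).trans_le hk)
  calc _ ≤ _ := le_opNorm _ w
    _ ≤ 1 * ‖w‖ := by gcongr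
    _ = ‖w‖ := one_mul _

theorem cocycle_map {X : Type*} {f : X → X} (B : X → U →ₗ[ℝ] U) (k n : ℕ) (x : X) :
    cocycle (E := fun _ : X => ⋀[ℝ]^k U) (f := f) (fun x => exteriorPower.map k (B x)) n x =
      exteriorPower.map k (cocycle (E := fun _ : X => U) (f := f) B n x : U →ₗ[ℝ] U) := by
  induction n generalizing x with
  | zero => exact exteriorPower.map_id.symm
  | succ n ih =>
    rw [cocycle, ih]
    exact (exteriorPower.map_comp (B x) _).symm

end SingularCosts

/-! ### The contracted cocycle of a bundle morphism. -/

section Cocycle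

variable {X : Type u} {d k : ℕ} {E : X → Type v}
  [∀ x, NormedAddCommGroup (E x)] [∀ x, InnerProductSpace ℝ (E x)]
  [∀ x, FiniteDimensional ℝ (E x)] (e : ∀ x, EuclideanSpace ℝ (Fin d) ≃ₗᵢ[ℝ] E x) {f : X → X}
  (F : ∀ x, E x →ₗ[ℝ] E (f x))

/-- The function `log⁺ ‖F_x‖`. -/
noncomputable def logPlusNorm (x : X) : ℝ := Real.posLog ‖(F x).toContinuousLinearMap‖

/-- The morphism `e^{-log⁺ ‖F_x‖} F_x`, which is a contraction, read in a frame. -/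
noncomputable def contractedMatrix (x : X) :
    EuclideanSpace ℝ (Fin d) →ₗ[ℝ] EuclideanSpace ℝ (Fin d) :=
  Real.exp (-logPlusNorm F x) • frameMatrix e F x

theorem logPlusNorm_nonneg (x : X) : 0 ≤ logPlusNorm F x := Real.posLog_nonneg

theorem norm_contractedMatrix_le (x : X) (w : EuclideanSpace ℝ (Fin d)) :
    ‖contractedMatrix e F x w‖ ≤ ‖w‖ := by
  have h1 : ‖frameMatrix e F x w‖ ≤ Real.exp (logPlusNorm F x) * ‖w‖ := by
    rw [← (e (f x)).norm_map, frame_frameMatrix, ← (e x).norm_map w]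
    exact ((F x).toContinuousLinearMap.le_opNorm _).trans
      (mul_le_mul_of_nonneg_right (Real.le_exp_posLog (norm_nonneg _)) (norm_nonneg _))
  rw [contractedMatrix, LinearMap.smul_apply, norm_smul, Real.norm_of_nonneg (Real.exp_pos _).le]
  calc _ ≤ Real.exp (-logPlusNorm F x) * (Real.exp (logPlusNorm F x) * ‖w‖) := by gcongr
    _ = ‖w‖ := by rw [← mul_assoc, ← Real.exp_add]; simp

theorem norm_eq_opNorm_frameMatrix (x : X) :
    ‖(F x).toContinuousLinearMap‖ = opNorm (frameMatrix e F x) := by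
  refine le_antisymm (ContinuousLinearMap.opNorm_le_bound _ (opNorm_nonneg _) fun v => ?_)
    (opNorm_le (norm_nonneg _) fun w => ?_)
  · have h := le_opNorm (frameMatrix e F x) ((e x).symm v)
    rwa [← (e (f x)).norm_map, frame_frameMatrix, (e x).apply_symm_apply,
      (e x).symm.norm_map] at h
  · rw [← (e (f x)).norm_map, frame_frameMatrix, ← (e x).norm_map w]
    exact (F x).toContinuousLinearMap.le_opNorm _

theorem frame_cocycle (n : ℕ) (x : X) (w : EuclideanSpace ℝ (Fin d)) :
    e (f^[n] x) ((cocycle (E := fun _ : X => EuclideanSpace ℝ (Fin d)) (f := f)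
      (contractedMatrix e F) n x : EuclideanSpace ℝ (Fin d) →ₗ[ℝ] EuclideanSpace ℝ (Fin d)) w) =
      Real.exp (-birkhoffSum f (logPlusNorm F) n x) • cocycle F n x (e x w) := by
  induction n generalizing x w with
  | zero =>
    simp only [cocycle, birkhoffSum_zero, neg_zero, Real.exp_zero]
    exact (one_smul ℝ (e x w)).symm
  | succ n ih =>
    refine (ih (f x) (contractedMatrix e F x w)).trans ?_
    rw [birkhoffSum_succ', neg_add, Real.exp_add]
    simp only [contractedMatrix, LinearMap.smul_apply, map_smul, frame_frameMatrix, cocycle]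
    rw [smul_smul, mul_comm]
    rfl

/-- The cost `-log (e^{-S_n} σ_{i+1}(F^n_x))`, where `S_n` is the Birkhoff sum of `log⁺ ‖F‖`. -/
noncomputable def singularCost (i n : ℕ) (x : X) : ℝ≥0∞ :=
  negLog (Real.exp (-birkhoffSum f (logPlusNorm F) n x) * (cocycle F n x).singularValues i)

/-- The cocycle of contractions induced on `⋀^k ℝ^d`. -/
noncomputable def extMatrix (k : ℕ) (x : X) :
    ⋀[ℝ]^k (EuclideanSpace ℝ (Fin d)) →ₗ[ℝ] ⋀[ℝ]^k (EuclideanSpace ℝ (Fin d)) :=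
  exteriorPower.map k (contractedMatrix e F x)

omit [∀ x, FiniteDimensional ℝ (E x)] in
include e in
theorem finrank_of_frame (x : X) : Module.finrank ℝ (E x) = d := by
  rw [← (e x).toLinearEquiv.finrank_eq]; simp

/-- Through this identity the partial sums inherit the superadditivity of operator costs. -/
theorem sum_singularCost (hk : k ≤ d) (n : ℕ) (x : X) :
    ∑ i ∈ Finset.range k, singularCost F i n x = cocycleCost f (extMatrix e F k) n x := by
  rw [cocycleCost]
  unfold extMatrix
  rw [cocycle_map, negLog_opNorm_exteriorPower_map (finrank_of_frame e x) (e x) (cocycle F n x)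
    (e (f^[n] x)) (Real.exp_pos _).le _ (frame_cocycle e F n x)
    (norm_cocycle_le (norm_contractedMatrix_le e F) n x) hk]
  rfl

include e in
theorem mul_singularValues_cocycle_le_one {i : ℕ} (hi : i < d) (n : ℕ) (x : X) :
    Real.exp (-birkhoffSum f (logPlusNorm F) n x) * (cocycle F n x).singularValues i ≤ 1 :=
  mul_singularValues_le_one (finrank_of_frame e x) (e x) (cocycle F n x)
    (e (f^[n] x)) (Real.exp_pos _).le _ (frame_cocycle e F n x)
    (norm_cocycle_le (norm_contractedMatrix_le e F) n x) hi

theorem norm_extMatrix_le (hk : k ≤ d) (x : X) (w : ⋀[ℝ]^k (EuclideanSpace ℝ (Fin d))) :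
    ‖extMatrix e F k x w‖ ≤ ‖w‖ :=
  norm_exteriorPower_map_le (norm_contractedMatrix_le e F x) (by simpa using hk) w

theorem extMatrix_eq_smul (x : X) : extMatrix e F k x =
    Real.exp (-(k * logPlusNorm F x)) • exteriorPower.map k (frameMatrix e F x) := by
  rw [extMatrix, contractedMatrix, exteriorPower_map_smul, ← Real.exp_nat_mul, mul_neg]

theorem birkhoffSum_ofReal (n : ℕ) (x : X) :
    birkhoffSum f (fun x => ENNReal.ofReal (logPlusNorm F x)) n x =
      ENNReal.ofReal (birkhoffSum f (logPlusNorm F) n x) := by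
  simp only [birkhoffSum]
  rw [ENNReal.ofReal_sum_of_nonneg fun i _ => logPlusNorm_nonneg F _]

include e in
theorem singularRate_eq {i n : ℕ} (hi : i < d) (hn : 0 < n) (x : X) :
    singularRate F i n x =
      ((birkhoffSum f (fun x => ENNReal.ofReal (logPlusNorm F x)) n x / n : ℝ≥0∞) : EReal) -
        ((singularCost F i n x / n : ℝ≥0∞) : EReal) := by
  rw [singularRate, birkhoffSum_ofReal, logE_eq_sub_negLog ((cocycle F n x).singularValues_nonneg i)
    (Finset.sum_nonneg fun _ _ => logPlusNorm_nonneg F _)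
    (mul_singularValues_cocycle_le_one e F hi n x)]
  exact EReal.coe_ennreal_sub_div ENNReal.ofReal_ne_top hn

theorem singularCost_mono {i j : ℕ} (n : ℕ) (x : X) (hij : i ≤ j) :
    singularCost F i n x ≤ singularCost F j n x :=
  negLog_anti (mul_le_mul_of_nonneg_left ((cocycle F n x).singularValues_antitone hij)
    (Real.exp_pos _).le)

end Cocycle

/-! ### Costs of invariant lifts and the optimal lift. -/

section Lifts

variable {X : Type u} {d k : ℕ} {E : X → Type v}
  [∀ x, NormedAddCommGroup (E x)] [∀ x, InnerProductSpace ℝ (E x)]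
  [∀ x, FiniteDimensional ℝ (E x)] (e : ∀ x, EuclideanSpace ℝ (Fin d) ≃ₗᵢ[ℝ] E x) {f : X → X}
  (F : ∀ x, E x →ₗ[ℝ] E (f x))

omit [∀ x, FiniteDimensional ℝ (E x)] in
theorem frameProj_smul {c : ℝ} (hc : c ≠ 0) (x : X) (w : ⋀[ℝ]^k (EuclideanSpace ℝ (Fin d))) :
    frameProj e (x, c • w) = frameProj e (x, w) := by
  refine congrArg (Sigma.mk x) ?_
  simp only [map_smul, lineOrCemetery_smul hc]

theorem projMap_frameProj_extMatrix (x : X) (w : ⋀[ℝ]^k (EuclideanSpace ℝ (Fin d))) :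
    projMap d F k (frameProj e (x, w)) = frameProj e (f x, extMatrix e F k x w) := by
  rw [projMap_frameProj, extMatrix_eq_smul, LinearMap.smul_apply,
    frameProj_smul e (Real.exp_pos _).ne']

/-- The cost `k log⁺ ‖F_x‖ - φ_k(x, [w])`. -/
noncomputable def projCost (z : ProjBundle d k E) : ℝ≥0∞ :=
  (((k * ENNReal.ofReal (logPlusNorm F (z.proj d E k)) : ℝ≥0∞) : EReal) -
    projPotential d F k z).toENNReal

theorem projPotential_frameProj_eq_sub (hk : k ≤ d) (x : X)
    (w : ⋀[ℝ]^k (EuclideanSpace ℝ (Fin d))) :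
    projPotential d F k (frameProj e (x, w)) =
      ((k * ENNReal.ofReal (logPlusNorm F x) : ℝ≥0∞) : EReal) -
        negLog (‖extMatrix e F k x w‖ / ‖w‖) := by
  have h1 : ‖extMatrix e F k x w‖ / ‖w‖ = Real.exp (-(k * logPlusNorm F x)) *
      (‖exteriorPower.map k (frameMatrix e F x) w‖ / ‖w‖) := by
    rw [extMatrix_eq_smul, LinearMap.smul_apply, norm_smul,
      Real.norm_of_nonneg (Real.exp_pos _).le, mul_div_assoc]
  have h2 : ‖extMatrix e F k x w‖ / ‖w‖ ≤ 1 :=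
    div_le_one_of_le₀ (norm_extMatrix_le e F hk x w) (norm_nonneg _)
  rw [projPotential_frameProj, logE_eq_sub_negLog (by positivity)
    (mul_nonneg (Nat.cast_nonneg k) (logPlusNorm_nonneg F x)) (h1 ▸ h2), ← h1,
    ENNReal.ofReal_mul (Nat.cast_nonneg k), ENNReal.ofReal_natCast]

theorem projCost_frameProj (hk : k ≤ d) (x : X) (w : ⋀[ℝ]^k (EuclideanSpace ℝ (Fin d))) :
    projCost F (frameProj e (x, w)) = negLog (‖extMatrix e F k x w‖ / ‖w‖) := by
  rw [projCost, projPotential_frameProj_eq_sub e F hk]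
  exact EReal.toENNReal_sub_sub_cancel (ENNReal.mul_ne_top (by simp) ENNReal.ofReal_ne_top) _

include e in
theorem projPotential_eq_sub (hk : k ≤ d) (z : ProjBundle d k E) :
    projPotential d F k z =
      ((k * ENNReal.ofReal (logPlusNorm F (z.proj d E k)) : ℝ≥0∞) : EReal) - projCost F z := by
  obtain ⟨⟨x, w⟩, rfl⟩ := frameProj_surjective e z
  rw [projCost_frameProj e F hk, projPotential_frameProj_eq_sub e F hk]
  rfl

/-- Contraction ratios multiply along the orbit, and the right side is `∞` as soon as the vector is
killed. -/
theorem birkhoffSum_projCost (hk : k ≤ d) (n : ℕ) (x : X)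
    {w : ⋀[ℝ]^k (EuclideanSpace ℝ (Fin d))} (hw : w ≠ 0) :
    negLog (‖(cocycle (E := fun _ : X => ⋀[ℝ]^k (EuclideanSpace ℝ (Fin d))) (f := f)
      (extMatrix e F k) n x : ⋀[ℝ]^k (EuclideanSpace ℝ (Fin d)) →ₗ[ℝ] _) w‖ / ‖w‖) ≤
      birkhoffSum (projMap d F k) (projCost F) n (frameProj e (x, w)) := by
  induction n generalizing x w with
  | zero =>
    have : negLog (‖w‖ / ‖w‖) = 0 := by rw [div_self (norm_ne_zero_iff.2 hw), negLog_one]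
    exact this.le.trans zero_le
  | succ n ih =>
    rw [birkhoffSum_succ', projMap_frameProj_extMatrix, projCost_frameProj e F hk]
    by_cases h0 : extMatrix e F k x w = 0
    · rw [h0, norm_zero, zero_div, negLog_zero, top_add]
      exact le_top
    · refine le_trans ?_ (add_le_add_right (ih (f x) h0) _)
      rw [← negLog_mul (by positivity)
        (div_le_one_of_le₀ (norm_extMatrix_le e F hk x w) (norm_nonneg _))
        (div_le_one_of_le₀ (norm_cocycle_le (norm_extMatrix_le e F hk) n (f x) _) (norm_nonneg _)),
        mul_comm, div_mul_div_cancel₀ (norm_ne_zero_iff.2 h0)]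
      rfl

theorem cocycleCost_le_birkhoffSum_projCost (hk : k ≤ d) {n : ℕ} (hn : 0 < n)
    (z : ProjBundle d k E) : cocycleCost f (extMatrix e F k) n (z.proj d E k) ≤
      birkhoffSum (projMap d F k) (projCost F) n z := by
  obtain ⟨⟨x, w⟩, rfl⟩ := frameProj_surjective e z
  by_cases hw : w = 0
  · obtain ⟨n, rfl⟩ := Nat.exists_eq_succ_of_ne_zero hn.ne'
    rw [birkhoffSum_succ', projCost_frameProj e F hk, hw, norm_zero, div_zero, negLog_zero, top_add]
    exact le_top
  · refine le_trans (negLog_anti ?_) (birkhoffSum_projCost e F hk n x hw)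
    exact div_le_of_le_mul₀ (norm_nonneg _) (opNorm_nonneg _) (le_opNorm _ w)

variable [MeasurableSpace X] [MeasurableSpace (BundleTotal d E)] {e} {F} {μ : Measure X}

theorem measurable_logPlusNorm (he : MeasurableEmbedding (frameMap e))
    (hF : Measurable (totalMap d F)) : Measurable (logPlusNorm F) := by
  unfold logPlusNorm
  simp only [norm_eq_opNorm_frameMatrix e F]
  have := measurable_opNorm (measurable_frameMatrix he hF)
  unfold Real.posLog
  exact measurable_const.max (Real.measurable_log.comp this)

theorem measurable_extMatrix (he : MeasurableEmbedding (frameMap e))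
    (hF : Measurable (totalMap d F)) (w : ⋀[ℝ]^k (EuclideanSpace ℝ (Fin d))) :
    Measurable fun x => extMatrix e F k x w :=
  measurable_exteriorPower_map (fun v => (measurable_logPlusNorm he hF).neg.exp.smul
    (measurable_frameMatrix he hF v)) k w

theorem measurable_projCost (he : MeasurableEmbedding (frameMap e))
    (hF : Measurable (totalMap d F)) (hk : k ≤ d) :
    Measurable (projCost F : ProjBundle d k E → ℝ≥0∞) := by
  rw [measurable_projBundle_iff he]
  have : (fun p : X × ⋀[ℝ]^k (EuclideanSpace ℝ (Fin d)) => projCost F (frameProj e p)) =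
      fun p => negLog (‖extMatrix e F k p.1 p.2‖ / ‖p.2‖) :=
    funext fun p => projCost_frameProj e F hk p.1 p.2
  rw [this]
  exact continuous_negLog.measurable.comp
    ((measurable_linearFamily_apply (measurable_extMatrix he hF)).norm.div measurable_snd.norm)

/-- The first term depends only on `μ`: maximizing the potential amounts to minimizing the mean
cost. -/
theorem extIntegral_projPotential (he : MeasurableEmbedding (frameMap e))
    (hF : Measurable (totalMap d F)) (hk : k ≤ d)
    (hfin : ∫⁻ x, ENNReal.ofReal (logPlusNorm F x) ∂μ ≠ ∞) {ν : Measure (ProjBundle d k E)}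
    (hν : MeasurePreserving (ProjBundle.proj d E k) ν μ) :
    extIntegral ν (projPotential d F k) =
      ((k * ∫⁻ x, ENNReal.ofReal (logPlusNorm F x) ∂μ : ℝ≥0∞) : EReal) -
        ((∫⁻ z, projCost F z ∂ν : ℝ≥0∞) : EReal) := by
  have hm : Measurable fun x => k * ENNReal.ofReal (logPlusNorm F x) :=
    (measurable_logPlusNorm he hF).ennreal_ofReal.const_mul _
  have hi : ∫⁻ z, k * ENNReal.ofReal (logPlusNorm F (ProjBundle.proj d E k z)) ∂ν =
      k * ∫⁻ x, ENNReal.ofReal (logPlusNorm F x) ∂μ := by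
    rw [hν.lintegral_comp hm, lintegral_const_mul _ (measurable_logPlusNorm he hF).ennreal_ofReal]
  rw [← hi]
  refine extIntegral_eq_sub (hm.comp hν.measurable) (measurable_projCost he hF hk) ?_
    (.of_forall (projPotential_eq_sub e F hk))
  rw [hi]
  exact ENNReal.mul_ne_top (by simp) hfin

theorem lintegral_cocycleCost_le_projCost (he : MeasurableEmbedding (frameMap e))
    (hf : Measurable f) (hF : Measurable (totalMap d F)) (hk : k ≤ d)
    {ν : Measure (ProjBundle d k E)} (hν : ν ∈ invariantLifts d F k μ) {n : ℕ} (hn : 0 < n) :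
    ∫⁻ x, cocycleCost f (extMatrix e F k) n x ∂μ ≤ n * ∫⁻ z, projCost F z ∂ν := by
  rw [← hν.2.lintegral_comp (measurable_cocycleCost hf (measurable_extMatrix he hF) n),
    ← hν.1.lintegral_birkhoffSum (measurable_projCost he hF hk)]
  exact lintegral_mono fun z => cocycleCost_le_birkhoffSum_projCost e F hk hn z

/-- Invariant lifts that realize the mean growth rate of the cocycle. -/
theorem exists_optimal_lift [StandardBorelSpace X] [IsProbabilityMeasure μ]
    (he : MeasurableEmbedding (frameMap e)) (hf : MeasurePreserving f μ μ)
    (hF : Measurable (totalMap d F)) (hk : k ≤ d) {c : ℝ≥0∞}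
    (hc : ∀ n, 0 < n → ∫⁻ x, cocycleCost f (extMatrix e F k) n x ∂μ ≤ n * c)
    (hcI : ∀ I, (∀ n, 0 < n → ∫⁻ x, cocycleCost f (extMatrix e F k) n x ∂μ ≤ n * I) → c ≤ I) :
    ∃ ν ∈ invariantLifts d F k μ, ∫⁻ z, projCost F z ∂ν ≤ c ∧
      (Ergodic f μ → Ergodic (projMap d F k) ν) ∧
      ((∀ x, Function.Injective (F x)) → ν (ProjBundle.cemetery d E k) = 0) := by
  have hpm := measurable_projMap (k := k) he hf.measurable hF
  have hBm := measurable_extMatrix (k := k) he hF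
  have hinj : (∀ x, Function.Injective (F x)) → ∀ x, Function.Injective (extMatrix e F k x) := by
    intro h x
    refine exteriorPower_map_injective (fun v w hvw => ?_) k
    have h1 := smul_right_injective _ (Real.exp_pos (-logPlusNorm F x)).ne' hvw
    have h2 := congrArg (e (f x)) h1
    rw [frame_frameMatrix, frame_frameMatrix] at h2
    exact (e x).injective (h x h2)
  by_cases hcase : c ≠ ∞ ∨ ∀ x, Function.Injective (extMatrix e F k x)
  · have : Nontrivial (⋀[ℝ]^k (EuclideanSpace ℝ (Fin d))) := by
      refine Module.nontrivial_of_finrank_pos (R := ℝ) ?_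
      rw [exteriorPower.finrank_eq]
      simpa using Nat.choose_pos hk
    obtain ⟨ν, hν1, hν2, hν3, hν4⟩ := exists_sphere_lift hf hBm (norm_extMatrix_le e F hk) hc hcI hcase
    let p : X × Metric.sphere (0 : ⋀[ℝ]^k (EuclideanSpace ℝ (Fin d))) 1 → ProjBundle d k E :=
      fun z => frameProj e (z.1, z.2)
    have hp : Measurable p := (measurable_frameProj he).comp
      (measurable_fst.prodMk (measurable_subtype_coe.comp measurable_snd))
    have hcost : ∀ z, projCost F (p z) = sphereCost (extMatrix e F k) z := fun z => by
      rw [projCost_frameProj e F hk, sphereCost]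
      simp
    -- A killed direction has cost `∞`, which finite mean cost excludes almost everywhere;
    -- injectivity excludes it everywhere.
    have hne : ∀ᵐ z ∂ν, extMatrix e F k z.1 z.2 ≠ 0 := by
      rcases hcase with hcase | hcase
      · have hcm : Measurable (sphereCost (extMatrix e F k)) := by
          have := (measurable_projCost he hF hk).comp hp
          rwa [show projCost F ∘ p = _ from funext hcost] at this
        filter_upwards [ae_lt_top hcm (ne_top_of_le_ne_top hcase hν3)] with z hz h0
        rw [sphereCost, h0, norm_zero, negLog_zero] at hz
        exact lt_irrefl _ hz
      · refine .of_forall fun z h0 => ?_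
        have h1 : (z.2 : ⋀[ℝ]^k (EuclideanSpace ℝ (Fin d))) = 0 :=
          hcase z.1 (h0.trans (map_zero _).symm)
        have h2 : ‖(z.2 : ⋀[ℝ]^k (EuclideanSpace ℝ (Fin d)))‖ = 1 := by simp
        rw [h1, norm_zero] at h2
        exact zero_ne_one h2
    have hsemi : ∀ᵐ z ∂ν, p (sphereMap f (extMatrix e F k) z) = projMap d F k (p z) := by
      filter_upwards [hne] with z hz
      rw [projMap_frameProj_extMatrix]
      simp only [p, sphereMap]
      rw [coe_directionOr _ hz, frameProj_smul e (inv_ne_zero (norm_ne_zero_iff.2 hz))]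
    refine ⟨ν.map p, ⟨hν1.map_of_ae_semiconj hpm hp hsemi, measurable_proj he, ?_⟩, ?_, ?_, ?_⟩
    · rw [Measure.map_map (measurable_proj he) hp]
      exact hν2
    · rw [lintegral_map (measurable_projCost he hF hk) hp]
      simpa only [hcost] using hν3
    · exact fun h => (hν4 h).map_of_ae_semiconj hpm hp hsemi
    · intro _
      rw [Measure.map_apply hp (measurableSet_cemetery he)]
      convert measure_empty (μ := ν)
      refine Set.eq_empty_iff_forall_notMem.2 fun z hz => ?_
      have h1 : (z.2 : ⋀[ℝ]^k (EuclideanSpace ℝ (Fin d))) = 0 := (frameProj_mem_cemetery e _).1 hz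
      have h2 : ‖(z.2 : ⋀[ℝ]^k (EuclideanSpace ℝ (Fin d)))‖ = 1 := by simp
      rw [h1, norm_zero] at h2
      exact zero_ne_one h2
  · rw [not_or, not_ne_iff] at hcase
    -- Every lift is optimal when `c = ∞`; the cemetery section carries an invariant one.
    let p : X → ProjBundle d k E := fun x => frameProj e (x, 0)
    have hp : Measurable p := (measurable_frameProj he).comp (measurable_id.prodMk measurable_const)
    have hsemi : ∀ x, p (f x) = projMap d F k (p x) := fun x => by
      rw [projMap_frameProj, map_zero]
    refine ⟨μ.map p, ⟨hf.map_of_ae_semiconj hpm hp (.of_forall hsemi), measurable_proj he, ?_⟩,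
      hcase.1 ▸ le_top, fun h => h.map_of_ae_semiconj hpm hp (.of_forall hsemi),
      fun h => absurd (hinj h) hcase.2⟩
    rw [Measure.map_map (measurable_proj he) hp]
    exact Measure.map_id

end Lifts

/-! ### Lyapunov exponents and the variational formula. -/

section Exponents

variable {X : Type u} {d : ℕ} {E : X → Type v}
  [∀ x, NormedAddCommGroup (E x)] [∀ x, InnerProductSpace ℝ (E x)]
  [∀ x, FiniteDimensional ℝ (E x)] {e : ∀ x, EuclideanSpace ℝ (Fin d) ≃ₗᵢ[ℝ] E x} {f : X → X}
  {F : ∀ x, E x →ₗ[ℝ] E (f x)} [MeasurableSpace X] [MeasurableSpace (BundleTotal d E)]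
  {μ : Measure X} [IsProbabilityMeasure μ]

theorem exists_singular_rates (he : MeasurableEmbedding (frameMap e))
    (hf : MeasurePreserving f μ μ) (hF : Measurable (totalMap d F)) :
    ∃ l : ℕ → X → ℝ≥0∞, (∀ i < d, Measurable (l i)) ∧ (∀ i < d, l i ∘ f =ᵐ[μ] l i) ∧
      (∀ i < d, ∀ᵐ x ∂μ, Tendsto (fun n => singularCost F i n x / n) atTop (𝓝 (l i x))) ∧
      ∀ k ≤ d, (∀ n, 0 < n → ∫⁻ x, cocycleCost f (extMatrix e F k) n x ∂μ ≤
          n * ∑ i ∈ Finset.range k, ∫⁻ x, l i x ∂μ) ∧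
        ∀ I, (∀ n, 0 < n → ∫⁻ x, cocycleCost f (extMatrix e F k) n x ∂μ ≤ n * I) →
          ∑ i ∈ Finset.range k, ∫⁻ x, l i x ∂μ ≤ I := by
  obtain ⟨l, h1, h2, h3, h4⟩ := exists_rates hf (d := d) (s := singularCost F)
    (fun k hk n => by
      simp only [sum_singularCost e F hk]
      exact measurable_cocycleCost hf.measurable (measurable_extMatrix he hF) n)
    (fun k hk m n x => by
      simp only [sum_singularCost e F hk]
      exact cocycleCost_superadditive (norm_extMatrix_le e F hk) m n x)
    (fun i j n x hij _ => singularCost_mono F n x hij)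
  refine ⟨l, h1, h2, h3, fun k hk => ?_⟩
  have := h4 k hk
  simpa only [sum_singularCost e F hk] using this

theorem ae_eq_lintegral_of_ergodic {l : X → ℝ≥0∞} (hf : Ergodic f μ) (hl : Measurable l)
    (hlf : l ∘ f =ᵐ[μ] l) : ∀ᵐ x ∂μ, l x = ∫⁻ x, l x ∂μ := by
  obtain ⟨c, hc⟩ := hf.quasiErgodic.ae_eq_const_of_ae_eq_comp₀ hl.nullMeasurable hlf
  have : ∫⁻ x, l x ∂μ = c := by rw [lintegral_congr_ae hc]; simp
  rw [this]
  exact hc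

end Exponents

theorem mainTheorem4 {X : Type u} [MeasurableSpace X] [StandardBorelSpace X] (d : ℕ)
    (E : X → Type v) [∀ x, NormedAddCommGroup (E x)] [∀ x, InnerProductSpace ℝ (E x)]
    [∀ x, FiniteDimensional ℝ (E x)] [MeasurableSpace (BundleTotal d E)]
    [IsMeasurableEuclideanBundle d E]
    (μ : Measure X) [IsProbabilityMeasure μ] (f : X → X) (hf : MeasurePreserving f μ μ)
    (F : ∀ x, E x →ₗ[ℝ] E (f x)) (hF : Measurable (totalMap d F))
    (hint : Integrable (fun x => Real.posLog ‖(F x).toContinuousLinearMap‖) μ)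
    (k : ℕ) (hk : 1 ≤ k) (hkd : k ≤ d) :
    -- the Lyapunov exponents exist as limits, and are constant in the ergodic case
    (∀ i < d, ∀ᵐ x ∂μ,
      Tendsto (fun n => singularRate F i n x) atTop (𝓝 (pointwiseExponent F i x))) ∧
    (Ergodic f μ → ∀ i < d, ∀ᵐ x ∂μ, pointwiseExponent F i x = lyapunovExponent F μ i) ∧
    -- the variational formula
    (∑ i ∈ Finset.range k, lyapunovExponent F μ i =
      ⨆ ν ∈ invariantLifts d F k μ, extIntegral ν (projPotential d F k)) ∧
    -- the supremum is attained, and attained on an ergodic lift if `μ` is ergodic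
    (∃ ν ∈ invariantLifts d F k μ,
      extIntegral ν (projPotential d F k) = ∑ i ∈ Finset.range k, lyapunovExponent F μ i) ∧
    (Ergodic f μ → ∃ ν ∈ invariantLifts d F k μ, Ergodic (projMap d F k) ν ∧
      extIntegral ν (projPotential d F k) = ∑ i ∈ Finset.range k, lyapunovExponent F μ i) ∧
    -- the same without the cemetery section if `F` is nonsingular
    ((∀ x, Function.Injective (F x)) →
      (∑ i ∈ Finset.range k, lyapunovExponent F μ i =
        ⨆ ν ∈ {ν ∈ invariantLifts d F k μ | ν (ProjBundle.cemetery d E k) = 0},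
          extIntegral ν (projPotential d F k)) ∧
      (∃ ν ∈ invariantLifts d F k μ, ν (ProjBundle.cemetery d E k) = 0 ∧
        extIntegral ν (projPotential d F k) = ∑ i ∈ Finset.range k, lyapunovExponent F μ i) ∧
      (Ergodic f μ → ∃ ν ∈ invariantLifts d F k μ, ν (ProjBundle.cemetery d E k) = 0 ∧
        Ergodic (projMap d F k) ν ∧
        extIntegral ν (projPotential d F k) =
          ∑ i ∈ Finset.range k, lyapunovExponent F μ i)) := by
  obtain ⟨e, he⟩ := exists_orthonormal_frame (d := d) (E := E)
  have hhm : Measurable fun x => ENNReal.ofReal (logPlusNorm F x) :=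
    (measurable_logPlusNorm he hF).ennreal_ofReal
  set a : ℝ≥0∞ := ∫⁻ x, ENNReal.ofReal (logPlusNorm F x) ∂μ with ha
  have hfin : a ≠ ∞ := hint.lintegral_lt_top.ne
  obtain ⟨H, hHm, hHf, hHt, hHi⟩ := exists_birkhoff_rate hf hhm
  obtain ⟨l, hlm, hlf, hlt, hlk⟩ := exists_singular_rates he hf hF
  rw [← ha] at hHi
  have hHfin : ∀ᵐ x ∂μ, H x < ∞ := ae_lt_top hHm (hHi ▸ hfin)
  -- Each exponent is the Birkhoff limit `H` of `log⁺ ‖F‖`, finite almost everywhere, minus the rate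
  -- of the singular cost; the difference is never `∞ - ∞`.
  have hlim : ∀ i < d, ∀ᵐ x ∂μ,
      Tendsto (fun n => singularRate F i n x) atTop (𝓝 ((H x : EReal) - l i x)) := fun i hi => by
    filter_upwards [hHt, hlt i hi, hHfin] with x h1 h2 h3
    refine (EReal.tendsto_coe_ennreal_sub h1 h2 h3.ne).congr' ?_
    filter_upwards [eventually_gt_atTop 0] with n hn
    exact (singularRate_eq e F hi hn x).symm
  have hpt : ∀ i < d, ∀ᵐ x ∂μ, pointwiseExponent F i x = (H x : EReal) - l i x := fun i hi =>
    (hlim i hi).mono fun x hx => hx.limsup_eq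
  have hly : ∀ i < d, lyapunovExponent F μ i = (a : EReal) - ((∫⁻ x, l i x ∂μ : ℝ≥0∞) : EReal) :=
    fun i hi => by
      rw [lyapunovExponent, extIntegral_eq_sub hHm (hlm i hi) (hHi ▸ hfin) (hpt i hi), hHi]
  have hsum : ∑ i ∈ Finset.range k, lyapunovExponent F μ i = ((k * a : ℝ≥0∞) : EReal) -
      ((∑ i ∈ Finset.range k, ∫⁻ x, l i x ∂μ : ℝ≥0∞) : EReal) := by
    rw [← EReal.sum_sub_eq hfin]
    exact Finset.sum_congr rfl fun i hi => hly i ((Finset.mem_range.1 hi).trans_le hkd)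
  have hle : ∀ ν ∈ invariantLifts d F k μ,
      extIntegral ν (projPotential d F k) ≤ ∑ i ∈ Finset.range k, lyapunovExponent F μ i := by
    intro ν hν
    rw [extIntegral_projPotential he hF hkd hfin hν.2, hsum]
    refine EReal.sub_le_sub le_rfl (EReal.coe_ennreal_le_coe_ennreal_iff.2 ?_)
    -- The summed rates are the least constant dominating the mean operator costs, and the mean cost
    -- of any invariant lift is such a constant.
    exact (hlk k hkd).2 _ fun n hn =>
      lintegral_cocycleCost_le_projCost he hf.measurable hF hkd hν hn
  obtain ⟨ν, hν, hνc, hνe, hνΔ⟩ := exists_optimal_lift he hf hF hkd (hlk k hkd).1 (hlk k hkd).2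
  have hνeq : extIntegral ν (projPotential d F k) =
      ∑ i ∈ Finset.range k, lyapunovExponent F μ i := by
    refine le_antisymm (hle ν hν) ?_
    rw [extIntegral_projPotential he hF hkd hfin hν.2, hsum]
    exact EReal.sub_le_sub le_rfl (EReal.coe_ennreal_le_coe_ennreal_iff.2 hνc)
  refine ⟨fun i hi => ?_, fun herg i hi => ?_, ?_, ⟨ν, hν, hνeq⟩, fun h => ⟨ν, hν, hνe h, hνeq⟩,
    fun hinj => ⟨?_, ⟨ν, hν, hνΔ hinj, hνeq⟩, fun h => ⟨ν, hν, hνΔ hinj, hνe h, hνeq⟩⟩⟩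
  · filter_upwards [hlim i hi, hpt i hi] with x h1 h2
    rwa [h2]
  · filter_upwards [hpt i hi, ae_eq_lintegral_of_ergodic herg hHm hHf,
      ae_eq_lintegral_of_ergodic herg (hlm i hi) (hlf i hi)] with x h1 h2 h3
    rw [h1, hly i hi, h2, h3, hHi]
  · exact le_antisymm (hνeq ▸ le_iSup₂_of_le ν hν le_rfl) (iSup₂_le hle)
  · exact le_antisymm (hνeq ▸ le_iSup₂_of_le ν ⟨hν, hνΔ hinj⟩ le_rfl)
      (iSup₂_le fun ν' hν' => hle ν' hν'.1)
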